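/- **Theorem (Characterization of the maximal globally hyperbolic development).** Consider on $\mathbb R_t\times\mathbb R_x$ the Cauchy problem $$-\partial_t^2\Phi-\Psi\,\partial_t\partial_x\Phi+2(2+\Psi)\,\partial_x^2\Phi=0,\qquad \Psi:=\partial_t\Phi-2\partial_x\Phi,\qquad \big(\Phi(0,x),\partial_t\Phi(0,x)\big)=(0,-\arctan x),$$ with acoustical metric $$\mathbf g=\mathbf g(\Psi)=-\frac{8(2+\Psi)}{(4+\Psi)^2}\,dt^2-\frac{2\Psi}{(4+\Psi)^2}(dt\otimes dx+dx\otimes dt)+\frac{4}{(4+\Psi)^2}\,dx^2$$ and characteristic vector fields $L=\partial_t+(2+\Psi)\partial_x$, $\underline L=\partial_t-2\partial_x$. *Definitions.* A globally hyperbolic development (GHD) is a pair $(\Omega,\Phi)$ of an open set $\Omega\supset\{t=0\}$ and a $C^\infty$ solution $\Phi:\Omega\to\mathbb R$ of the Cauchy problem such that $\mathbf g$ is Lorentzian on $\Omega$ and every timelike $C^1$ curve in $\Omega$ that is inextendible (it has a limit in $\Omega$ at neither end of its parameter interval) meets $\{t=0\}$ exactly once. It is maximal (an MGHD) if there is no GHD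 $(\Omega',\Phi')$ with $\Omega\subsetneq\Omega'$ and $\Phi'|_\Omega=\Phi$. Set $\gamma_y(t):=(t,\,y+t(2-\arctan y))$, $\mathscr S(z):=(1+z^2,\,(2-\arctan z)(1+z^2)+z)$ and $$\Omega_C:=\{\gamma_y(t): y>0,\ t<1+y^2\}\cup\Big\{\gamma_y(t): y\le 0,\ t<\tfrac{4-y}{4-\arctan y}\Big\},$$ $$\mathcal B:=\{(t,x):t>1,\ x=x_{\mathcal B}(t)\},\quad \mathcal S:=\{(1,2)\},\quad \underline{\mathcal C}:=\{(t,x):t>1,\ x=4-2t\},$$ where $x_{\mathcal B}(t)$ is the $x$-coordinate of $\mathscr S(\sqrt{t-1})$. For $p\in\overline{\Omega_C}$, a function is $C^{0,\alpha}$ (resp. $C^{1,\alpha}$) at $p$ if on the intersection of $\overline{\Omega_C}$ with a neighbourhood of $p$ it is $\alpha$-Hölder (resp. differentiable within $\overline{\Omega_C}$ with $\alpha$-Hölder derivative). Then: 1. [Existence] $\Omega_C\subsetneq\mathbb R^2$ is open and there is a smooth classical solution $\Phi_C$ of the Cauchy problem on $\Omega_C$, with $\Psi_C=\partial_t\Phi_C-2\partial_x\Phi_C\in(-\frac\pi2,\frac\pi2)$.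 In particular $\mathbf g$ is Lorentzian on $\Omega_C$. 2. [Uniqueness] $(\Omega_C,\Phi_C)$ is an MGHD of the data, and it is the only one. 3. [Boundary] (a) $\partial\Omega_C$ is the disjoint union of the singular boundary $\mathcal B$, the initial singularity $\mathcal S$ and the Cauchy horizon $\underline{\mathcal C}$, which are smooth embedded submanifolds of codimension $1$, $2$ and $1$; each of the three is connected, and so is $\partial\Omega_C$. (b) $\mathcal B=\{\mathscr S(z): z\in(0,\infty)\}$ and $\mathcal S=\{\mathscr S(0)\}$. (c) $\mathrm{cl}(\underline{\mathcal C})\setminus\underline{\mathcal C}=\mathcal S$ and $\mathrm{cl}(\mathcal B)\setminus\mathcal B=\mathcal S$. (d) $\Phi_C$ extends smoothly to $\underline{\mathcal C}$ (the extension to $\Omega_C\cup\underline{\mathcal C}$ is the restriction of a $C^\infty$ function on an open neighbourhood of that set). (e) This extension continues to one that is $C^{1,1/3}$ at $\mathcal S$ and $C^{1,1/2}$ at every point of $\mathcal B$. This is sharp: no extension of $\Phi_C$ is $C^{1,\alpha}$ at $\mathcal S$ with $\alpha>\frac13$, or at a point of $\mathcal B$ with $\alpha>\frac12$. Moreover,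 if $p\in\mathcal S\cup\mathcal B$, $p_n\in\Omega_C$ and $p_n\to p$, then $|\partial^2\Phi_C(p_n)|\to\infty$. (f) $\mathbf g$ extends continuously to a Lorentzian metric on $\overline{\Omega_C}$, again denoted $\mathbf g$, which is $C^{0,1/3}$ at $\mathcal S$, $C^{0,1/2}$ at the points of $\mathcal B$, and smooth up to $\underline{\mathcal C}$. Likewise $L$ extends continuously to $\overline{\Omega_C}$, is $C^{0,1/3}$ at $\mathcal S$ and $C^{0,1/2}$ at the points of $\mathcal B$, and $\mathbf g(L,L)=0$ on $\mathcal S\cup\mathcal B$. (g) $\underline L$ is everywhere tangent to $\underline{\mathcal C}$, and $\underline{\mathcal C}$ is null for the extended $\mathbf g$ (all of its tangent vectors are null). The extended $L$ is everywhere tangent to $\mathcal B$, and $\mathcal B$ is null for the extended $\mathbf g$. 4. [Degeneracy along the singular boundary] For every $p\in\mathcal B$ there are $a>0$ and two integral curves $\gamma_1,\gamma_2:(-a,0]\to\mathbb R^2$ of the extended $L$ with $\gamma_1(0)=\gamma_2(0)=p$, such that $\gamma_1((-a,0])\subset\mathcal B$ and $\gamma_2((-a,0))\subset\Omega_C$;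 in particular $\gamma_1(s)\ne\gamma_2(s)$ for $-a<s<0$. -/

import Mathlib

open Set Filter Topology
open scoped NNReal ContDiff

noncomputable section

namespace ShockMGHD

/-! Points of the plane are pairs `(t, x)`. -/

/-- The partial derivative in `t`. -/
def dt (f : ℝ × ℝ → ℝ) (q : ℝ × ℝ) : ℝ := fderiv ℝ f q (1, 0)

/-- The partial derivative in `x`. -/
def dx (f : ℝ × ℝ → ℝ) (q : ℝ × ℝ) : ℝ := fderiv ℝ f q (0, 1)

/-- `Ψ = ∂ₜΦ - 2 ∂ₓΦ`. -/
def psi (Φ : ℝ × ℝ → ℝ) (q : ℝ × ℝ) : ℝ := dt Φ q - 2 * dx Φ q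

/-- The outgoing characteristic vector `L = ∂ₜ + (2 + Ψ) ∂ₓ` where `Ψ` takes the value `ψ`. -/
def outgoing (ψ : ℝ) : ℝ × ℝ := (1, 2 + ψ)

/-- The ingoing characteristic vector `∂ₜ - 2 ∂ₓ`. -/
def ingoing : ℝ × ℝ := (1, -2)

/-! ### The acoustical metric and Lorentzian geometry -/

/-- The components, in the coordinates `(t, x)`, of the acoustical metric where `Ψ` takes the
value `ψ`; for `ψ ≠ -4` this is the inverse of the principal symbol
`!![-1, -ψ/2; -ψ/2, 2 (2 + ψ)]` of the wave equation. -/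
def acousticMetric (ψ : ℝ) : Matrix (Fin 2) (Fin 2) ℝ :=
  !![-(8 * (2 + ψ)) / (4 + ψ) ^ 2, -(2 * ψ) / (4 + ψ) ^ 2;
     -(2 * ψ) / (4 + ψ) ^ 2, 4 / (4 + ψ) ^ 2]

/-- The bilinear form with matrix `A`, on vectors `(vᵗ, vˣ)`. -/
def form (A : Matrix (Fin 2) (Fin 2) ℝ) (v w : ℝ × ℝ) : ℝ :=
  A 0 0 * v.1 * w.1 + A 0 1 * v.1 * w.2 + A 1 0 * v.2 * w.1 + A 1 1 * v.2 * w.2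

/-- Symmetric, with one negative and one positive eigenvalue. -/
def IsLorentzian (A : Matrix (Fin 2) (Fin 2) ℝ) : Prop :=
  A.IsSymm ∧ ∃ l m : ℝ, l < 0 ∧ 0 < m ∧
    Module.End.HasEigenvalue (Matrix.toLin' A) l ∧ Module.End.HasEigenvalue (Matrix.toLin' A) m

/-- `γ` restricted to the interval `I` is a `C¹` curve with timelike velocity. -/
def IsTimelikeCurve (g : ℝ × ℝ → Matrix (Fin 2) (Fin 2) ℝ) (I : Set ℝ) (γ : ℝ → ℝ × ℝ) : Prop :=
  ∃ γ' : ℝ → ℝ × ℝ, ContinuousOn γ' I ∧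
    ∀ s ∈ I, HasDerivWithinAt γ (γ' s) I s ∧ form (g (γ s)) (γ' s) (γ' s) < 0

/-- At least one of the two limits of the curve, towards the lower and towards the upper end of
the interval `I`, exists in `Ω`. -/
def IsExtendible (Ω : Set (ℝ × ℝ)) (I : Set ℝ) (γ : ℝ → ℝ × ℝ) : Prop :=
  (∃ q ∈ Ω, Tendsto (fun s : I => γ s) atBot (𝓝 q)) ∨
    (∃ q ∈ Ω, Tendsto (fun s : I => γ s) atTop (𝓝 q))

/-- `{t = 0}` is a Cauchy hypersurface of `(Ω, g)`: every inextendible timelike `C¹` curve in `Ω`,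
defined on an interval with more than one point, meets it exactly once. -/
def IsCauchyHypersurface (Ω : Set (ℝ × ℝ)) (g : ℝ × ℝ → Matrix (Fin 2) (Fin 2) ℝ) : Prop :=
  ∀ (I : Set ℝ) (γ : ℝ → ℝ × ℝ), I.OrdConnected → I.Nontrivial → MapsTo γ I Ω →
    IsTimelikeCurve g I γ → ¬ IsExtendible Ω I γ → ∃! s, s ∈ I ∧ (γ s).1 = 0

/-! ### Developments of the data -/

/-- `Φ` is a smooth classical solution of the Cauchy problem on the open set `Ω`, which
contains the line `{t = 0}`. -/
structure IsDevelopment (Ω : Set (ℝ × ℝ)) (Φ : ℝ × ℝ → ℝ) : Prop where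
  isOpen : IsOpen Ω
  line_subset : ∀ x : ℝ, ((0 : ℝ), x) ∈ Ω
  smooth : ContDiffOn ℝ ∞ Φ Ω
  equation : ∀ q ∈ Ω, -dt (dt Φ) q - psi Φ q * dt (dx Φ) q
    + 2 * (2 + psi Φ q) * dx (dx Φ) q = 0
  data_zero : ∀ x : ℝ, Φ (0, x) = 0
  data_one : ∀ x : ℝ, dt Φ (0, x) = -Real.arctan x

/-- Globally hyperbolic developments. -/
structure IsGHD (Ω : Set (ℝ × ℝ)) (Φ : ℝ × ℝ → ℝ) : Prop extends IsDevelopment Ω Φ where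
  lorentzian : ∀ q ∈ Ω, IsLorentzian (acousticMetric (psi Φ q))
  cauchy : IsCauchyHypersurface Ω (fun q => acousticMetric (psi Φ q))

/-- Maximal globally hyperbolic developments: no globally hyperbolic development properly
extends it. -/
def IsMGHD (Ω : Set (ℝ × ℝ)) (Φ : ℝ × ℝ → ℝ) : Prop :=
  IsGHD Ω Φ ∧ ¬ ∃ (Ω' : Set (ℝ × ℝ)) (Φ' : ℝ × ℝ → ℝ), IsGHD Ω' Φ' ∧ Ω ⊂ Ω' ∧ EqOn Φ' Φ Ω

/-! ### The explicit sets -/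

/-- The initial value of `Ψ`. -/
def psi0 (x : ℝ) : ℝ := -Real.arctan x

/-- The outgoing characteristic from `(0, y)`, parametrized by `t`. -/
def char (y t : ℝ) : ℝ × ℝ := (t, y + t * (2 + psi0 y))

/-- The part foliated by the outgoing characteristics with `y > 0`, up to the time `-1 / Ψ₀'(y)`
at which they focus. -/
def Omega1 : Set (ℝ × ℝ) := {q | ∃ y t : ℝ, 0 < y ∧ t < 1 + y ^ 2 ∧ q = char y t}

/-- The part foliated by the outgoing characteristics with `y ≤ 0`, up to the time at which they
reach the line `x = 4 - 2 t`. -/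
def Omega2 : Set (ℝ × ℝ) :=
  {q | ∃ y t : ℝ, y ≤ 0 ∧ t < (4 - y) / (4 + psi0 y) ∧ q = char y t}

/-- The domain of the maximal development. -/
def OmegaC : Set (ℝ × ℝ) := Omega1 ∪ Omega2

/-- The curve `z ↦ (1 + z², (2 - arctan z) (1 + z²) + z)`. -/
def singCurve (z : ℝ) : ℝ × ℝ := (1 + z ^ 2, (2 - Real.arctan z) * (1 + z ^ 2) + z)

/-- The singular boundary, as the graph `x = x_B(t)` over `t > 1`. -/
def singBdry : Set (ℝ × ℝ) := {q | 1 < q.1 ∧ q.2 = (singCurve (Real.sqrt (q.1 - 1))).2}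

/-- The initial singularity. -/
def initSing : ℝ × ℝ := (1, 2)

/-- The Cauchy horizon. -/
def cauchyHor : Set (ℝ × ℝ) := {q | 1 < q.1 ∧ q.2 = 4 - 2 * q.1}

/-! ### Submanifolds and tangency -/

/-- `M` is a smooth embedded submanifold of the plane of codimension `k`. -/
def IsSubmanifold (k : ℕ) (M : Set (ℝ × ℝ)) : Prop :=
  ∀ p ∈ M, ∃ (U : Set (ℝ × ℝ)) (f : ℝ × ℝ → (Fin k → ℝ)), IsOpen U ∧ p ∈ U ∧
    ContDiffOn ℝ ∞ f U ∧ (∀ q ∈ U, Function.Surjective (fderiv ℝ f q)) ∧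
    M ∩ U = {q | q ∈ U ∧ f q = 0}

/-- `v` is the velocity at `p` of a smooth curve in `M`. -/
def IsTangent (M : Set (ℝ × ℝ)) (p v : ℝ × ℝ) : Prop :=
  ∃ c : ℝ → ℝ × ℝ, ContDiffAt ℝ ∞ c 0 ∧ c 0 = p ∧ (∀ᶠ s in 𝓝 0, c s ∈ M) ∧ HasDerivAt c v 0

/-- All tangent vectors of the curve `M` are null for `g`. -/
def IsNullCurve (g : ℝ × ℝ → Matrix (Fin 2) (Fin 2) ℝ) (M : Set (ℝ × ℝ)) : Prop :=
  ∀ p ∈ M, ∀ v, IsTangent M p v → form (g p) v v = 0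

/-! ### Regularity up to the boundary -/

/-- `f` is smooth on the (not necessarily open) set `s`: it agrees on `s` with a smooth function
on an open set containing `s`. -/
def IsSmoothOn (f : ℝ × ℝ → ℝ) (s : Set (ℝ × ℝ)) : Prop :=
  ∃ (U : Set (ℝ × ℝ)) (F : ℝ × ℝ → ℝ), IsOpen U ∧ s ⊆ U ∧ ContDiffOn ℝ ∞ F U ∧ EqOn F f s

/-- On a neighbourhood of `p` in `K`, the function `f` is Hölder continuous of exponent `α`. -/
def IsHolderNear {E : Type*} [PseudoEMetricSpace E] (α : ℝ≥0) (K : Set (ℝ × ℝ))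
    (f : ℝ × ℝ → E) (p : ℝ × ℝ) : Prop :=
  ∃ r > 0, ∃ C : ℝ≥0, HolderOnWith C α f (K ∩ Metric.ball p r)

/-- On a neighbourhood of `p` in `K`, the function `f` is of class `C^{1,α}`: it is differentiable
within `K` with derivative Hölder continuous of exponent `α`. -/
def IsC1HolderNear (α : ℝ≥0) (K : Set (ℝ × ℝ)) (f : ℝ × ℝ → ℝ) (p : ℝ × ℝ) : Prop :=
  ∃ r > 0, ∃ (C : ℝ≥0) (D : ℝ × ℝ → (ℝ × ℝ →L[ℝ] ℝ)),
    (∀ q ∈ K ∩ Metric.ball p r, HasFDerivWithinAt f (D q) K q) ∧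
    HolderOnWith C α D (K ∩ Metric.ball p r)

/-- `γ` is an integral curve of the vector field `X` on the interval `(-a, 0]`. -/
def IsBackwardIntegralCurve (X : ℝ × ℝ → ℝ × ℝ) (a : ℝ) (γ : ℝ → ℝ × ℝ) : Prop :=
  ∀ s ∈ Ioc (-a) 0, HasDerivWithinAt γ (X (γ s)) (Ioc (-a) 0) s

end ShockMGHD

end

open ShockMGHD

noncomputable section

namespace ShockMGHD

/-! ### The characteristic map -/

/-! The wave operator factors: the equation is `L Ψ = 0`. Hence `Ψ` is constant along the outgoing
characteristics, which are the straight lines `char y` carrying the value `-arctan y`. At fixed time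
the map from the label `y` to `x` has derivative `1 - t / (1 + y²)`, so neighbouring characteristics
focus at `t = 1 + y²`. The focusing points with `y ≥ 0` form the singular boundary together with its
end point `(1, 2)`. The proof works in the coordinates (label, time), where `OmegaC` is the
injective image of the explicit open set `openLabels`.

Regularity. The solution is a function of label and time plus a function of `x + 2t`. The label
derivative of the first part contains exactly the factor `1 - t / (1 + y²)`, so it cancels from the
differential of the solution, which becomes a smooth function of the label and `x + 2t` alone
(`hasFDerivAt_sol`, `hasFDerivWithinAt_sol`). Regularity at the boundary is therefore that of the
label. At fixed time the label inverts a function that grows cubically at `(1, 2)` and quadratically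
along the rest of the singular boundary, which gives the exponents 1/3 and 1/2 (`label_sub_cube_le`,
`label_sub_sq_le`) and also their sharpness. The second derivatives keep one inverse focusing factor
and blow up. The Cauchy horizon is the ingoing line issuing from `(1, 2)`. Its labels are negative
and not yet focused, so everything is smooth across it.

Global hyperbolicity. Along a future directed timelike curve `t` and `x + 2t` increase and the label
decreases. A curve missing `{t = 0}` has bounded monotone coordinates towards that line, so it has
an end point in `OmegaC` (`isConeCauchy_omegaC`).

Maximality and uniqueness. In any globally hyperbolic development, null segments back to `{t = 0}`
stay inside (`line_mem`). Since the hypothesis concerns timelike curves only, a null segment that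
left the domain is shadowed by a timelike curve with the same missing end point
(`exists_timelike_approach`). Outgoing segments then force `Ψ = -arctan` of the foot of the
characteristic and a time before focusing. Ingoing segments force `x + 2t < 4` for feet `≤ 0`. So
every development lies in `OmegaC` and agrees there with `sol` (`IsGHD.mem_omegaC`,
`IsGHD.eqOn_sol`), and both maximality and uniqueness follow. -/

/-- The displacement `x - 2t` of the point with label `y` at time `t`. -/
def focal (y t : ℝ) : ℝ := y - t * Real.arctan y

lemma hasDerivAt_focal (y t : ℝ) :
    HasDerivAt (fun η => focal η t) (1 - t / (1 + y ^ 2)) y := by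
  have h := (hasDerivAt_id y).sub ((Real.hasDerivAt_arctan y).const_mul t)
  exact h.congr_deriv (by ring)

lemma char_fst (y t : ℝ) : (char y t).1 = t := rfl

lemma char_snd (y t : ℝ) : (char y t).2 = focal y t + 2 * t := by
  simp only [char, psi0, focal]; ring

lemma char_eq_iff {y z t : ℝ} : char y t = char z t ↔ focal y t = focal z t := by
  rw [Prod.ext_iff, char_snd, char_snd]
  simp [char_fst]

lemma monotoneOn_sub_of_hasDerivAt_le {f g f' g' : ℝ → ℝ} {y z : ℝ} (hyz : y ≤ z)
    (hf : ∀ η, HasDerivAt f (f' η) η) (hg : ∀ η, HasDerivAt g (g' η) η)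
    (h : ∀ η, y < η → η < z → g' η ≤ f' η) : g z - g y ≤ f z - f y := by
  have : MonotoneOn (fun η => f η - g η) (Icc y z) := by
    refine monotoneOn_of_hasDerivWithinAt_nonneg (f' := fun η => f' η - g' η) (convex_Icc y z)
      (fun η _ => ((hf η).sub (hg η)).continuousAt.continuousWithinAt)
      (fun η _ => ((hf η).sub (hg η)).hasDerivWithinAt) ?_
    intro η hη
    rw [interior_Icc] at hη
    linarith [h η hη.1 hη.2]
  have := this (left_mem_Icc.2 hyz) (right_mem_Icc.2 hyz) hyz
  simp only at this
  linarith

lemma hasDerivAt_cube_sub (c a η : ℝ) :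
    HasDerivAt (fun η => c * (η - a) ^ 3) (3 * c * (η - a) ^ 2) η := by
  have h := (((hasDerivAt_id η).sub_const a).pow 3).const_mul c
  exact h.congr_deriv (by simp only [id]; push_cast; ring)

lemma hasDerivAt_sq_sub (c a η : ℝ) :
    HasDerivAt (fun η => c * (η - a) ^ 2) (2 * c * (η - a)) η := by
  have h := (((hasDerivAt_id η).sub_const a).pow 2).const_mul c
  exact h.congr_deriv (by simp only [id]; push_cast; ring)

/-- The derivative is `(1 + η² - t) / (1 + η²)`. Bounding the denominator on `|η| ≤ R` reduces all
spreading estimates to lower bounds for `1 + η² - t`. -/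
lemma le_focal_deriv {η t s R : ℝ} (hs : 0 ≤ s) (hR : |η| ≤ R) (h : s ≤ 1 + η ^ 2 - t) :
    s / (1 + R ^ 2) ≤ 1 - t / (1 + η ^ 2) := by
  have h1 : η ^ 2 ≤ R ^ 2 := by
    rw [← sq_abs η]; gcongr
  have h2 : (0 : ℝ) < 1 + η ^ 2 := by positivity
  calc s / (1 + R ^ 2) ≤ s / (1 + η ^ 2) := by gcongr
    _ ≤ (1 + η ^ 2 - t) / (1 + η ^ 2) := by gcongr
    _ = 1 - t / (1 + η ^ 2) := by field_simp

/-- Labels whose characteristics have not focused by the time `t` spread at least cubically. -/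
lemma cube_le_focal_sub {y z t R : ℝ} (hyz : y ≤ z) (hy : |y| ≤ R) (hz : |z| ≤ R)
    (hty : t ≤ 1 + y ^ 2) (htz : t ≤ 1 + z ^ 2) (h : t ≤ 1 ∨ 0 ≤ y ∨ z ≤ 0) :
    (z - y) ^ 3 / (12 * (1 + R ^ 2)) ≤ focal z t - focal y t := by
  have hR : (0 : ℝ) < 1 + R ^ 2 := by positivity
  have habs : ∀ η, y < η → η < z → |η| ≤ R := fun η h1 h2 =>
    abs_le.2 ⟨by linarith [(abs_le.1 hy).1], by linarith [(abs_le.1 hz).2]⟩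
  have hd : 0 ≤ z - y := by linarith
  -- In the three cases `1 + η² - t` is at least `η²`, `(η - y)²` and `(η - z)²` respectively. The
  -- excluded configuration, `y < 0 < z` with `t > 1`, has focused labels in between.
  rcases h with h | h | h
  · have key := monotoneOn_sub_of_hasDerivAt_le hyz (fun η => hasDerivAt_focal η t)
      (fun η => hasDerivAt_cube_sub (1 / (3 * (1 + R ^ 2))) 0 η) (fun η h1 h2 => by
        refine le_trans (le_of_eq ?_) (le_focal_deriv (s := η ^ 2) (by positivity)
          (habs η h1 h2) (by linarith))
        field_simp; ring)
    refine le_trans ?_ key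
    have : (1 / (3 * (1 + R ^ 2)) * (z - 0) ^ 3 - 1 / (3 * (1 + R ^ 2)) * (y - 0) ^ 3)
        = (4 * (z ^ 3 - y ^ 3)) / (12 * (1 + R ^ 2)) := by field_simp; ring
    rw [this]
    gcongr
    -- `4 (z³ - y³) - (z - y)³ = 3 (z - y) (z + y)²`; the loss of 4 here turns the factor 3 into 12.
    nlinarith [mul_nonneg hd (sq_nonneg (z + y))]
  · have key := monotoneOn_sub_of_hasDerivAt_le hyz (fun η => hasDerivAt_focal η t)
      (fun η => hasDerivAt_cube_sub (1 / (3 * (1 + R ^ 2))) y η) (fun η h1 h2 => by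
        refine le_trans (le_of_eq ?_) (le_focal_deriv (s := (η - y) ^ 2) (by positivity)
          (habs η h1 h2) (by nlinarith))
        field_simp)
    refine le_trans ?_ key
    have : (1 / (3 * (1 + R ^ 2)) * (z - y) ^ 3 - 1 / (3 * (1 + R ^ 2)) * (y - y) ^ 3)
        = (4 * (z - y) ^ 3) / (12 * (1 + R ^ 2)) := by field_simp; ring
    rw [this]
    gcongr
    nlinarith [pow_nonneg hd 3]
  · have key := monotoneOn_sub_of_hasDerivAt_le hyz (fun η => hasDerivAt_focal η t)
      (fun η => hasDerivAt_cube_sub (1 / (3 * (1 + R ^ 2))) z η) (fun η h1 h2 => by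
        refine le_trans (le_of_eq ?_) (le_focal_deriv (s := (η - z) ^ 2) (by positivity)
          (habs η h1 h2) (by nlinarith))
        field_simp)
    refine le_trans ?_ key
    have : (1 / (3 * (1 + R ^ 2)) * (z - z) ^ 3 - 1 / (3 * (1 + R ^ 2)) * (y - z) ^ 3)
        = (4 * (z - y) ^ 3) / (12 * (1 + R ^ 2)) := by field_simp; ring
    rw [this]
    gcongr
    nlinarith [pow_nonneg hd 3]

/-- Away from the label `0` they spread at least quadratically. -/
lemma sq_le_focal_sub {y z t m R : ℝ} (hyz : y ≤ z) (hm : 0 ≤ m) (hy : m ≤ y) (hz : z ≤ R)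
    (hty : t ≤ 1 + y ^ 2) :
    m * (z - y) ^ 2 / (1 + R ^ 2) ≤ focal z t - focal y t := by
  have hR : (0 : ℝ) < 1 + R ^ 2 := by positivity
  -- For `m ≤ y ≤ η` one has `1 + η² - t ≥ η² - y² ≥ 2 m (η - y)`.
  have key := monotoneOn_sub_of_hasDerivAt_le hyz (fun η => hasDerivAt_focal η t)
      (fun η => hasDerivAt_sq_sub (m / (1 + R ^ 2)) y η) (fun η h1 h2 => by
        refine le_trans (le_of_eq ?_) (le_focal_deriv (s := 2 * m * (η - y)) (R := R)
          (mul_nonneg (by linarith) (by linarith))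
          (abs_le.2 ⟨by linarith, by linarith⟩) (by nlinarith))
        field_simp)
  refine le_trans (le_of_eq ?_) key
  field_simp; ring

lemma focal_lt {y z t : ℝ} (hyz : y < z)
    (hty : t ≤ 1 + y ^ 2) (htz : t ≤ 1 + z ^ 2) (h : t ≤ 1 ∨ 0 ≤ y ∨ z ≤ 0) :
    focal y t < focal z t := by
  have h1 := cube_le_focal_sub hyz.le (le_max_left |y| |z|) (le_max_right |y| |z|) hty htz h
  have : 0 < (z - y) ^ 3 / (12 * (1 + (max |y| |z|) ^ 2)) := by
    have : 0 < z - y := by linarith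
    positivity
  linarith

lemma focal_le {y z t : ℝ} (hyz : y ≤ z)
    (hty : t ≤ 1 + y ^ 2) (htz : t ≤ 1 + z ^ 2) (h : t ≤ 1 ∨ 0 ≤ y ∨ z ≤ 0) :
    focal y t ≤ focal z t := by
  rcases hyz.eq_or_lt with rfl | h'
  · rfl
  · exact (focal_lt h' hty htz h).le

lemma arctan_le_self {y : ℝ} (hy : 0 ≤ y) : Real.arctan y ≤ y := by
  have := focal_le hy (t := 1) (by nlinarith) (by nlinarith) (Or.inl le_rfl)
  simp [focal] at this
  exact this

lemma self_lt_arctan {y : ℝ} (hy : y < 0) : y < Real.arctan y := by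
  have := focal_lt hy (t := 1) (by nlinarith) (by nlinarith) (Or.inl le_rfl)
  simp [focal] at this
  exact this

lemma arctan_mem (y : ℝ) : Real.arctan y ∈ Ioo (-1.6 : ℝ) 1.6 := by
  have h1 := Real.arctan_lt_pi_div_two y
  have h2 := Real.neg_pi_div_two_lt_arctan y
  have h3 := Real.pi_lt_d2
  constructor <;> linarith

lemma self_le_one_add_sq_mul_arctan {y : ℝ} (hy : 0 ≤ y) : y ≤ (1 + y ^ 2) * Real.arctan y := by
  have h : ∀ η : ℝ, HasDerivAt (fun η => (1 + η ^ 2) * Real.arctan η)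
      (2 * η * Real.arctan η + 1) η := fun η => by
    have := (((hasDerivAt_id η).pow 2).const_add 1).mul (Real.hasDerivAt_arctan η)
    refine this.congr_deriv ?_
    have : (1 + η ^ 2) ≠ 0 := by positivity
    simp only [id, Nat.cast_ofNat, Nat.add_one_sub_one, pow_one, mul_one, Pi.pow_apply]
    field_simp
  have := monotoneOn_sub_of_hasDerivAt_le hy h (fun η => hasDerivAt_id η) (fun η h1 h2 => by
    have : 0 ≤ Real.arctan η := Real.arctan_nonneg.2 h1.le
    nlinarith)
  simpa using this

/-- The value of `x + 2t` at the point with label `y` at time `t`. -/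
def ingoingCoord (y t : ℝ) : ℝ := y + t * (4 - Real.arctan y)

lemma char_ingoingCoord (y t : ℝ) : (char y t).2 + 2 * (char y t).1 = ingoingCoord y t := by
  simp only [char, psi0, ingoingCoord]; ring

/-- The singular boundary stays strictly on the far side of the line `x + 2t = 4`, which separates
it from the Cauchy horizon. For `z ≤ 4` the bound `arctan z ≤ z` leaves `4 + z² (4 - z)`; for larger
`z` it is enough that `arctan` is below 1.6. -/
lemma four_lt_ingoingCoord_sing {z : ℝ} (hz : 0 < z) : 4 < ingoingCoord z (1 + z ^ 2) := by
  unfold ingoingCoord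
  have h1 := arctan_le_self hz.le
  have h2 := (arctan_mem z).2
  rcases le_or_gt z 4 with h | h
  · nlinarith [mul_le_mul_of_nonneg_left h1 (by positivity : (0:ℝ) ≤ 1 + z ^ 2),
      mul_nonneg (sq_nonneg z) (sub_nonneg.2 h), mul_pos hz hz]
  · nlinarith [mul_pos (by positivity : (0:ℝ) < 1 + z ^ 2) (sub_pos.2 h2)]

/-- Characteristics with nonpositive label reach the line `x = 4 - 2t` before they focus. -/
lemma lt_of_ingoingCoord {y t : ℝ} (hy : y < 0) (h : ingoingCoord y t ≤ 4) : t < 1 + y ^ 2 := by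
  unfold ingoingCoord at h
  have h1 := self_le_one_add_sq_mul_arctan (y := -y) (by linarith)
  rw [Real.arctan_neg] at h1
  have h2 := (arctan_mem y).2
  by_contra! h3
  nlinarith [mul_le_mul_of_nonneg_right h3 (by linarith : 0 ≤ 4 - Real.arctan y), sq_pos_of_neg hy]

lemma ingoingCoord_mono (y : ℝ) : StrictMono (ingoingCoord y) := fun s t h => by
  have h2 := (arctan_mem y).2
  unfold ingoingCoord
  nlinarith

/-- The singular boundary as a graph over the time axis. -/
def singX (t : ℝ) : ℝ := (singCurve (Real.sqrt (t - 1))).2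

lemma singCurve_eq_char (z : ℝ) : singCurve z = char z (1 + z ^ 2) := by
  simp only [singCurve, char, psi0, Prod.mk.injEq, true_and]; ring

lemma singX_eq {t : ℝ} (ht : 1 ≤ t) : singX t = (char (Real.sqrt (t - 1)) t).2 := by
  rw [singX, singCurve_eq_char, Real.sq_sqrt (by linarith)]; ring_nf

lemma lt_singX {t : ℝ} (ht : 1 < t) : 4 - 2 * t < singX t := by
  have h1 : 0 < Real.sqrt (t - 1) := Real.sqrt_pos.2 (by linarith)
  have h := four_lt_ingoingCoord_sing h1
  rw [← char_ingoingCoord, Real.sq_sqrt (by linarith), char_fst, add_sub_cancel] at h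
  rw [singX_eq ht.le]
  linarith

/-- At time `t`, positions increase with the label from `√(t - 1)` on, and that label sits on the
singular boundary. -/
lemma singX_le_char {y t : ℝ} (ht : 1 ≤ t) (hy : 0 ≤ y) (hty : t ≤ 1 + y ^ 2) :
    singX t ≤ (char y t).2 := by
  rw [singX_eq ht, char_snd, char_snd]
  have : Real.sqrt (t - 1) ≤ y := Real.sqrt_le_iff.2 ⟨hy, by linarith⟩
  have := focal_le this (t := t) (by rw [Real.sq_sqrt (by linarith)]; linarith) hty
    (Or.inr (Or.inl (Real.sqrt_nonneg _)))
  linarith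

/-! ### Labels -/

/-- A set of pairs (label, time) on which the characteristic map is injective, which contains all
those of the closure of the development. -/
def labels : Set (ℝ × ℝ) :=
  {w | w.2 ≤ 1 + w.1 ^ 2 ∧ (0 ≤ w.1 ∨ w.2 ≤ 1 ∨ (char w.1 w.2).2 < singX w.2)}

/-- Monotonicity of `focal` settles every case except `y < 0 < z` with `t > 1`. There the point with
label `y` is strictly to the left of the singular boundary and the one with label `z` is not. -/
lemma labels_injective {y z t : ℝ} (hy : (y, t) ∈ labels) (hz : (z, t) ∈ labels)
    (h : char y t = char z t) : y = z := by
  wlog hyz : y < z generalizing y z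
  · rcases (not_lt.1 hyz).eq_or_lt with h' | h'
    · exact h'.symm
    · exact (this hz hy h.symm h').symm
  exfalso
  by_cases hc : t ≤ 1 ∨ 0 ≤ y ∨ z ≤ 0
  · exact (focal_lt hyz hy.1 hz.1 hc).ne (char_eq_iff.1 h)
  · push Not at hc
    rcases hy.2 with h1 | h1 | h1
    · exact absurd h1 (not_le.2 hc.2.1)
    · exact absurd h1 (not_le.2 hc.1)
    · have := singX_le_char hc.1.le hc.2.2.le hz.1
      simp only at h1
      rw [h] at h1
      linarith

/-- The label of a point. -/
def label (q : ℝ × ℝ) : ℝ :=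
  open Classical in if h : ∃ y, (y, q.1) ∈ labels ∧ char y q.1 = q then h.choose else 0

lemma label_char {y t : ℝ} (h : (y, t) ∈ labels) : label (char y t) = y := by
  have hex : ∃ z, (z, (char y t).1) ∈ labels ∧ char z (char y t).1 = char y t := ⟨y, h, rfl⟩
  rw [label, dif_pos hex]
  exact labels_injective hex.choose_spec.1 h hex.choose_spec.2

/-- The labels of the development. -/
def openLabels : Set (ℝ × ℝ) := {w | w.2 < 1 + w.1 ^ 2 ∧ (0 < w.1 ∨ ingoingCoord w.1 w.2 < 4)}

/-- The labels of the closure of the development. -/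
def closedLabels : Set (ℝ × ℝ) :=
  {w | (0 ≤ w.1 ∧ w.2 ≤ 1 + w.1 ^ 2) ∨ (w.1 ≤ 0 ∧ ingoingCoord w.1 w.2 ≤ 4)}

/-- The labels of a larger set on which the solution is still smooth. -/
def smoothLabels : Set (ℝ × ℝ) :=
  {w | w.2 < 1 + w.1 ^ 2 ∧ (0 < w.1 ∨ w.2 < 1 ∨ (w.1 < 0 ∧ (char w.1 w.2).2 < singX w.2))}

/-- The characteristic map on pairs. -/
def charMap (w : ℝ × ℝ) : ℝ × ℝ := char w.1 w.2

lemma closedLabels_subset_labels : closedLabels ⊆ labels := by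
  rintro ⟨y, t⟩ (⟨h1, h2⟩ | ⟨h1, h2⟩)
  · exact ⟨h2, Or.inl h1⟩
  · simp only at h1 h2
    rcases h1.eq_or_lt with rfl | h1
    · refine ⟨?_, Or.inl le_rfl⟩
      simp [ingoingCoord] at h2 ⊢
      linarith
    · refine ⟨(lt_of_ingoingCoord h1 h2).le, Or.inr ?_⟩
      rcases le_or_gt t 1 with ht | ht
      · exact Or.inl ht
      · right
        rw [← char_ingoingCoord, char_fst] at h2
        simp only
        linarith [lt_singX ht]

lemma smoothLabels_subset_labels : smoothLabels ⊆ labels := by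
  rintro ⟨y, t⟩ ⟨h1, h2⟩
  refine ⟨h1.le, ?_⟩
  rcases h2 with h2 | h2 | h2
  · exact Or.inl h2.le
  · exact Or.inr (Or.inl h2.le)
  · exact Or.inr (Or.inr h2.2)

lemma openLabels_subset_closedLabels : openLabels ⊆ closedLabels := by
  rintro ⟨y, t⟩ ⟨h1, h2⟩
  rcases le_or_gt y 0 with hy | hy
  · exact Or.inr ⟨hy, (h2.resolve_left (not_lt.2 hy)).le⟩
  · exact Or.inl ⟨hy.le, h1.le⟩

/-- The labels of the Cauchy horizon are interior to `smoothLabels`, which is why the solution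
continues smoothly across the horizon. -/
lemma mem_smoothLabels_of_neg {y t : ℝ} (hy : y < 0) (h : ingoingCoord y t ≤ 4) :
    (y, t) ∈ smoothLabels := by
  have h1 := lt_of_ingoingCoord hy h
  refine ⟨h1, Or.inr ?_⟩
  rcases lt_trichotomy t 1 with ht | rfl | ht
  · exact Or.inl ht
  · refine Or.inr ⟨hy, ?_⟩
    have := focal_lt hy (t := 1) (by nlinarith) (by nlinarith) (Or.inl le_rfl)
    simp only [char_snd, singX, singCurve]
    simp [focal] at this ⊢
    linarith
  · right
    rw [← char_ingoingCoord, char_fst] at h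
    simp only
    exact ⟨hy, by linarith [lt_singX ht]⟩

lemma openLabels_subset_smoothLabels : openLabels ⊆ smoothLabels := by
  rintro ⟨y, t⟩ ⟨h1, h2⟩
  simp only at h1 h2
  rcases lt_trichotomy y 0 with hy | rfl | hy
  · exact mem_smoothLabels_of_neg hy (h2.resolve_left (not_lt.2 hy.le)).le
  · exact ⟨h1, Or.inr (Or.inl (by simpa using h1))⟩
  · exact ⟨h1, Or.inl hy⟩

lemma openLabels_subset_labels : openLabels ⊆ labels :=
  openLabels_subset_closedLabels.trans closedLabels_subset_labels

lemma contDiff_ingoingCoord : ContDiff ℝ ∞ (fun w : ℝ × ℝ => ingoingCoord w.1 w.2) := by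
  unfold ingoingCoord
  exact contDiff_fst.add (contDiff_snd.mul (contDiff_const.sub
    (Real.contDiff_arctan.comp contDiff_fst)))

lemma contDiff_charMap : ContDiff ℝ ∞ charMap := by
  unfold charMap char psi0
  exact contDiff_snd.prodMk (contDiff_fst.add (contDiff_snd.mul (contDiff_const.add
    (Real.contDiff_arctan.comp contDiff_fst).neg)))

lemma continuous_singX : Continuous singX := by
  unfold singX singCurve
  fun_prop

lemma isOpen_openLabels : IsOpen openLabels := by
  have h := contDiff_ingoingCoord.continuous
  have h1 : IsOpen {w : ℝ × ℝ | w.2 < 1 + w.1 ^ 2} := isOpen_lt (by fun_prop) (by fun_prop)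
  have h2 : IsOpen {w : ℝ × ℝ | 0 < w.1} := isOpen_lt (by fun_prop) (by fun_prop)
  have h3 : IsOpen {w : ℝ × ℝ | ingoingCoord w.1 w.2 < 4} := isOpen_lt h (by fun_prop)
  exact h1.inter (h2.union h3)

lemma isClosed_closedLabels : IsClosed closedLabels := by
  have h := contDiff_ingoingCoord.continuous
  have h1 : IsClosed {w : ℝ × ℝ | w.2 ≤ 1 + w.1 ^ 2} := isClosed_le (by fun_prop) (by fun_prop)
  have h2 : IsClosed {w : ℝ × ℝ | 0 ≤ w.1} := isClosed_le (by fun_prop) (by fun_prop)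
  have h3 : IsClosed {w : ℝ × ℝ | w.1 ≤ 0} := isClosed_le (by fun_prop) (by fun_prop)
  have h4 : IsClosed {w : ℝ × ℝ | ingoingCoord w.1 w.2 ≤ 4} := isClosed_le h (by fun_prop)
  exact (h2.inter h1).union (h3.inter h4)

lemma isOpen_smoothLabels : IsOpen smoothLabels := by
  have h : Continuous fun w : ℝ × ℝ => (char w.1 w.2).2 :=
    continuous_snd.comp contDiff_charMap.continuous
  have h1 : IsOpen {w : ℝ × ℝ | w.2 < 1 + w.1 ^ 2} := isOpen_lt (by fun_prop) (by fun_prop)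
  have h2 : IsOpen {w : ℝ × ℝ | 0 < w.1} := isOpen_lt (by fun_prop) (by fun_prop)
  have h3 : IsOpen {w : ℝ × ℝ | w.2 < 1} := isOpen_lt (by fun_prop) (by fun_prop)
  have h4 : IsOpen {w : ℝ × ℝ | w.1 < 0} := isOpen_lt (by fun_prop) (by fun_prop)
  have h5 : IsOpen {w : ℝ × ℝ | (char w.1 w.2).2 < singX w.2} :=
    isOpen_lt h (continuous_singX.comp continuous_snd)
  exact h1.inter (h2.union (h3.union (h4.inter h5)))

/-- For labels `≤ 0` the condition of not having focused is implied by `x + 2t < 4`, so both pieces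
fit into one open set of labels. -/
lemma omegaC_eq : OmegaC = charMap '' openLabels := by
  ext q
  simp only [OmegaC, Omega1, Omega2, mem_union, mem_ofPred_eq, mem_image, Prod.exists, openLabels,
    charMap]
  have key : ∀ y t : ℝ, t < (4 - y) / (4 + psi0 y) ↔ ingoingCoord y t < 4 := fun y t => by
    have := (arctan_mem y).2
    rw [lt_div_iff₀ (by unfold psi0; linarith), ingoingCoord, psi0]
    constructor <;> intro h <;> linarith
  constructor
  · rintro (⟨y, t, hy, ht, rfl⟩ | ⟨y, t, hy, ht, rfl⟩)
    · exact ⟨y, t, ⟨ht, Or.inl hy⟩, rfl⟩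
    · rw [key] at ht
      refine ⟨y, t, ⟨?_, Or.inr ht⟩, rfl⟩
      rcases hy.eq_or_lt with rfl | hy
      · simp [ingoingCoord] at ht ⊢
        linarith
      · exact lt_of_ingoingCoord hy ht.le
  · rintro ⟨y, t, ⟨h1, h2⟩, rfl⟩
    rcases le_or_gt y 0 with hy | hy
    · exact Or.inr ⟨y, t, hy, (key y t).2 (h2.resolve_left (not_lt.2 hy)), rfl⟩
    · exact Or.inl ⟨y, t, hy, h1, rfl⟩

lemma label_mem_openLabels {q : ℝ × ℝ} (hq : q ∈ OmegaC) :
    (label q, q.1) ∈ openLabels ∧ char (label q) q.1 = q := by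
  rw [omegaC_eq] at hq
  obtain ⟨⟨y, t⟩, h, rfl⟩ := hq
  have := label_char (openLabels_subset_labels h)
  rw [charMap, this]
  exact ⟨h, rfl⟩

/-! ### Smoothness of the label -/

/-- The derivative of the characteristic map. -/
lemma exists_equiv_hasFDerivAt_charMap {y t : ℝ} (h : 1 - t / (1 + y ^ 2) ≠ 0) :
    ∃ e : (ℝ × ℝ) ≃L[ℝ] (ℝ × ℝ), HasFDerivAt charMap (e : ℝ × ℝ →L[ℝ] ℝ × ℝ) (y, t) ∧
      ∀ v, (e.symm v).1 = (v.2 - (2 - Real.arctan y) * v.1) / (1 - t / (1 + y ^ 2)) := by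
  set k := 1 - t / (1 + y ^ 2) with hk
  let f : (ℝ × ℝ) →ₗ[ℝ] (ℝ × ℝ) :=
    { toFun := fun v => (v.2, k * v.1 + (2 - Real.arctan y) * v.2)
      map_add' := fun v w => by ext <;> simp <;> ring
      map_smul' := fun c v => by ext <;> simp <;> ring }
  let g : (ℝ × ℝ) →ₗ[ℝ] (ℝ × ℝ) :=
    { toFun := fun v => ((v.2 - (2 - Real.arctan y) * v.1) / k, v.1)
      map_add' := fun v w => by ext <;> simp; field_simp; ring
      map_smul' := fun c v => by ext <;> simp; field_simp }
  let e : (ℝ × ℝ) ≃ₗ[ℝ] (ℝ × ℝ) := LinearEquiv.ofLinearMap f g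
    (by ext <;> simp [f, g] <;> field_simp <;> ring)
    (by ext <;> simp [f, g, h])
  refine ⟨e.toContinuousLinearEquiv, ?_, fun v => rfl⟩
  have hy : HasFDerivAt (fun w : ℝ × ℝ => w.1) (ContinuousLinearMap.fst ℝ ℝ ℝ) (y, t) :=
    hasFDerivAt_fst
  have ht : HasFDerivAt (fun w : ℝ × ℝ => w.2) (ContinuousLinearMap.snd ℝ ℝ ℝ) (y, t) :=
    hasFDerivAt_snd
  have ha := (Real.hasDerivAt_arctan y).comp_hasFDerivAt (y, t) hy
  have := ht.prodMk (hy.add (ht.mul (ha.neg.const_add 2)))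
  refine this.congr_fderiv ?_
  have hp : (1 + y ^ 2) ≠ 0 := by positivity
  ext <;> simp [e, f, hk] <;> field_simp <;> ring

/-- Before focusing the characteristic map is a local diffeomorphism. Its local inverse takes values
in `smoothLabels`, where labels are unique, so it must coincide with `label`. -/
lemma contDiffAt_label {w : ℝ × ℝ} (hw : w ∈ smoothLabels) :
    ContDiffAt ℝ ∞ label (charMap w) ∧ charMap '' smoothLabels ∈ 𝓝 (charMap w) ∧
    HasFDerivAt label ((1 / (1 - w.2 / (1 + w.1 ^ 2))) •
      (ContinuousLinearMap.snd ℝ ℝ ℝ - (2 - Real.arctan w.1) • ContinuousLinearMap.fst ℝ ℝ ℝ))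
      (charMap w) := by
  obtain ⟨y, t⟩ := w
  have hk : 1 - t / (1 + y ^ 2) ≠ 0 := by
    have h1 : t < 1 + y ^ 2 := hw.1
    have : t / (1 + y ^ 2) < 1 := (div_lt_one (by positivity)).2 h1
    linarith
  obtain ⟨e, he, he'⟩ := exists_equiv_hasFDerivAt_charMap hk
  have hc : ContDiffAt ℝ ∞ charMap (y, t) := contDiff_charMap.contDiffAt
  have hs : HasStrictFDerivAt charMap (e : ℝ × ℝ →L[ℝ] ℝ × ℝ) (y, t) :=
    hc.hasStrictFDerivAt' he (by simp)
  have hl := hc.to_localInverse he (by simp)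
  have hl0 : hc.localInverse he (by simp) (charMap (y, t)) = (y, t) :=
    hc.localInverse_apply_image he (by simp)
  set g := hc.localInverse he (by simp)
  have hg : HasStrictFDerivAt g (e.symm : ℝ × ℝ →L[ℝ] ℝ × ℝ) (charMap (y, t)) :=
    hs.to_localInverse
  have hmem : ∀ᶠ q in 𝓝 (charMap (y, t)), g q ∈ smoothLabels := by
    refine hl.continuousAt (isOpen_smoothLabels.mem_nhds ?_)
    rw [hl0]; exact hw
  have hright : ∀ᶠ q in 𝓝 (charMap (y, t)), charMap (g q) = q :=
    hs.eventually_right_inverse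
  have heq : label =ᶠ[𝓝 (charMap (y, t))] fun q => (g q).1 := by
    filter_upwards [hmem, hright] with q h1 h2
    have := label_char (smoothLabels_subset_labels h1)
    change label (charMap (g q)) = (g q).1 at this
    rwa [h2] at this
  refine ⟨(contDiffAt_fst.comp _ hl).congr_of_eventuallyEq heq, ?_, ?_⟩
  · filter_upwards [hmem, hright] with q h1 h2
    exact ⟨g q, h1, h2⟩
  · have h1 : HasFDerivAt (fun q => (g q).1)
        ((ContinuousLinearMap.fst ℝ ℝ ℝ).comp (e.symm : ℝ × ℝ →L[ℝ] ℝ × ℝ)) (charMap (y, t)) :=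
      (ContinuousLinearMap.fst ℝ ℝ ℝ).hasFDerivAt.comp _ hg.hasFDerivAt
    refine (h1.congr_of_eventuallyEq heq).congr_fderiv ?_
    ext
    · simp only [ContinuousLinearMap.comp_apply, ContinuousLinearMap.inl_apply,
        ContinuousLinearEquiv.coe_coe, ContinuousLinearMap.coe_fst', he']
      simp; ring
    · simp only [ContinuousLinearMap.comp_apply, ContinuousLinearMap.inr_apply,
        ContinuousLinearEquiv.coe_coe, ContinuousLinearMap.coe_fst', he']
      simp

lemma isOpen_charMap_smoothLabels : IsOpen (charMap '' smoothLabels) := by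
  rw [isOpen_iff_mem_nhds]
  rintro _ ⟨w, hw, rfl⟩
  exact (contDiffAt_label hw).2.1

lemma isOpen_omegaC : IsOpen OmegaC := by
  rw [omegaC_eq, isOpen_iff_mem_nhds]
  rintro _ ⟨⟨y, t⟩, hw, rfl⟩
  obtain ⟨h1, h2, -⟩ := contDiffAt_label (openLabels_subset_smoothLabels hw)
  have h3 : ContinuousAt (fun q : ℝ × ℝ => (label q, q.1)) (charMap (y, t)) :=
    h1.continuousAt.prodMk continuousAt_fst
  have h4 : (label (charMap (y, t)), (charMap (y, t)).1) = (y, t) := by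
    rw [charMap, label_char (openLabels_subset_labels hw), char_fst]
  filter_upwards [h2, h3.preimage_mem_nhds (by rw [h4]; exact isOpen_openLabels.mem_nhds hw)]
    with q hq hq'
  obtain ⟨⟨z, s⟩, hz, rfl⟩ := hq
  rw [mem_preimage, charMap, label_char (smoothLabels_subset_labels hz), char_fst] at hq'
  exact ⟨(z, s), hq', rfl⟩

/-! ### The solution -/

/-- `log (4 + Ψ)` on the characteristic with label `y`. -/
def logSpeed (y : ℝ) : ℝ := Real.log (4 - Real.arctan y)

lemma speed_pos (y : ℝ) : 0 < 4 - Real.arctan y := by linarith [(arctan_mem y).2]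

lemma contDiff_logSpeed : ContDiff ℝ ∞ logSpeed :=
  (contDiff_const.sub Real.contDiff_arctan).log fun y => (speed_pos y).ne'

lemma hasDerivAt_logSpeed (y : ℝ) :
    HasDerivAt logSpeed (-(1 / (1 + y ^ 2)) / (4 - Real.arctan y)) y :=
  ((Real.hasDerivAt_arctan y).const_sub 4).log (speed_pos y).ne'

/-- The primitive of `log (4 - arctan)` that vanishes at the origin. -/
def logPrimitive (y : ℝ) : ℝ := ∫ η in (0 : ℝ)..y, logSpeed η

lemma hasDerivAt_logPrimitive (y : ℝ) : HasDerivAt logPrimitive (logSpeed y) y :=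
  contDiff_logSpeed.continuous.integral_hasStrictDerivAt 0 y |>.hasDerivAt

lemma contDiff_logPrimitive : ContDiff ℝ ∞ logPrimitive := by
  rw [contDiff_infty_iff_deriv]
  refine ⟨fun y => (hasDerivAt_logPrimitive y).differentiableAt, ?_⟩
  have : deriv logPrimitive = logSpeed := funext fun y => (hasDerivAt_logPrimitive y).deriv
  rw [this]
  exact contDiff_logSpeed

/-- The part of the solution that depends on the time and the label. -/
def labelPart (t y : ℝ) : ℝ :=
  -(t * Real.arctan y) - t * (4 - Real.arctan y) * logSpeed y - logPrimitive y

/-- The key cancellation: the factor `1 - t / (1 + y²)` is the derivative of `focal` in the label,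
so with respect to `x` the derivative is just `-logSpeed y`, which stays finite at focusing. -/
lemma hasDerivAt_labelPart (t y : ℝ) :
    HasDerivAt (labelPart t) (-(logSpeed y * (1 - t / (1 + y ^ 2)))) y := by
  have h1 := ((Real.hasDerivAt_arctan y).const_mul t).neg
  have h2 := (((Real.hasDerivAt_arctan y).const_sub 4).const_mul t).mul (hasDerivAt_logSpeed y)
  refine ((h1.sub h2).sub (hasDerivAt_logPrimitive y)).congr_deriv ?_
  have h3 := (speed_pos y).ne'
  have h4 : (1 + y ^ 2) ≠ 0 := by positivity
  field_simp
  ring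

lemma contDiff_labelPart : ContDiff ℝ ∞ fun w : ℝ × ℝ => labelPart w.1 w.2 := by
  have h1 : ContDiff ℝ ∞ fun w : ℝ × ℝ => Real.arctan w.2 :=
    Real.contDiff_arctan.comp contDiff_snd
  have h2 : ContDiff ℝ ∞ fun w : ℝ × ℝ => logSpeed w.2 := contDiff_logSpeed.comp contDiff_snd
  have h3 : ContDiff ℝ ∞ fun w : ℝ × ℝ => logPrimitive w.2 :=
    contDiff_logPrimitive.comp contDiff_snd
  exact ((contDiff_fst.mul h1).neg.sub ((contDiff_fst.mul (contDiff_const.sub h1)).mul h2)).sub h3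

lemma hasFDerivAt_labelPart (t y : ℝ) :
    HasFDerivAt (fun w : ℝ × ℝ => labelPart w.1 w.2)
      ((-Real.arctan y - (4 - Real.arctan y) * logSpeed y) • ContinuousLinearMap.fst ℝ ℝ ℝ +
        (-(logSpeed y * (1 - t / (1 + y ^ 2)))) • ContinuousLinearMap.snd ℝ ℝ ℝ) (t, y) := by
  have hd : DifferentiableAt ℝ (fun w : ℝ × ℝ => labelPart w.1 w.2) (t, y) :=
    contDiff_labelPart.contDiffAt.differentiableAt (by simp)
  refine hd.hasFDerivAt.congr_fderiv ?_
  have h1 : HasDerivAt (fun s => labelPart s y)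
      (fderiv ℝ (fun w : ℝ × ℝ => labelPart w.1 w.2) (t, y) (1, 0)) t :=
    hd.hasFDerivAt.comp_hasDerivAt (f := fun s => (s, y)) t
      ((hasDerivAt_id t).prodMk (hasDerivAt_const t y))
  have h2 : HasDerivAt (fun z => labelPart t z)
      (fderiv ℝ (fun w : ℝ × ℝ => labelPart w.1 w.2) (t, y) (0, 1)) y :=
    hd.hasFDerivAt.comp_hasDerivAt (f := fun z => (t, z)) y
      ((hasDerivAt_const y t).prodMk (hasDerivAt_id y))
  have h3 : HasDerivAt (fun s => labelPart s y)
      (-Real.arctan y - (4 - Real.arctan y) * logSpeed y) t := by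
    unfold labelPart
    have := ((((hasDerivAt_id t).mul_const (Real.arctan y)).neg.sub
      (((hasDerivAt_id t).mul_const (4 - Real.arctan y)).mul_const (logSpeed y))).sub_const
      (logPrimitive y))
    exact this.congr_deriv (by ring)
  ext
  · simp [h1.unique h3]
  · simp [h2.unique (hasDerivAt_labelPart t y)]

/-- The solution, extended to the boundary of the development. -/
def sol (q : ℝ × ℝ) : ℝ := labelPart q.1 (label q) + logPrimitive (q.2 + 2 * q.1)

/-- The differential of the solution as a function of the label and of `x + 2t`. -/
def solDeriv (w : ℝ × ℝ) : ℝ × ℝ →L[ℝ] ℝ :=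
  (-Real.arctan w.1 - 2 * logSpeed w.1 + 2 * logSpeed w.2) • ContinuousLinearMap.fst ℝ ℝ ℝ +
    (logSpeed w.2 - logSpeed w.1) • ContinuousLinearMap.snd ℝ ℝ ℝ

/-- The domain of the smooth continuation of the solution. -/
def smoothDomain : Set (ℝ × ℝ) := charMap '' smoothLabels

lemma isOpen_smoothDomain : IsOpen smoothDomain := isOpen_charMap_smoothLabels

lemma omegaC_subset_smoothDomain : OmegaC ⊆ smoothDomain := by
  rw [omegaC_eq]
  exact image_mono openLabels_subset_smoothLabels

lemma label_mem_smoothLabels {q : ℝ × ℝ} (hq : q ∈ smoothDomain) :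
    (label q, q.1) ∈ smoothLabels ∧ charMap (label q, q.1) = q := by
  obtain ⟨⟨y, t⟩, h, rfl⟩ := hq
  have h1 : label (charMap (y, t)) = y := label_char (smoothLabels_subset_labels h)
  rw [h1]
  exact ⟨h, rfl⟩

lemma contDiffOn_label : ContDiffOn ℝ ∞ label smoothDomain := by
  rintro _ ⟨w, hw, rfl⟩
  exact (contDiffAt_label hw).1.contDiffWithinAt

lemma hasFDerivAt_label {q : ℝ × ℝ} (hq : q ∈ smoothDomain) :
    HasFDerivAt label ((1 / (1 - q.1 / (1 + label q ^ 2))) •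
      (ContinuousLinearMap.snd ℝ ℝ ℝ -
        (2 - Real.arctan (label q)) • ContinuousLinearMap.fst ℝ ℝ ℝ)) q := by
  obtain ⟨h1, h2⟩ := label_mem_smoothLabels hq
  have := (contDiffAt_label h1).2.2
  rwa [h2] at this

lemma focus_pos {q : ℝ × ℝ} (hq : q ∈ smoothDomain) : 0 < 1 - q.1 / (1 + label q ^ 2) := by
  have h1 := (label_mem_smoothLabels hq).1.1
  have : q.1 / (1 + label q ^ 2) < 1 := (div_lt_one (by positivity)).2 h1
  linarith

lemma hasFDerivAt_ingoing (q : ℝ × ℝ) : HasFDerivAt (fun q : ℝ × ℝ => q.2 + 2 * q.1)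
    (ContinuousLinearMap.snd ℝ ℝ ℝ + (2 : ℝ) • ContinuousLinearMap.fst ℝ ℝ ℝ) q :=
  hasFDerivAt_snd.add (hasFDerivAt_fst.const_mul 2)

lemma contDiffOn_sol : ContDiffOn ℝ ∞ sol smoothDomain := by
  have h1 : ContDiffOn ℝ ∞ (fun q : ℝ × ℝ => labelPart q.1 (label q)) smoothDomain :=
    contDiff_labelPart.comp_contDiffOn (contDiffOn_fst.prodMk contDiffOn_label)
  have h2 : ContDiff ℝ ∞ (fun q : ℝ × ℝ => logPrimitive (q.2 + 2 * q.1)) :=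
    contDiff_logPrimitive.comp (by fun_prop)
  exact h1.add h2.contDiffOn

/-- The focusing factor from `labelPart` cancels the one in the denominator of the derivative of
`label`. Only smooth functions of the label and of `x + 2t` remain. -/
lemma hasFDerivAt_sol {q : ℝ × ℝ} (hq : q ∈ smoothDomain) :
    HasFDerivAt sol (solDeriv (label q, q.2 + 2 * q.1)) q := by
  have h1 := (hasFDerivAt_labelPart q.1 (label q)).comp q
    ((hasFDerivAt_fst (𝕜 := ℝ) (p := q)).prodMk (hasFDerivAt_label hq))
  have h2 := (hasDerivAt_logPrimitive (q.2 + 2 * q.1)).comp_hasFDerivAt q (hasFDerivAt_ingoing q)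
  refine (h1.add h2).congr_fderiv ?_
  have h3 := (focus_pos hq).ne'
  set k := 1 - q.1 / (1 + label q ^ 2)
  ext
  · simp [solDeriv]; field_simp; ring
  · simp [solDeriv]; field_simp; ring

lemma dt_sol {q : ℝ × ℝ} (hq : q ∈ smoothDomain) :
    dt sol q = (-Real.arctan (label q) - 2 * logSpeed (label q)) +
      2 * logSpeed (q.2 + 2 * q.1) := by
  rw [dt, (hasFDerivAt_sol hq).fderiv]
  simp [solDeriv]

lemma dx_sol {q : ℝ × ℝ} (hq : q ∈ smoothDomain) :
    dx sol q = -logSpeed (label q) + logSpeed (q.2 + 2 * q.1) := by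
  rw [dx, (hasFDerivAt_sol hq).fderiv]
  simp [solDeriv]; ring

lemma psi_sol {q : ℝ × ℝ} (hq : q ∈ smoothDomain) : psi sol q = -Real.arctan (label q) := by
  rw [psi, dt_sol hq, dx_sol hq]; ring

/-- Both first derivatives of the solution have the form `f (label) + g (x + 2t)`; this
differentiates them once more. -/
lemma hasFDerivAt_label_add_ingoing {f g : ℝ → ℝ} {f' g' : ℝ} {F : ℝ × ℝ → ℝ} {q : ℝ × ℝ}
    (hq : q ∈ smoothDomain) (hf : HasDerivAt f f' (label q)) (hg : HasDerivAt g g' (q.2 + 2 * q.1))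
    (hF : ∀ p ∈ smoothDomain, F p = f (label p) + g (p.2 + 2 * p.1)) :
    dt F q = -f' * (2 - Real.arctan (label q)) / (1 - q.1 / (1 + label q ^ 2)) + 2 * g' ∧
    dx F q = f' / (1 - q.1 / (1 + label q ^ 2)) + g' := by
  have h := (hf.comp_hasFDerivAt q (hasFDerivAt_label hq)).add
    (hg.comp_hasFDerivAt q (hasFDerivAt_ingoing q))
  have h' := h.congr_of_eventuallyEq (f₁ := F) (by
    filter_upwards [isOpen_smoothDomain.mem_nhds hq] with p hp using hF p hp)
  rw [dt, dx, h'.fderiv]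
  constructor
  · simp; ring
  · simp; ring

lemma dx_dx_sol {q : ℝ × ℝ} (hq : q ∈ smoothDomain) :
    dx (dx sol) q = 1 / (1 + label q ^ 2) / (4 - Real.arctan (label q)) /
        (1 - q.1 / (1 + label q ^ 2)) +
      -(1 / (1 + (q.2 + 2 * q.1) ^ 2)) / (4 - Real.arctan (q.2 + 2 * q.1)) := by
  rw [(hasFDerivAt_label_add_ingoing hq (hasDerivAt_logSpeed _).neg (hasDerivAt_logSpeed _)
    (fun p hp => dx_sol hp)).2]
  ring

lemma equation_sol {q : ℝ × ℝ} (hq : q ∈ smoothDomain) :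
    -dt (dt sol) q - psi sol q * dt (dx sol) q + 2 * (2 + psi sol q) * dx (dx sol) q = 0 := by
  obtain ⟨h1, h2⟩ := hasFDerivAt_label_add_ingoing hq (hasDerivAt_logSpeed _).neg
    (hasDerivAt_logSpeed _) (fun p hp => dx_sol hp)
  obtain ⟨h3, -⟩ := hasFDerivAt_label_add_ingoing hq
    ((Real.hasDerivAt_arctan _).neg.sub ((hasDerivAt_logSpeed _).const_mul 2))
    ((hasDerivAt_logSpeed _).const_mul 2) (fun p hp => dt_sol hp)
  rw [h1, h2, h3, psi_sol hq]
  have h4 := (focus_pos hq).ne'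
  set k := 1 - q.1 / (1 + label q ^ 2)
  have h5 := (speed_pos (label q)).ne'
  have h6 := (speed_pos (q.2 + 2 * q.1)).ne'
  set A := Real.arctan (label q)
  set A' := Real.arctan (q.2 + 2 * q.1)
  have h7 : 1 + label q ^ 2 ≠ 0 := by positivity
  have h8 : 1 + (q.2 + 2 * q.1) ^ 2 ≠ 0 := by positivity
  field_simp
  ring

lemma initial_mem (x : ℝ) : ((0 : ℝ), x) ∈ OmegaC ∧ label (0, x) = x := by
  have h1 : (x, (0 : ℝ)) ∈ openLabels := by
    refine ⟨by simp only; positivity, ?_⟩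
    rcases lt_or_ge 0 x with h | h
    · exact Or.inl h
    · right; simp [ingoingCoord]; linarith
  have h2 : char x 0 = (0, x) := by simp [char]
  constructor
  · rw [omegaC_eq]
    exact ⟨_, h1, h2⟩
  · rw [← h2, label_char (openLabels_subset_labels h1)]

lemma isDevelopment_sol : IsDevelopment OmegaC sol where
  isOpen := isOpen_omegaC
  line_subset x := (initial_mem x).1
  smooth := contDiffOn_sol.mono omegaC_subset_smoothDomain
  equation q hq := equation_sol (omegaC_subset_smoothDomain hq)
  data_zero x := by
    -- At `t = 0` the label is `x` and the two occurrences of `logPrimitive x` cancel.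
    rw [sol, (initial_mem x).2]
    simp [labelPart]
  data_one x := by
    rw [dt_sol (omegaC_subset_smoothDomain (initial_mem x).1), (initial_mem x).2]
    simp

/-! ### The acoustical metric -/

/-- A negative determinant makes the discriminant of the characteristic polynomial exceed the square
of the trace, so its roots have opposite signs. -/
lemma isLorentzian_of_det_neg {a b d : ℝ} (h : a * d - b * b < 0) :
    IsLorentzian !![a, b; b, d] := by
  have hroot : ∀ l : ℝ, l ^ 2 - (a + d) * l + (a * d - b * b) = 0 →
      Module.End.HasEigenvalue (Matrix.toLin' !![a, b; b, d]) l := fun l hl => by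
    rw [Module.End.hasEigenvalue_iff_isRoot_charpoly, Matrix.charpoly_toLin',
      Matrix.charpoly_fin_two]
    simp [Matrix.trace_fin_two, Matrix.det_fin_two]
    exact hl
  have hs : (a + d) ^ 2 < (a + d) ^ 2 - 4 * (a * d - b * b) := by linarith
  set s := Real.sqrt ((a + d) ^ 2 - 4 * (a * d - b * b)) with hsdef
  have hs2 : s ^ 2 = (a + d) ^ 2 - 4 * (a * d - b * b) :=
    Real.sq_sqrt (by nlinarith [sq_nonneg (a + d)])
  have habs : |a + d| < s := by
    rw [hsdef, ← Real.sqrt_sq_eq_abs]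
    exact Real.sqrt_lt_sqrt (sq_nonneg _) hs
  obtain ⟨h1, h2⟩ := abs_lt.1 habs
  refine ⟨?_, ((a + d) - s) / 2, ((a + d) + s) / 2, by linarith, by linarith,
    hroot _ (by nlinarith), hroot _ (by nlinarith)⟩
  ext i j
  fin_cases i <;> fin_cases j <;> rfl

lemma isLorentzian_acousticMetric {ψ : ℝ} (h : ψ ≠ -4) : IsLorentzian (acousticMetric ψ) := by
  have h' : 4 + ψ ≠ 0 := fun h0 => h (by linarith)
  apply isLorentzian_of_det_neg
  have : -(8 * (2 + ψ)) / (4 + ψ) ^ 2 * (4 / (4 + ψ) ^ 2) -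
      -(2 * ψ) / (4 + ψ) ^ 2 * (-(2 * ψ) / (4 + ψ) ^ 2) = -(4 / (4 + ψ) ^ 2) := by
    field_simp; ring
  rw [this]
  have : 0 < 4 / (4 + ψ) ^ 2 := by positivity
  linarith

/-- At `ψ = -4` every entry is a division by zero, hence 0, and the zero matrix has no negative
eigenvalue. -/
lemma ne_of_isLorentzian {ψ : ℝ} (h : IsLorentzian (acousticMetric ψ)) : ψ ≠ -4 := by
  rintro rfl
  obtain ⟨-, l, -, hl, -, h, -⟩ := h
  obtain ⟨v, hv⟩ := h.exists_hasEigenvector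
  have h1 := hv.apply_eq_smul
  have h0 : acousticMetric (-4) = 0 := by
    ext i j
    fin_cases i <;> fin_cases j <;> norm_num [acousticMetric]
  rw [h0, map_zero, LinearMap.zero_apply, eq_comm, smul_eq_zero] at h1
  exact h1.elim hl.ne hv.2

/-- The quadratic form splits into the two characteristic directions. Timelike thus means having a
velocity strictly between the slopes `2 + ψ` and `-2`, which is all that is used of the metric in
the causal arguments. -/
lemma form_acousticMetric (ψ : ℝ) (v : ℝ × ℝ) :
    form (acousticMetric ψ) v v =
      4 / (4 + ψ) ^ 2 * ((v.2 - (2 + ψ) * v.1) * (v.2 - -2 * v.1)) := by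
  simp [form, acousticMetric]
  ring

lemma form_acousticMetric_neg_iff {ψ : ℝ} (h : ψ ≠ -4) (v : ℝ × ℝ) :
    form (acousticMetric ψ) v v < 0 ↔ (v.2 - (2 + ψ) * v.1) * (v.2 - -2 * v.1) < 0 := by
  have h' : 4 + ψ ≠ 0 := fun h0 => h (by linarith)
  have : 0 < 4 / (4 + ψ) ^ 2 := by positivity
  rw [form_acousticMetric, mul_neg_iff]
  constructor
  · rintro (h | h)
    · exact h.2
    · exact absurd h.1 (not_lt.2 this.le)
  · exact fun h => Or.inl ⟨this, h⟩

lemma neg_arctan_ne (y : ℝ) : -Real.arctan y ≠ -4 := by linarith [speed_pos y]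

/-! ### The closure and the boundary -/

/-- Properness holds because `arctan` is bounded. It makes images of closed sets of labels closed,
which yields the closure of `OmegaC` and continuity of the label even at focused points, where the
inverse function theorem fails. -/
lemma isProperMap_charMap : IsProperMap charMap := by
  rw [isProperMap_iff_tendsto_cocompact]
  refine ⟨contDiff_charMap.continuous, ?_⟩
  have key : ∀ w : ℝ × ℝ, ‖w‖ ≤ 10 * ‖charMap w‖ := by
    rintro ⟨y, t⟩
    have h1 : |t| ≤ ‖charMap (y, t)‖ := norm_fst_le (charMap (y, t))
    have h2 : |(charMap (y, t)).2| ≤ ‖charMap (y, t)‖ := norm_snd_le (charMap (y, t))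
    have h3 : y = (charMap (y, t)).2 - t * (2 - Real.arctan y) := by
      simp only [charMap, char, psi0]; ring
    have h4 : |2 - Real.arctan y| ≤ 4 :=
      abs_le.2 ⟨by linarith [(arctan_mem y).2], by linarith [(arctan_mem y).1]⟩
    have h5 : |y| ≤ |(charMap (y, t)).2| + |t| * 4 := by
      calc |y| = |(charMap (y, t)).2 - t * (2 - Real.arctan y)| := congrArg _ h3
        _ ≤ |(charMap (y, t)).2| + |t * (2 - Real.arctan y)| := abs_sub _ _
        _ ≤ _ := by rw [abs_mul]; gcongr
    rw [Prod.norm_def, max_le_iff]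
    simp only [Real.norm_eq_abs]
    constructor <;> linarith [abs_nonneg t]
  rw [← Metric.cobounded_eq_cocompact, ← comap_norm_atTop, tendsto_comap_iff]
  refine tendsto_atTop_mono (f := fun w => ‖w‖ / 10) (fun w => ?_) ?_
  · simp only [Function.comp]; linarith [key w]
  · exact tendsto_comap.atTop_div_const (by norm_num)

lemma closure_omegaC : closure OmegaC = charMap '' closedLabels := by
  apply subset_antisymm
  · refine closure_minimal ?_ (isProperMap_charMap.isClosedMap _ isClosed_closedLabels)
    rw [omegaC_eq]
    exact image_mono openLabels_subset_closedLabels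
  · rintro _ ⟨⟨y, t⟩, hw, rfl⟩
    -- Lowering the time at a fixed label moves from `closedLabels` into `openLabels`.
    have hlim : Tendsto (fun s => charMap (y, s)) (𝓝[<] t) (𝓝 (charMap (y, t))) :=
      ((contDiff_charMap.continuous.comp (by fun_prop : Continuous fun s : ℝ => (y, s))).tendsto
        t).mono_left nhdsWithin_le_nhds
    refine mem_closure_of_tendsto hlim ?_
    filter_upwards [self_mem_nhdsWithin] with s hs
    rw [omegaC_eq]
    refine ⟨(y, s), ?_, rfl⟩
    have hs : s < t := hs
    have hmono := ingoingCoord_mono y hs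
    rcases hw with ⟨h1, h2⟩ | ⟨h1, h2⟩
    · simp only at h1 h2
      refine ⟨by simp only; linarith, ?_⟩
      rcases h1.eq_or_lt with rfl | h1
      · right
        simp [ingoingCoord] at h2 hmono ⊢
        linarith
      · exact Or.inl h1
    · simp only at h1 h2
      refine ⟨?_, Or.inr (by simp only; linarith)⟩
      rcases h1.eq_or_lt with rfl | h1
      · simp [ingoingCoord] at h2 ⊢
        linarith
      · have := lt_of_ingoingCoord h1 h2
        simp only
        linarith

lemma label_mem_closedLabels {q : ℝ × ℝ} (hq : q ∈ closure OmegaC) :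
    (label q, q.1) ∈ closedLabels ∧ charMap (label q, q.1) = q := by
  rw [closure_omegaC] at hq
  obtain ⟨⟨y, t⟩, h, rfl⟩ := hq
  have h1 : label (charMap (y, t)) = y := label_char (closedLabels_subset_labels h)
  rw [h1]
  exact ⟨h, rfl⟩

/-- The preimage of a closed set is the image, under the proper characteristic map, of a closed set
of labels. -/
lemma continuousOn_label : ContinuousOn label (closure OmegaC) := by
  rw [continuousOn_iff_isClosed]
  intro C hC
  refine ⟨charMap '' (closedLabels ∩ Prod.fst ⁻¹' C),
    isProperMap_charMap.isClosedMap _ (isClosed_closedLabels.inter (hC.preimage continuous_fst)), ?_⟩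
  ext q
  constructor
  · rintro ⟨h1, h2⟩
    obtain ⟨h3, h4⟩ := label_mem_closedLabels h2
    exact ⟨⟨_, ⟨h3, h1⟩, h4⟩, h2⟩
  · rintro ⟨⟨⟨y, t⟩, ⟨h1, h2⟩, rfl⟩, h3⟩
    refine ⟨?_, h3⟩
    have : label (charMap (y, t)) = y := label_char (closedLabels_subset_labels h1)
    rw [mem_preimage, this]
    exact h2

lemma singBdry_eq_image : singBdry = singCurve '' Ioi 0 := by
  ext ⟨t, x⟩
  constructor
  · rintro ⟨h1, h2⟩
    simp only at h1 h2
    refine ⟨Real.sqrt (t - 1), Real.sqrt_pos.2 (by linarith), ?_⟩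
    refine Prod.ext ?_ h2.symm
    simp only [singCurve]
    rw [Real.sq_sqrt (by linarith)]; ring
  · rintro ⟨z, hz, h⟩
    have hz : 0 < z := hz
    rw [← h]
    refine ⟨?_, ?_⟩
    · simp only [singCurve]; nlinarith
    · have : (singCurve z).1 - 1 = z ^ 2 := by simp [singCurve]
      rw [this, Real.sqrt_sq hz.le]

lemma initSing_eq : initSing = singCurve 0 := by
  simp [initSing, singCurve]

lemma sing_mem_closedLabels {z : ℝ} (hz : 0 ≤ z) : (z, 1 + z ^ 2) ∈ closedLabels :=
  Or.inl ⟨hz, le_rfl⟩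

lemma label_singCurve {z : ℝ} (hz : 0 ≤ z) : label (singCurve z) = z := by
  rw [singCurve_eq_char]
  exact label_char (closedLabels_subset_labels (sing_mem_closedLabels hz))

lemma cauchyHor_eq_image :
    cauchyHor = charMap '' {w | w.1 < 0 ∧ ingoingCoord w.1 w.2 = 4} := by
  ext ⟨t, x⟩
  constructor
  · rintro ⟨h1, h2⟩
    simp only at h1 h2
    -- Intermediate values in the label at fixed `t > 1`: label 0 gives `4t > 4`, and label `-6t`
    -- gives a negative number because `4 - arctan` is below 5.6.
    have hcont : ContinuousOn (fun y => ingoingCoord y t) (Icc (-(6 * t)) 0) := by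
      have := contDiff_ingoingCoord.continuous
      exact (this.comp (by fun_prop : Continuous fun y : ℝ => (y, t))).continuousOn
    have hmem : (4 : ℝ) ∈ Icc (ingoingCoord (-(6 * t)) t) (ingoingCoord 0 t) := by
      constructor
      · have := (arctan_mem (-(6 * t))).1
        unfold ingoingCoord
        nlinarith
      · simp [ingoingCoord]; linarith
    obtain ⟨y, hy, h4⟩ := intermediate_value_Icc (by linarith) hcont hmem
    simp only at h4
    have hy0 : y < 0 := by
      rcases hy.2.eq_or_lt with rfl | h
      · simp [ingoingCoord] at h4; linarith
      · exact h
    refine ⟨(y, t), ⟨hy0, h4⟩, ?_⟩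
    rw [← char_ingoingCoord, char_fst] at h4
    refine Prod.ext rfl ?_
    simp only [charMap]
    linarith
  · rintro ⟨⟨y, s⟩, ⟨h1, h2⟩, h⟩
    simp only at h1 h2
    rw [← h]
    have h3 := char_ingoingCoord y s
    rw [h2, char_fst] at h3
    refine ⟨?_, ?_⟩
    · simp only [charMap, char_fst]
      have h4 := self_lt_arctan h1
      unfold ingoingCoord at h2
      by_contra! h5
      nlinarith [mul_le_mul_of_nonneg_right h5 (speed_pos y).le]
    · simp only [charMap, char_fst]
      linarith

lemma cauchyHor_subset_smoothDomain : cauchyHor ⊆ smoothDomain := by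
  rw [cauchyHor_eq_image]
  rintro _ ⟨⟨y, t⟩, ⟨h1, h2⟩, rfl⟩
  exact ⟨_, mem_smoothLabels_of_neg h1 (le_of_eq h2), rfl⟩

lemma frontier_omegaC : frontier OmegaC = singBdry ∪ {initSing} ∪ cauchyHor := by
  rw [isOpen_omegaC.frontier_eq, closure_omegaC, singBdry_eq_image, initSing_eq,
    cauchyHor_eq_image]
  ext q
  constructor
  · rintro ⟨⟨⟨y, t⟩, h1, rfl⟩, h2⟩
    have h2 : (y, t) ∉ openLabels := fun h => h2 (by rw [omegaC_eq]; exact ⟨_, h, rfl⟩)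
    rcases lt_trichotomy y 0 with hy | rfl | hy
    · right
      refine ⟨(y, t), ⟨hy, ?_⟩, rfl⟩
      have h3 : ingoingCoord y t ≤ 4 := by
        rcases h1 with h1 | h1
        · exact absurd h1.1 (not_le.2 hy)
        · exact h1.2
      by_contra h4
      exact h2 ⟨lt_of_ingoingCoord hy h3, Or.inr (lt_of_le_of_ne h3 h4)⟩
    · left; right
      have h3 : t ≤ 1 := by
        rcases h1 with h1 | h1
        · simpa using h1.2
        · have := h1.2
          simp [ingoingCoord] at this
          linarith
      have h4 : t = 1 := by
        by_contra h4
        have h4 : t < 1 := lt_of_le_of_ne h3 h4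
        refine h2 ⟨by simpa using h4, Or.inr ?_⟩
        simp [ingoingCoord]
        linarith
      simp [singCurve_eq_char, charMap, h4]
    · left; left
      have h3 : t ≤ 1 + y ^ 2 := by
        rcases h1 with h1 | h1
        · exact h1.2
        · exact absurd h1.1 (not_le.2 hy)
      have h4 : t = 1 + y ^ 2 := by
        by_contra h4
        exact h2 ⟨lt_of_le_of_ne h3 h4, Or.inl hy⟩
      exact ⟨y, hy, by rw [singCurve_eq_char, charMap, h4]⟩
  · have key : ∀ w ∈ closedLabels, w ∉ openLabels →
        charMap w ∈ charMap '' closedLabels \ OmegaC := by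
      rintro ⟨y, t⟩ h1 h2
      refine ⟨⟨_, h1, rfl⟩, fun h3 => h2 ?_⟩
      have := (label_mem_openLabels h3).1
      rwa [charMap, label_char (closedLabels_subset_labels h1)] at this
    rintro ((⟨z, hz, rfl⟩ | h) | ⟨⟨y, t⟩, ⟨h1, h2⟩, rfl⟩)
    · rw [singCurve_eq_char]
      exact key (z, 1 + z ^ 2) (sing_mem_closedLabels (le_of_lt hz)) fun h => lt_irrefl _ h.1
    · rw [mem_singleton_iff] at h
      rw [h, singCurve_eq_char]
      exact key (0, 1 + 0 ^ 2) (sing_mem_closedLabels le_rfl) fun h => lt_irrefl _ h.1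
    · refine key (y, t) (Or.inr ⟨le_of_lt h1, le_of_eq h2⟩) fun h => ?_
      rcases h.2 with h | h
      · exact lt_asymm h h1
      · exact h.ne h2

lemma closure_subset : closure OmegaC ⊆ smoothDomain ∪ (singBdry ∪ {initSing}) := by
  intro q hq
  by_cases h : q ∈ OmegaC
  · exact Or.inl (omegaC_subset_smoothDomain h)
  · have : q ∈ frontier OmegaC := by
      rw [isOpen_omegaC.frontier_eq]; exact ⟨hq, h⟩
    rw [frontier_omegaC] at this
    rcases this with h | h
    · exact Or.inr h
    · exact Or.inl (cauchyHor_subset_smoothDomain h)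

lemma sing_subset_closure : singBdry ∪ {initSing} ⊆ closure OmegaC := by
  refine subset_trans ?_ frontier_subset_closure
  rw [frontier_omegaC]
  exact subset_union_left

lemma sing_eq_image : singBdry ∪ {initSing} = singCurve '' Ici 0 := by
  rw [singBdry_eq_image, initSing_eq, ← image_singleton, ← image_union, Ioi_union_left]

lemma disjoint_singBdry_initSing : Disjoint singBdry {initSing} := by
  rw [disjoint_singleton_right]
  exact fun h => lt_irrefl _ h.1

lemma disjoint_singBdry_cauchyHor : Disjoint singBdry cauchyHor := by
  rw [disjoint_left]
  rintro q ⟨h1, h2⟩ ⟨-, h3⟩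
  have := lt_singX h1
  rw [singX] at this
  linarith

lemma disjoint_initSing_cauchyHor : Disjoint {initSing} cauchyHor := by
  rw [disjoint_singleton_left]
  exact fun h => lt_irrefl _ h.1

lemma contDiff_singCurve : ContDiff ℝ ∞ singCurve := by
  unfold singCurve
  have := Real.contDiff_arctan (n := ∞)
  fun_prop

lemma isConnected_singBdry : IsConnected singBdry := by
  rw [singBdry_eq_image]
  exact isConnected_Ioi.image _ contDiff_singCurve.continuous.continuousOn

lemma cauchyHor_eq : cauchyHor = (fun t : ℝ => (t, 4 - 2 * t)) '' Ioi 1 := by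
  ext ⟨t, x⟩
  simp [cauchyHor, eq_comm]

lemma isConnected_cauchyHor : IsConnected cauchyHor := by
  rw [cauchyHor_eq]
  exact isConnected_Ioi.image _ (by fun_prop)

lemma initSing_union_cauchyHor :
    {initSing} ∪ cauchyHor = (fun t : ℝ => (t, 4 - 2 * t)) '' Ici 1 := by
  have : {initSing} = (fun t : ℝ => (t, 4 - 2 * t)) '' {1} := by
    rw [image_singleton, initSing]; norm_num
  rw [cauchyHor_eq, this, ← image_union, union_comm, Ioi_union_left]

lemma isConnected_frontier : IsConnected (frontier OmegaC) := by
  have : frontier OmegaC = (singBdry ∪ {initSing}) ∪ ({initSing} ∪ cauchyHor) := by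
    rw [frontier_omegaC]
    ext q
    simp only [mem_union]
    tauto
  rw [this]
  refine IsConnected.union ⟨initSing, Or.inr rfl, Or.inl rfl⟩ ?_ ?_
  · rw [sing_eq_image]
    exact isConnected_Ici.image _ contDiff_singCurve.continuous.continuousOn
  · rw [initSing_union_cauchyHor]
    exact isConnected_Ici.image _ (by fun_prop)

/-- A curve that is a graph over `(a, ∞)` accumulates off itself only at the graph over `a`. -/
lemma closure_graph_diff {f : ℝ → ℝ} (hf : Continuous f) (a : ℝ) :
    closure {q : ℝ × ℝ | a < q.1 ∧ q.2 = f q.1} \ {q : ℝ × ℝ | a < q.1 ∧ q.2 = f q.1} =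
      {(a, f a)} := by
  have h1 : closure {q : ℝ × ℝ | a < q.1 ∧ q.2 = f q.1} =
      {q : ℝ × ℝ | a ≤ q.1 ∧ q.2 = f q.1} := by
    apply subset_antisymm
    · refine closure_minimal (fun q h => ⟨h.1.le, h.2⟩) ?_
      exact (isClosed_le continuous_const continuous_fst).inter
        (isClosed_eq continuous_snd (hf.comp continuous_fst))
    · rintro ⟨t, x⟩ ⟨h1, h2⟩
      simp only at h1 h2
      have : Tendsto (fun s => (s, f s)) (𝓝[>] t) (𝓝 (t, x)) := by
        rw [h2]
        exact ((continuous_id.prodMk hf).tendsto t).mono_left nhdsWithin_le_nhds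
      refine mem_closure_of_tendsto this ?_
      filter_upwards [self_mem_nhdsWithin] with s hs
      exact ⟨lt_of_le_of_lt h1 hs, rfl⟩
  rw [h1]
  ext ⟨t, x⟩
  constructor
  · rintro ⟨⟨h2, h3⟩, h4⟩
    simp only at h2 h3
    rcases h2.eq_or_lt with rfl | h2
    · rw [h3]; rfl
    · exact absurd ⟨h2, h3⟩ h4
  · intro h
    rw [mem_singleton_iff, Prod.mk.injEq] at h
    obtain ⟨rfl, rfl⟩ := h
    exact ⟨⟨le_rfl, rfl⟩, fun h => lt_irrefl _ h.1⟩

lemma closure_cauchyHor_diff : closure cauchyHor \ cauchyHor = {initSing} := by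
  have := closure_graph_diff (f := fun t => 4 - 2 * t) (by fun_prop) 1
  rw [show initSing = ((1 : ℝ), (4 - 2 * 1 : ℝ)) by simp [initSing]; norm_num]
  exact this

lemma closure_singBdry_diff : closure singBdry \ singBdry = {initSing} := by
  have := closure_graph_diff continuous_singX 1
  rw [show initSing = ((1 : ℝ), singX 1) by simp [initSing, singX, singCurve]]
  exact this

/-- The graph of a smooth function over an open set of times is a submanifold. -/
lemma isSubmanifold_graph {f : ℝ → ℝ} {a : ℝ} (hf : ContDiffOn ℝ ∞ f (Ioi a)) :
    IsSubmanifold 1 {q : ℝ × ℝ | a < q.1 ∧ q.2 = f q.1} := by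
  intro p hp
  have ho : IsOpen {q : ℝ × ℝ | a < q.1} := isOpen_lt continuous_const continuous_fst
  refine ⟨{q | a < q.1}, fun q _ => q.2 - f q.1, ho, hp.1, ?_, ?_, ?_⟩
  · rw [contDiffOn_pi]
    intro i
    exact contDiffOn_snd.sub (hf.comp contDiffOn_fst fun q hq => hq)
  · intro q hq
    have h1 : HasDerivAt f (deriv f q.1) q.1 :=
      ((hf.contDiffAt (Ioi_mem_nhds hq)).differentiableAt (by simp)).hasDerivAt
    have h2 : HasFDerivAt (fun q : ℝ × ℝ => fun _ : Fin 1 => q.2 - f q.1)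
        (ContinuousLinearMap.pi fun _ => ContinuousLinearMap.snd ℝ ℝ ℝ -
          deriv f q.1 • ContinuousLinearMap.fst ℝ ℝ ℝ) q := by
      rw [hasFDerivAt_pi]
      intro i
      exact hasFDerivAt_snd.sub (h1.comp_hasFDerivAt q hasFDerivAt_fst)
    rw [h2.fderiv]
    intro v
    refine ⟨(0, v 0), ?_⟩
    ext i
    rw [Subsingleton.elim i 0]
    simp
  · ext q
    simp only [mem_inter_iff, mem_ofPred_eq, funext_iff, Pi.zero_apply, sub_eq_zero]
    constructor
    · rintro ⟨⟨h1, h2⟩, h3⟩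
      exact ⟨h1, fun _ => h2⟩
    · rintro ⟨h1, h2⟩
      exact ⟨⟨h1, h2 0⟩, h1⟩

lemma contDiffOn_singX : ContDiffOn ℝ ∞ singX (Ioi 1) := by
  have h1 : ContDiffOn ℝ ∞ (fun t : ℝ => Real.sqrt (t - 1)) (Ioi 1) := by
    refine ContDiffOn.sqrt (by fun_prop) fun t ht => ?_
    have : (1 : ℝ) < t := ht
    linarith
  exact (contDiff_snd.comp contDiff_singCurve).comp_contDiffOn h1

lemma isSubmanifold_singBdry : IsSubmanifold 1 singBdry := isSubmanifold_graph contDiffOn_singX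

lemma isSubmanifold_cauchyHor : IsSubmanifold 1 cauchyHor :=
  isSubmanifold_graph (f := fun t => 4 - 2 * t) (by fun_prop)

lemma isSubmanifold_initSing : IsSubmanifold 2 {initSing} := by
  intro p hp
  rw [mem_singleton_iff] at hp
  subst hp
  let e : (ℝ × ℝ) →L[ℝ] (Fin 2 → ℝ) := ContinuousLinearMap.pi
    ![ContinuousLinearMap.fst ℝ ℝ ℝ, ContinuousLinearMap.snd ℝ ℝ ℝ]
  have he : ∀ v, e v = ![v.1, v.2] := fun v => by
    ext i; fin_cases i <;> rfl
  refine ⟨univ, fun q => e (q - initSing), isOpen_univ, mem_univ _, ?_, ?_, ?_⟩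
  · exact (e.contDiff.comp (by fun_prop)).contDiffOn
  · intro q _
    have : HasFDerivAt (fun q => e (q - initSing)) e q :=
      (e.hasFDerivAt.comp q ((hasFDerivAt_id q).sub_const _)).congr_fderiv (by ext <;> rfl)
    rw [this.fderiv]
    intro v
    refine ⟨(v 0, v 1), ?_⟩
    rw [he]
    ext i; fin_cases i <;> rfl
  · ext q
    simp only [inter_univ, mem_singleton_iff, mem_univ, true_and, mem_ofPred_eq, he]
    rw [← sub_eq_zero, Prod.ext_iff]
    simp

lemma omegaC_ne_univ : OmegaC ≠ univ := by
  intro h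
  have := frontier_omegaC
  rw [h, frontier_univ] at this
  exact (this ▸ Or.inl (Or.inr rfl) : initSing ∈ (∅ : Set (ℝ × ℝ)))

/-! ### Differentiability up to the boundary -/

/-- Carathéodory's form of differentiability: an increment with coefficients that converge. It
allows differentiation at singular points, where the chain rule through `label` is not available. -/
lemma hasFDerivWithinAt_of_eventually_eq {f c₁ c₂ : ℝ × ℝ → ℝ} {K : Set (ℝ × ℝ)} {q : ℝ × ℝ}
    {a b : ℝ} (h : ∀ᶠ p in 𝓝[K] q, f p - f q = c₁ p * (p.1 - q.1) + c₂ p * (p.2 - q.2))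
    (h₁ : Tendsto c₁ (𝓝[K] q) (𝓝 a)) (h₂ : Tendsto c₂ (𝓝[K] q) (𝓝 b)) :
    HasFDerivWithinAt f (a • ContinuousLinearMap.fst ℝ ℝ ℝ + b • ContinuousLinearMap.snd ℝ ℝ ℝ)
      K q := by
  rw [hasFDerivWithinAt_iff_isLittleO, Asymptotics.isLittleO_iff]
  intro ε hε
  filter_upwards [h, h₁ (Metric.ball_mem_nhds a (half_pos hε)),
    h₂ (Metric.ball_mem_nhds b (half_pos hε))] with p hp hp1 hp2
  rw [hp]
  simp only [mem_preimage, Metric.mem_ball, Real.dist_eq] at hp1 hp2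
  have e1 : c₁ p * (p.1 - q.1) + c₂ p * (p.2 - q.2) -
      (a • ContinuousLinearMap.fst ℝ ℝ ℝ + b • ContinuousLinearMap.snd ℝ ℝ ℝ) (p - q) =
      (c₁ p - a) * (p - q).1 + (c₂ p - b) * (p - q).2 := by
    simp; ring
  rw [e1]
  calc ‖(c₁ p - a) * (p - q).1 + (c₂ p - b) * (p - q).2‖
      ≤ ‖(c₁ p - a) * (p - q).1‖ + ‖(c₂ p - b) * (p - q).2‖ := norm_add_le _ _
    _ ≤ ε / 2 * ‖p - q‖ + ε / 2 * ‖p - q‖ := by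
      rw [norm_mul, norm_mul, Real.norm_eq_abs, Real.norm_eq_abs (c₂ p - b)]
      gcongr
      · exact norm_fst_le _
      · exact norm_snd_le _
    _ = ε * ‖p - q‖ := by ring

/-- Cauchy's mean value theorem for `labelPart` against `focal`. The common factor of the two
derivatives has to be nonzero only strictly between the labels, so an end point may be focused. -/
lemma exists_labelPart_sub {t y z : ℝ}
    (h : ∀ η, min y z < η → η < max y z → 1 - t / (1 + η ^ 2) ≠ 0) :
    ∃ ξ ∈ Icc (min y z) (max y z),
      labelPart t z - labelPart t y = -logSpeed ξ * (focal z t - focal y t) := by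
  have key : ∀ a b : ℝ, a < b → (∀ η, a < η → η < b → 1 - t / (1 + η ^ 2) ≠ 0) →
      ∃ ξ ∈ Icc a b, labelPart t b - labelPart t a = -logSpeed ξ * (focal b t - focal a t) := by
    intro a b hab h
    obtain ⟨ξ, hξ, h1⟩ := exists_ratio_hasDerivAt_eq_ratio_slope (labelPart t) _ hab
      (fun η _ => (hasDerivAt_labelPart t η).continuousAt.continuousWithinAt)
      (fun η _ => hasDerivAt_labelPart t η) (fun η => focal η t) _
      (fun η _ => (hasDerivAt_focal η t).continuousAt.continuousWithinAt)
      (fun η _ => hasDerivAt_focal η t)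
    refine ⟨ξ, Ioo_subset_Icc_self hξ, ?_⟩
    refine mul_right_cancel₀ (h ξ hξ.1 hξ.2) ?_
    linarith
  rcases lt_trichotomy y z with hyz | rfl | hyz
  · rw [min_eq_left hyz.le, max_eq_right hyz.le] at h ⊢
    exact key y z hyz h
  · exact ⟨y, by simp, by simp⟩
  · rw [min_eq_right hyz.le, max_eq_left hyz.le] at h ⊢
    obtain ⟨ξ, hξ, h1⟩ := key z y hyz h
    exact ⟨ξ, hξ, by linarith⟩

/-- At time `1 + y²` exactly the labels `±y` are focused; positivity of `η` excludes the second one.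
-/
lemma focus_ne_zero {y η : ℝ} (hη : η ≠ y) (h : 0 ≤ y) (h0 : 0 < y → 0 < η) :
    1 - (1 + y ^ 2) / (1 + η ^ 2) ≠ 0 := by
  have h1 : (0 : ℝ) < 1 + η ^ 2 := by positivity
  rw [sub_ne_zero, ne_comm, Ne, div_eq_one_iff_eq h1.ne']
  intro h2
  have h3 : y ^ 2 = η ^ 2 := by linarith
  rcases h.eq_or_lt with rfl | h
  · exact hη (by simpa using h3.symm)
  · rcases sq_eq_sq_iff_eq_or_eq_neg.1 h3 with h4 | h4
    · exact hη h4.symm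
    · linarith [h0 h]

/-- At a singular point the increment of the label part is split into a change of time at the new
label, which is linear in the time, and a change of label at the time of `q`. The latter is an
intermediate value of `-logSpeed` times an increment of `focal`, and `focal` is affine in the
position and the time. -/
lemma hasFDerivWithinAt_sol {q : ℝ × ℝ} (hq : q ∈ closure OmegaC) :
    HasFDerivWithinAt sol (solDeriv (label q, q.2 + 2 * q.1)) (closure OmegaC) q := by
  rcases closure_subset hq with h | h
  · exact (hasFDerivAt_sol h).hasFDerivWithinAt
  rw [sing_eq_image] at h
  obtain ⟨z, hz, rfl⟩ := h
  have hz : 0 ≤ z := hz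
  set q := singCurve z with hqdef
  have hlab : label q = z := label_singCurve hz
  have hcont : Tendsto label (𝓝[closure OmegaC] q) (𝓝 z) := by
    have := continuousOn_label q hq
    rwa [ContinuousWithinAt, hlab] at this
  have hq1 : q.1 = 1 + z ^ 2 := rfl
  -- The intermediate label is made a total function of `p`. It defaults to `z` when the sign
  -- condition fails, which does not happen for `p` near `q` in the closure.
  have hex : ∀ p : ℝ × ℝ, ∃ ξ ∈ Icc (min z (label p)) (max z (label p)), (0 < z → 0 < label p) →
      labelPart q.1 (label p) - labelPart q.1 z =
        -logSpeed ξ * (focal (label p) q.1 - focal z q.1) := by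
    intro p
    by_cases hp : 0 < z → 0 < label p
    · obtain ⟨ξ, h1, h2⟩ := exists_labelPart_sub (t := q.1) (y := z) (z := label p)
        (fun η h1 h2 => by
          rw [hq1]
          refine focus_ne_zero ?_ hz fun h0 => lt_trans (lt_min h0 (hp h0)) h1
          rintro rfl
          rcases le_total η (label p) with h | h
          · rw [min_eq_left h] at h1; exact lt_irrefl _ h1
          · rw [max_eq_left h] at h2; exact lt_irrefl _ h2)
      exact ⟨ξ, h1, fun _ => h2⟩
    · exact ⟨z, ⟨min_le_left _ _, le_max_left _ _⟩, fun h => absurd h hp⟩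
  choose ξ hξ hξ' using hex
  have hξlim : Tendsto ξ (𝓝[closure OmegaC] q) (𝓝 z) := by
    refine tendsto_of_tendsto_of_tendsto_of_le_of_le (g := fun p => min z (label p))
      (h := fun p => max z (label p)) ?_ ?_ (fun p => (hξ p).1) (fun p => (hξ p).2)
    · simpa using (tendsto_const_nhds (x := z)).min hcont
    · simpa using (tendsto_const_nhds (x := z)).max hcont
  have hpos : ∀ᶠ p in 𝓝[closure OmegaC] q, 0 < z → 0 < label p := by
    rcases hz.eq_or_lt with rfl | h0
    · exact Eventually.of_forall fun p h => absurd h (lt_irrefl _)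
    · filter_upwards [hcont (lt_mem_nhds h0)] with p hp _ using hp
  have hmem : ∀ᶠ p in 𝓝[closure OmegaC] q, p ∈ closure OmegaC := self_mem_nhdsWithin
  have hpart : HasFDerivWithinAt (fun p : ℝ × ℝ => labelPart p.1 (label p))
      (((-Real.arctan z - (4 - Real.arctan z) * logSpeed z) +
          logSpeed z * (2 - Real.arctan z)) • ContinuousLinearMap.fst ℝ ℝ ℝ +
        (-logSpeed z) • ContinuousLinearMap.snd ℝ ℝ ℝ) (closure OmegaC) q := by
    refine hasFDerivWithinAt_of_eventually_eq
      (c₁ := fun p => (-Real.arctan (label p) - (4 - Real.arctan (label p)) * logSpeed (label p)) +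
        logSpeed (ξ p) * (2 - Real.arctan (label p)))
      (c₂ := fun p => -logSpeed (ξ p)) ?_ ?_ ?_
    · filter_upwards [hmem, hpos] with p hp hp0
      have h1 := hξ' p hp0
      have h2 : focal (label p) p.1 + 2 * p.1 = p.2 := by
        rw [← char_snd]
        exact congrArg Prod.snd (label_mem_closedLabels hp).2
      have h3 : focal z q.1 + 2 * q.1 = q.2 := by
        rw [← char_snd, ← hlab]
        exact congrArg Prod.snd (label_mem_closedLabels hq).2
      have h4 : focal (label p) q.1 - focal z q.1 =
          (p.2 - q.2) - (2 - Real.arctan (label p)) * (p.1 - q.1) := by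
        rw [← h2, ← h3]
        unfold focal
        ring
      rw [h4] at h1
      have h5 : labelPart p.1 (label p) - labelPart q.1 (label p) =
          (p.1 - q.1) * (-Real.arctan (label p) -
            (4 - Real.arctan (label p)) * logSpeed (label p)) := by
        unfold labelPart; ring
      rw [hlab]
      linear_combination h5 + h1
    · have hA := (Real.continuous_arctan.tendsto z).comp hcont
      have hl := (contDiff_logSpeed.continuous.tendsto z).comp hcont
      have hl' := (contDiff_logSpeed.continuous.tendsto z).comp hξlim
      exact (hA.neg.sub ((hA.const_sub 4).mul hl)).add (hl'.mul (hA.const_sub 2))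
    · exact ((contDiff_logSpeed.continuous.tendsto z).comp hξlim).neg
  have h2 := (hasDerivAt_logPrimitive (q.2 + 2 * q.1)).comp_hasFDerivAt q (hasFDerivAt_ingoing q)
  refine (hpart.add h2.hasFDerivWithinAt).congr_fderiv ?_
  rw [hlab]
  ext
  · simp [solDeriv]; ring
  · simp [solDeriv]; ring

/-! ### Hölder continuity of the label -/

/-- Transports both labels to a common time `τ`. The displacement `x - 2t` differs between the
points by at most three times their distance, and each shift in time costs at most `|arctan| ≤ 2`
times its length. -/
lemma focal_sub_focal_le {p q : ℝ × ℝ} (hp : p ∈ closure OmegaC) (hq : q ∈ closure OmegaC)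
    {τ c : ℝ} (h1 : |τ - p.1| ≤ c * dist p q) (h2 : |τ - q.1| ≤ c * dist p q) :
    focal (label q) τ - focal (label p) τ ≤ (3 + 4 * c) * dist p q := by
  have e1 : focal (label p) p.1 + 2 * p.1 = p.2 := by
    rw [← char_snd]
    exact congrArg Prod.snd (label_mem_closedLabels hp).2
  have e2 : focal (label q) q.1 + 2 * q.1 = q.2 := by
    rw [← char_snd]
    exact congrArg Prod.snd (label_mem_closedLabels hq).2
  have e3 : focal (label q) τ - focal (label p) τ = (q.2 - p.2) - 2 * (q.1 - p.1) -
      (τ - q.1) * Real.arctan (label q) + (τ - p.1) * Real.arctan (label p) := by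
    rw [← e1, ← e2]; unfold focal; ring
  have d1 : |p.1 - q.1| ≤ dist p q := by rw [Prod.dist_eq]; exact le_max_left _ _
  have d2 : |p.2 - q.2| ≤ dist p q := by rw [Prod.dist_eq]; exact le_max_right _ _
  have b : ∀ y : ℝ, |Real.arctan y| ≤ 2 := fun y =>
    abs_le.2 ⟨by linarith [(arctan_mem y).1], by linarith [(arctan_mem y).2]⟩
  have c1 : |(τ - q.1) * Real.arctan (label q)| ≤ c * dist p q * 2 := by
    rw [abs_mul]
    exact mul_le_mul h2 (b _) (abs_nonneg _) (le_trans (abs_nonneg _) h2)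
  have c2 : |(τ - p.1) * Real.arctan (label p)| ≤ c * dist p q * 2 := by
    rw [abs_mul]
    exact mul_le_mul h1 (b _) (abs_nonneg _) (le_trans (abs_nonneg _) h1)
  rw [abs_le] at d1 d2 c1 c2
  rw [e3]
  linarith [c1.1, c2.2, d1.2, d2.1]

lemma time_le_of_closedLabels {w : ℝ × ℝ} (hw : w ∈ closedLabels) : w.2 ≤ 1 + w.1 ^ 2 :=
  (closedLabels_subset_labels hw).1

lemma label_sub_cube_le {p q : ℝ × ℝ} (hp : p ∈ closure OmegaC) (hq : q ∈ closure OmegaC)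
    (hp1 : |label p| ≤ 1) (hq1 : |label q| ≤ 1) :
    |label p - label q| ^ 3 ≤ 400 * dist p q := by
  wlog hpq : label p ≤ label q generalizing p q
  · rw [abs_sub_comm, dist_comm]
    exact this hq hp hq1 hp1 (not_le.1 hpq).le
  rw [abs_sub_comm, abs_of_nonneg (by linarith)]
  obtain ⟨hlp, -⟩ := label_mem_closedLabels hp
  obtain ⟨hlq, -⟩ := label_mem_closedLabels hq
  have tp : p.1 ≤ 1 + label p ^ 2 := time_le_of_closedLabels hlp
  have tq : q.1 ≤ 1 + label q ^ 2 := time_le_of_closedLabels hlq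
  have d1 : |p.1 - q.1| ≤ dist p q := by rw [Prod.dist_eq]; exact le_max_left _ _
  have d2 : |p.2 - q.2| ≤ dist p q := by rw [Prod.dist_eq]; exact le_max_right _ _
  have dn : 0 ≤ dist p q := dist_nonneg
  -- At the earlier of the two times neither label is past focusing, so the cubic bound applies
  -- there.
  by_cases hc : min p.1 q.1 ≤ 1 ∨ 0 ≤ label p ∨ label q ≤ 0
  · have k1 := cube_le_focal_sub hpq hp1 hq1 (le_trans (min_le_left _ _) tp)
      (le_trans (min_le_right _ _) tq) hc
    have k2 := focal_sub_focal_le hp hq (τ := min p.1 q.1) (c := 1)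
      (by
        rw [abs_sub_comm, abs_of_nonneg (by linarith [min_le_left p.1 q.1]), one_mul]
        rcases le_total p.1 q.1 with h | h
        · rw [min_eq_left h]; linarith
        · rw [min_eq_right h]; exact le_trans (le_abs_self _) d1)
      (by
        rw [abs_sub_comm, abs_of_nonneg (by linarith [min_le_right p.1 q.1]), one_mul]
        rcases le_total p.1 q.1 with h | h
        · rw [min_eq_left h]
          exact le_trans (le_abs_self _) (by rwa [abs_sub_comm])
        · rw [min_eq_right h]; linarith)
    norm_num at k1 k2
    linarith
  -- Opposite labels after time 1: `p` satisfies `x + 2t ≤ 4`, whereas at `q` this quantity is at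
  -- least `4 + 2 (t - 1)`. So both times are within `3 * dist p q` of 1, and time 1 can serve as
  -- the common time. This case gives `24 * 15 = 360`, the worst constant.
  · push Not at hc
    obtain ⟨h1, h2, h3⟩ := hc
    rw [lt_min_iff] at h1
    have u1 : ingoingCoord (label p) p.1 ≤ 4 := by
      rcases hlp with h | h
      · exact absurd h.1 (not_le.2 h2)
      · exact h.2
    have e1 := char_ingoingCoord (label p) p.1
    have e2 := char_ingoingCoord (label q) q.1
    have e1' : char (label p) p.1 = p := (label_mem_closedLabels hp).2
    have e2' : char (label q) q.1 = q := (label_mem_closedLabels hq).2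
    rw [e1'] at e1
    rw [e2'] at e2
    have h4 := arctan_le_self h3.le
    have h5 := (arctan_mem (label q)).2
    have h6 : 2 * (q.1 - 1) ≤ 3 * dist p q := by
      rw [abs_le] at d1 d2
      have : 4 + 2 * (q.1 - 1) ≤ ingoingCoord (label q) q.1 := by
        unfold ingoingCoord
        nlinarith
      linarith
    rw [abs_le] at d1
    have k1 := cube_le_focal_sub (t := 1) hpq hp1 hq1 (by nlinarith) (by nlinarith) (Or.inl le_rfl)
    have k2 := focal_sub_focal_le hp hq (τ := 1) (c := 3)
      (by rw [abs_le]; constructor <;> linarith)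
      (by rw [abs_le]; constructor <;> linarith)
    norm_num at k1 k2
    linarith

/-- The common time is that of the point with the smaller label, since the quadratic bound only
needs that label not to be past focusing. The 7 is `3 + 4 c` with `c = 1`. -/
lemma label_sub_sq_le {p q : ℝ × ℝ} (hp : p ∈ closure OmegaC) (hq : q ∈ closure OmegaC)
    {m R : ℝ} (hm : 0 < m) (hp1 : label p ∈ Icc m R) (hq1 : label q ∈ Icc m R) :
    |label p - label q| ^ 2 ≤ 7 * (1 + R ^ 2) / m * dist p q := by
  wlog hpq : label p ≤ label q generalizing p q
  · rw [abs_sub_comm, dist_comm]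
    exact this hq hp hq1 hp1 (not_le.1 hpq).le
  rw [abs_sub_comm, abs_of_nonneg (by linarith)]
  have tp : p.1 ≤ 1 + label p ^ 2 := time_le_of_closedLabels (label_mem_closedLabels hp).1
  have d1 : |p.1 - q.1| ≤ dist p q := by rw [Prod.dist_eq]; exact le_max_left _ _
  have k1 := sq_le_focal_sub hpq hm.le hp1.1 hq1.2 tp
  have k2 := focal_sub_focal_le hp hq (τ := p.1) (c := 1) (by simp) (by simpa using d1)
  have hR : (0 : ℝ) < 1 + R ^ 2 := by positivity
  have k3 := k1.trans k2
  rw [div_le_iff₀ hR] at k3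
  rw [div_mul_eq_mul_div, le_div_iff₀ hm]
  linarith

/-! ### Hölder continuity of functions of the label -/

lemma holderOnWith_of_dist_le {X E : Type*} [PseudoMetricSpace X] [PseudoMetricSpace E]
    {f : X → E} {s : Set X} {C α : ℝ≥0}
    (h : ∀ x ∈ s, ∀ y ∈ s, dist (f x) (f y) ≤ C * dist x y ^ (α : ℝ)) : HolderOnWith C α f s := by
  intro x hx y hy
  rw [edist_nndist, edist_nndist, ← ENNReal.coe_rpow_of_nonneg _ α.coe_nonneg, ← ENNReal.coe_mul,
    ENNReal.coe_le_coe]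
  exact h x hx y hy

/-- A `C¹` function of the label and `x + 2t` is locally Lipschitz in this pair, so it inherits the
Hölder exponent of the label. This serves the differential of the solution, the metric and `L`
alike. -/
lemma isHolderNear_of_label {E : Type*} [NormedAddCommGroup E] [NormedSpace ℝ E]
    {f : ℝ × ℝ → E} (hf : ContDiff ℝ 1 f) {p : ℝ × ℝ} (hp : p ∈ closure OmegaC) {n : ℕ}
    (hn : n ≠ 0) {α : ℝ≥0} (hα : (α : ℝ) = 1 / n) {A : ℝ} (hA : 0 ≤ A)
    {U : Set (ℝ × ℝ)} (hU : U ∈ 𝓝[closure OmegaC] p)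
    (hUb : ∀ q ∈ U, ∀ q' ∈ U, q ∈ closure OmegaC → q' ∈ closure OmegaC →
      |label q - label q'| ^ n ≤ A * dist q q') :
    ∃ r > 0, ∃ C : ℝ≥0, HolderOnWith C α (fun q => f (label q, q.2 + 2 * q.1))
      (closure OmegaC ∩ Metric.ball p r) := by
  obtain ⟨K, V, hV, hK⟩ :=
    (hf.contDiffAt (x := (label p, p.2 + 2 * p.1))).exists_lipschitzOnWith
  have hc : Tendsto (fun q : ℝ × ℝ => (label q, q.2 + 2 * q.1)) (𝓝[closure OmegaC] p)
      (𝓝 (label p, p.2 + 2 * p.1)) := by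
    refine (continuousOn_label p hp).prodMk_nhds ?_
    exact ((by fun_prop : Continuous fun q : ℝ × ℝ => q.2 + 2 * q.1).tendsto p).mono_left
      nhdsWithin_le_nhds
  have hW : U ∩ (fun q : ℝ × ℝ => (label q, q.2 + 2 * q.1)) ⁻¹' V ∈ 𝓝[closure OmegaC] p :=
    inter_mem hU (hc hV)
  obtain ⟨r, hr, hrW⟩ := Metric.mem_nhdsWithin_iff.1 hW
  -- Radius at most 1/2 keeps distances at most 1, so that the Lipschitz coordinate `x + 2t` is also
  -- Hölder of exponent `1 / n`.
  refine ⟨min r (1 / 2), by positivity, K * (max (A ^ (1 / n : ℝ)) 3).toNNReal, ?_⟩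
  apply holderOnWith_of_dist_le
  rintro q ⟨hq, hqr⟩ q' ⟨hq', hqr'⟩
  rw [Metric.mem_ball, lt_min_iff] at hqr hqr'
  obtain ⟨hqU, hqV⟩ := hrW ⟨hqr.1, hq⟩
  obtain ⟨hqU', hqV'⟩ := hrW ⟨hqr'.1, hq'⟩
  have h1 := hK.dist_le_mul _ hqV _ hqV'
  have hd : dist q q' ≤ 1 := by
    have := dist_triangle_right q q' p
    linarith
  have hαpos : 0 < (1 / n : ℝ) := by positivity
  have hα1 : (1 / n : ℝ) ≤ 1 := by
    rw [div_le_one (by positivity)]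
    exact_mod_cast Nat.one_le_iff_ne_zero.2 hn
  have h2 : dist (label q) (label q') ≤ A ^ (1 / n : ℝ) * dist q q' ^ (1 / n : ℝ) := by
    rw [← Real.mul_rpow hA dist_nonneg, Real.dist_eq]
    have := Real.rpow_le_rpow (by positivity) (hUb q hqU q' hqU' hq hq') hαpos.le
    rwa [one_div, Real.pow_rpow_inv_natCast (abs_nonneg _) hn, ← one_div] at this
  have h3 : dist (q.2 + 2 * q.1) (q'.2 + 2 * q'.1) ≤ 3 * dist q q' ^ (1 / n : ℝ) := by
    have d1 : |q.1 - q'.1| ≤ dist q q' := by rw [Prod.dist_eq]; exact le_max_left _ _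
    have d2 : |q.2 - q'.2| ≤ dist q q' := by rw [Prod.dist_eq]; exact le_max_right _ _
    have d3 : dist q q' ≤ dist q q' ^ (1 / n : ℝ) := by
      rcases (dist_nonneg (x := q) (y := q')).eq_or_lt with h0 | h0
      · rw [← h0]; positivity
      · calc dist q q' = dist q q' ^ (1 : ℝ) := (Real.rpow_one _).symm
          _ ≤ _ := Real.rpow_le_rpow_of_exponent_ge h0 hd hα1
    rw [Real.dist_eq]
    rw [abs_le] at d1 d2 ⊢
    constructor <;> linarith [d1.1, d1.2, d2.1, d2.2]
  have hpw : 0 ≤ dist q q' ^ (1 / n : ℝ) := by positivity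
  refine h1.trans ?_
  rw [hα, NNReal.coe_mul, Real.coe_toNNReal _ (by positivity), mul_assoc]
  refine mul_le_mul_of_nonneg_left ?_ K.coe_nonneg
  rw [Prod.dist_eq]
  refine max_le (h2.trans ?_) (h3.trans ?_)
  · exact mul_le_mul_of_nonneg_right (le_max_left _ _) hpw
  · exact mul_le_mul_of_nonneg_right (le_max_right _ _) hpw

lemma isHolderNear_initSing {E : Type*} [NormedAddCommGroup E] [NormedSpace ℝ E]
    {f : ℝ × ℝ → E} (hf : ContDiff ℝ 1 f) :
    IsHolderNear (1 / 3) (closure OmegaC) (fun q => f (label q, q.2 + 2 * q.1)) initSing := by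
  have hp : initSing ∈ closure OmegaC := sing_subset_closure (Or.inr rfl)
  have h0 : label initSing = 0 := by rw [initSing_eq]; exact label_singCurve le_rfl
  refine isHolderNear_of_label hf hp (n := 3) (by norm_num) (by norm_num)
    (A := 400) (by norm_num) (U := label ⁻¹' (Metric.closedBall 0 1)) ?_ ?_
  · refine continuousOn_label _ hp ?_
    rw [h0]
    exact Metric.closedBall_mem_nhds _ one_pos
  · intro q hq q' hq' h1 h2
    exact label_sub_cube_le h1 h2 (by simpa using hq) (by simpa using hq')

lemma isHolderNear_singBdry {E : Type*} [NormedAddCommGroup E] [NormedSpace ℝ E]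
    {f : ℝ × ℝ → E} (hf : ContDiff ℝ 1 f) {p : ℝ × ℝ} (hp : p ∈ singBdry) :
    IsHolderNear (1 / 2) (closure OmegaC) (fun q => f (label q, q.2 + 2 * q.1)) p := by
  have hp' : p ∈ closure OmegaC := sing_subset_closure (Or.inl hp)
  rw [singBdry_eq_image] at hp
  obtain ⟨z, hz, rfl⟩ := hp
  have hz : 0 < z := hz
  refine isHolderNear_of_label hf hp' (n := 2) (by norm_num) (by norm_num)
    (A := 7 * (1 + (2 * z) ^ 2) / (z / 2)) (by positivity)
    (U := label ⁻¹' (Icc (z / 2) (2 * z))) ?_ ?_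
  · refine continuousOn_label _ hp' ?_
    rw [label_singCurve hz.le]
    exact Icc_mem_nhds (by linarith) (by linarith)
  · intro q hq q' hq' h1 h2
    exact label_sub_sq_le h1 h2 (by positivity) hq hq'

lemma contDiff_solDeriv : ContDiff ℝ 1 solDeriv := by
  have h1 : ContDiff ℝ 1 fun w : ℝ × ℝ => Real.arctan w.1 :=
    Real.contDiff_arctan.comp contDiff_fst
  have h2 : ContDiff ℝ 1 fun w : ℝ × ℝ => logSpeed w.1 :=
    (contDiff_logSpeed.of_le (by simp)).comp contDiff_fst
  have h3 : ContDiff ℝ 1 fun w : ℝ × ℝ => logSpeed w.2 :=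
    (contDiff_logSpeed.of_le (by simp)).comp contDiff_snd
  exact (((h1.neg.sub (contDiff_const.mul h2)).add (contDiff_const.mul h3)).smul
    contDiff_const).add ((h3.sub h2).smul contDiff_const)

lemma isC1HolderNear_sol {α : ℝ≥0} {p : ℝ × ℝ}
    (h : IsHolderNear α (closure OmegaC) (fun q => solDeriv (label q, q.2 + 2 * q.1)) p) :
    IsC1HolderNear α (closure OmegaC) sol p := by
  obtain ⟨r, hr, C, hC⟩ := h
  exact ⟨r, hr, C, _, fun q hq => hasFDerivWithinAt_sol hq.1, hC⟩

/-! ### Sharpness of the regularity at the singular boundary -/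

/-- On `OmegaC` the derivative of any extension in the direction `(1, -2)` is `Ψ = -arctan (label)`.
A `C^{1,α}` extension would therefore make `arctan (label)` Hölder of exponent `α`. -/
lemma abs_arctan_label_sub_le {F : ℝ × ℝ → ℝ} (hF : EqOn F sol OmegaC) {α : ℝ≥0} {p : ℝ × ℝ}
    (h : IsC1HolderNear α (closure OmegaC) F p) :
    ∃ r > 0, ∃ C : ℝ≥0, ∀ q ∈ OmegaC ∩ Metric.ball p r, ∀ q' ∈ OmegaC ∩ Metric.ball p r,
      |Real.arctan (label q) - Real.arctan (label q')| ≤ C * dist q q' ^ (α : ℝ) := by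
  obtain ⟨r, hr, C, D, hD, hC⟩ := h
  have key : ∀ q ∈ OmegaC ∩ Metric.ball p r, D q (1, -2) = -Real.arctan (label q) := by
    rintro q ⟨h1, h2⟩
    have h3 : closure OmegaC ∈ 𝓝 q := mem_of_superset (isOpen_omegaC.mem_nhds h1) subset_closure
    have h4 := (hD q ⟨subset_closure h1, h2⟩).hasFDerivAt h3
    have h5 : sol =ᶠ[𝓝 q] F := by
      filter_upwards [isOpen_omegaC.mem_nhds h1] with x hx using (hF hx).symm
    have h6 := (h4.congr_of_eventuallyEq h5).unique
      (hasFDerivAt_sol (omegaC_subset_smoothDomain h1))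
    rw [h6]
    simp [solDeriv]; ring
  refine ⟨r, hr, C * 2, fun q hq q' hq' => ?_⟩
  have h1 : Real.arctan (label q) - Real.arctan (label q') = (D q' - D q) (1, -2) := by
    rw [sub_apply, key q hq, key q' hq']; ring
  have h2 : ‖((1 : ℝ), (-2 : ℝ))‖ = 2 := by simp [Prod.norm_def]
  have h3 := (D q' - D q).le_opNorm (1, -2)
  have h4 := hC.dist_le ⟨subset_closure hq.1, hq.2⟩ ⟨subset_closure hq'.1, hq'.2⟩
  rw [h2] at h3
  rw [dist_comm, dist_eq_norm] at h4
  rw [h1, ← Real.norm_eq_abs, NNReal.coe_mul, NNReal.coe_ofNat]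
  linarith

lemma false_of_eventually_le_rpow {c A β : ℝ} (hc : 0 < c) (hβ : 1 < β)
    (h : ∀ᶠ ε in 𝓝[>] (0 : ℝ), c * ε ≤ A * ε ^ β) : False := by
  have h1 : Tendsto (fun ε : ℝ => A * ε ^ (β - 1)) (𝓝[>] 0) (𝓝 0) := by
    have : Tendsto (fun ε : ℝ => ε ^ (β - 1)) (𝓝 0) (𝓝 0) := by
      have h2 := (Real.continuous_rpow_const (by linarith : 0 ≤ β - 1)).tendsto 0
      rwa [Real.zero_rpow (by linarith)] at h2
    simpa using (this.mono_left nhdsWithin_le_nhds).const_mul A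
  obtain ⟨ε, ⟨h2, h3⟩, h4⟩ := ((h.and (h1 (gt_mem_nhds hc))).and
    (self_mem_nhdsWithin : Ioi (0 : ℝ) ∈ _)).exists
  have h4 : 0 < ε := h4
  have h5 : ε ^ β = ε ^ (β - 1) * ε := by
    rw [← Real.rpow_add_one h4.ne']; ring_nf
  rw [h5] at h2
  have h6 : A * ε ^ (β - 1) < c := h3
  nlinarith

/-- Pairs of points at distance `O(εⁿ)` whose values of `Ψ` differ by at least a multiple of `ε`
rule out exponents above `1 / n`. -/
lemma not_isC1HolderNear {F : ℝ × ℝ → ℝ} (hF : EqOn F sol OmegaC) {α : ℝ≥0} {p : ℝ × ℝ}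
    {n : ℕ} (hα : 1 < n * (α : ℝ)) {q q' : ℝ → ℝ × ℝ}
    (hq : Tendsto q (𝓝[>] 0) (𝓝 p)) (hq' : Tendsto q' (𝓝[>] 0) (𝓝 p)) {c B : ℝ} (hc : 0 < c)
    (hB : 0 ≤ B)
    (h : ∀ᶠ ε in 𝓝[>] (0 : ℝ), q ε ∈ OmegaC ∧ q' ε ∈ OmegaC ∧
      c * ε ≤ |Real.arctan (label (q ε)) - Real.arctan (label (q' ε))| ∧
      dist (q ε) (q' ε) ≤ B * ε ^ n) :
    ¬ IsC1HolderNear α (closure OmegaC) F p := by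
  intro hH
  obtain ⟨r, hr, C, hC⟩ := abs_arctan_label_sub_le hF hH
  refine false_of_eventually_le_rpow (A := C * B ^ (α : ℝ)) hc hα ?_
  filter_upwards [h, hq (Metric.ball_mem_nhds p hr), hq' (Metric.ball_mem_nhds p hr),
    self_mem_nhdsWithin] with ε ⟨h1, h2, h3, h4⟩ h5 h6 h7
  have h7 : 0 < ε := h7
  refine (h3.trans (hC _ ⟨h1, h5⟩ _ ⟨h2, h6⟩)).trans ?_
  rw [mul_assoc]
  refine mul_le_mul_of_nonneg_left ?_ C.coe_nonneg
  refine (Real.rpow_le_rpow dist_nonneg h4 α.coe_nonneg).trans (le_of_eq ?_)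
  rw [Real.mul_rpow hB (by positivity), Real.rpow_mul h7.le, Real.rpow_natCast]

lemma dist_char (y z t : ℝ) : dist (char y t) (char z t) = |focal y t - focal z t| := by
  rw [Prod.dist_eq, char_fst, char_fst, dist_self, char_snd, char_snd, Real.dist_eq,
    add_sub_add_right_eq_sub, max_eq_right (abs_nonneg _)]

lemma continuous_char_left (t : ℝ) : Continuous fun y => char y t :=
  contDiff_charMap.continuous.comp (by fun_prop : Continuous fun y : ℝ => (y, t))

lemma char_mem_omegaC {y t : ℝ} (h : (y, t) ∈ openLabels) :
    char y t ∈ OmegaC ∧ label (char y t) = y :=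
  ⟨by rw [omegaC_eq]; exact ⟨_, h, rfl⟩, label_char (openLabels_subset_labels h)⟩

lemma not_isC1HolderNear_initSing {F : ℝ × ℝ → ℝ} (hF : EqOn F sol OmegaC) {α : ℝ≥0}
    (hα : 1 / 3 < α) : ¬ IsC1HolderNear α (closure OmegaC) F initSing := by
  have h0 : initSing = char 0 1 := by simp [initSing, char, psi0]
  have hα' : (1 / 3 : ℝ) < α := by exact_mod_cast hα
  -- Labels `±ε` at time 1: their distance is `2 (ε - arctan ε) ≤ 2 ε³`, and `2 arctan ε ≥ ε` for `ε
  -- < 1`.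
  refine not_isC1HolderNear hF (n := 3) (q := fun ε => char ε 1) (q' := fun ε => char (-ε) 1)
    (c := 1) (B := 2) (by push_cast; linarith) ?_ ?_ one_pos (by norm_num) ?_
  · rw [h0]
    exact ((continuous_char_left 1).tendsto 0).mono_left nhdsWithin_le_nhds
  · have := ((continuous_char_left 1).comp continuous_neg).tendsto 0
    simp only [Function.comp_def, neg_zero] at this
    rw [h0]
    exact this.mono_left nhdsWithin_le_nhds
  · filter_upwards [Ioo_mem_nhdsGT (one_pos : (0 : ℝ) < 1)] with ε hε
    obtain ⟨h1, h2⟩ := char_mem_omegaC (y := ε) (t := 1)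
      ⟨by simp only; nlinarith [hε.1], Or.inl hε.1⟩
    obtain ⟨h3, h4⟩ := char_mem_omegaC (y := -ε) (t := 1)
      ⟨by simp only; nlinarith [hε.1], Or.inr (by
        have := self_lt_arctan (y := -ε) (by linarith [hε.1])
        unfold ingoingCoord
        simp only
        linarith)⟩
    have h5 := self_le_one_add_sq_mul_arctan hε.1.le
    have h6 : 0 < Real.arctan ε := Real.arctan_pos.2 hε.1
    have h7 := arctan_le_self hε.1.le
    refine ⟨h1, h3, ?_, ?_⟩
    · rw [h2, h4, Real.arctan_neg, sub_neg_eq_add, abs_of_pos (by linarith)]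
      nlinarith [mul_pos h6 hε.1, hε.1, hε.2]
    · rw [dist_char]
      unfold focal
      rw [Real.arctan_neg, abs_le]
      have h8 : ε - ε ^ 3 ≤ Real.arctan ε := by
        nlinarith [mul_le_mul_of_nonneg_left h7 (sq_nonneg ε)]
      constructor <;> linarith

lemma not_isC1HolderNear_singBdry {F : ℝ × ℝ → ℝ} (hF : EqOn F sol OmegaC) {α : ℝ≥0}
    (hα : 1 / 2 < α) {p : ℝ × ℝ} (hp : p ∈ singBdry) :
    ¬ IsC1HolderNear α (closure OmegaC) F p := by
  rw [singBdry_eq_image] at hp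
  obtain ⟨z, hz, rfl⟩ := hp
  have hz : 0 < z := hz
  have hα' : (1 / 2 : ℝ) < α := by exact_mod_cast hα
  have hlim : ∀ k : ℝ, Tendsto (fun ε => char (z + k * ε) (1 + z ^ 2)) (𝓝[>] 0)
      (𝓝 (singCurve z)) := fun k => by
    have := ((continuous_char_left (1 + z ^ 2)).comp
      (by fun_prop : Continuous fun ε : ℝ => z + k * ε)).tendsto 0
    simp only [Function.comp_def, mul_zero, add_zero] at this
    rw [singCurve_eq_char]
    exact this.mono_left nhdsWithin_le_nhds
  -- Labels `z + ε` and `z + 2ε` at time `1 + z²`, both not yet focused. In between `focal` has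
  -- derivative at most `η² - z² ≤ 4 (z + 1) ε`, while `arctan` has derivative at least `1 / (1 + (z
  -- + 2)²)`.
  refine not_isC1HolderNear hF (n := 2) (q := fun ε => char (z + 1 * ε) (1 + z ^ 2))
    (q' := fun ε => char (z + 2 * ε) (1 + z ^ 2)) (c := 1 / (1 + (z + 2) ^ 2))
    (B := 4 * (z + 1)) (by push_cast; linarith) (hlim 1) (hlim 2) (by positivity)
    (by positivity) ?_
  filter_upwards [Ioo_mem_nhdsGT (one_pos : (0 : ℝ) < 1)] with ε ⟨hε, hε1⟩
  obtain ⟨h1, h2⟩ := char_mem_omegaC (y := z + 1 * ε) (t := 1 + z ^ 2)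
    ⟨by simp only; nlinarith, Or.inl (by simp only; linarith)⟩
  obtain ⟨h3, h4⟩ := char_mem_omegaC (y := z + 2 * ε) (t := 1 + z ^ 2)
    ⟨by simp only; nlinarith, Or.inl (by simp only; linarith)⟩
  have hlin : ∀ c η : ℝ, HasDerivAt (fun η : ℝ => c * η) c η := fun c η => by
    simpa using (hasDerivAt_id η).const_mul c
  refine ⟨h1, h3, ?_, ?_⟩
  · rw [h2, h4, abs_sub_comm]
    refine le_trans ?_ (le_abs_self _)
    have := monotoneOn_sub_of_hasDerivAt_le (by linarith : z + 1 * ε ≤ z + 2 * ε)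
      Real.hasDerivAt_arctan (hlin (1 / (1 + (z + 2) ^ 2))) (fun η h5 h6 => by
        have : η ^ 2 ≤ (z + 2) ^ 2 := by nlinarith
        gcongr)
    linarith
  · rw [dist_char, abs_sub_comm]
    have h5 := focal_lt (y := z + 1 * ε) (z := z + 2 * ε) (t := 1 + z ^ 2) (by linarith)
      (by nlinarith) (by nlinarith) (Or.inr (Or.inl (by positivity)))
    rw [abs_of_pos (by linarith)]
    have := monotoneOn_sub_of_hasDerivAt_le (by linarith : z + 1 * ε ≤ z + 2 * ε)
      (hlin (4 * (z + 1) * ε)) (fun η => hasDerivAt_focal η (1 + z ^ 2)) (fun η h5 h6 => by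
        have h7 : (0 : ℝ) < 1 + η ^ 2 := by positivity
        rw [sub_le_iff_le_add, ← sub_le_iff_le_add', le_div_iff₀ h7]
        have h8 : η ^ 2 - z ^ 2 ≤ 4 * (z + 1) * ε := by
          have : η - z ≤ 2 * ε := by linarith
          have : η + z ≤ 2 * (z + 1) := by linarith
          nlinarith
        have h9 : 0 ≤ 4 * (z + 1) * ε := by positivity
        nlinarith [mul_nonneg h9 (sq_nonneg η)])
    nlinarith

/-! ### Blow-up of the second derivatives -/

lemma abs_dx_dx_le {Φ : ℝ × ℝ → ℝ} {q : ℝ × ℝ} (h : ContDiffAt ℝ 2 Φ q) :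
    |dx (dx Φ) q| ≤ ‖iteratedFDeriv ℝ 2 Φ q‖ := by
  have hd : DifferentiableAt ℝ (fderiv ℝ Φ) q :=
    (h.fderiv_right (m := 1) (by norm_num)).differentiableAt (by simp)
  have h1 : dx (dx Φ) q = iteratedFDeriv ℝ 2 Φ q ![(0, 1), (0, 1)] := by
    rw [iteratedFDeriv_two_apply]
    unfold dx
    rw [fderiv_clm_apply hd (differentiableAt_const _)]
    simp
  rw [h1, ← Real.norm_eq_abs]
  refine (ContinuousMultilinearMap.le_opNorm _ _).trans (le_of_eq ?_)
  simp [Fin.prod_univ_two, Prod.norm_def]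

/-- In `∂ₓ²Φ` one term is a quantity with positive limit divided by the focusing factor, which tends
to 0 from above; the other term converges. -/
lemma tendsto_norm_iteratedFDeriv_sol {p : ℝ × ℝ} (hp : p ∈ singBdry ∪ {initSing})
    {u : ℕ → ℝ × ℝ} (hu : ∀ n, u n ∈ OmegaC) (hlim : Tendsto u atTop (𝓝 p)) :
    Tendsto (fun n => ‖iteratedFDeriv ℝ 2 sol (u n)‖) atTop atTop := by
  have hcl := sing_subset_closure hp
  rw [sing_eq_image] at hp
  obtain ⟨z, hz, rfl⟩ := hp
  have hz : 0 ≤ z := hz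
  have hmem : ∀ n, u n ∈ smoothDomain := fun n => omegaC_subset_smoothDomain (hu n)
  have hlab : Tendsto (fun n => label (u n)) atTop (𝓝 z) := by
    have h1 := continuousOn_label _ hcl
    rw [ContinuousWithinAt, label_singCurve hz] at h1
    exact h1.comp (tendsto_nhdsWithin_iff.2
      ⟨hlim, Eventually.of_forall fun n => subset_closure (hu n)⟩)
  have hfoc : Tendsto (fun n => 1 - (u n).1 / (1 + label (u n) ^ 2)) atTop (𝓝[>] 0) := by
    rw [tendsto_nhdsWithin_iff]
    refine ⟨?_, Eventually.of_forall fun n => focus_pos (hmem n)⟩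
    have h1 : Tendsto (fun n => (u n).1) atTop (𝓝 (1 + z ^ 2)) :=
      (continuous_fst.tendsto (singCurve z)).comp hlim
    have hz2 : 1 + z ^ 2 ≠ 0 := by positivity
    have h2 := (h1.div ((hlab.pow 2).const_add 1) hz2).const_sub 1
    rwa [div_self hz2, sub_self] at h2
  have hA := (Real.continuous_arctan.tendsto z).comp hlab
  have hc1 : Tendsto (fun n => 1 / (1 + label (u n) ^ 2) / (4 - Real.arctan (label (u n)))) atTop
      (𝓝 (1 / (1 + z ^ 2) / (4 - Real.arctan z))) :=
    ((tendsto_const_nhds.div ((hlab.pow 2).const_add 1) (by positivity)).div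
      (hA.const_sub 4) (speed_pos z).ne')
  have hpos : 0 < 1 / (1 + z ^ 2) / (4 - Real.arctan z) := by
    have := speed_pos z
    positivity
  have hw : Tendsto (fun n => (u n).2 + 2 * (u n).1) atTop
      (𝓝 ((singCurve z).2 + 2 * (singCurve z).1)) :=
    ((by fun_prop : Continuous fun q : ℝ × ℝ => q.2 + 2 * q.1).tendsto (singCurve z)).comp hlim
  have hAw := (Real.continuous_arctan.tendsto _).comp hw
  have hc2 := ((tendsto_const_nhds (x := (1 : ℝ))).div ((hw.pow 2).const_add 1)
    (by positivity)).neg.div (hAw.const_sub 4) (speed_pos _).ne'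
  have h3 := (hc1.pos_mul_atTop hpos hfoc.inv_tendsto_nhdsGT_zero).atTop_add hc2
  refine tendsto_atTop_mono (fun n => ?_) h3
  refine le_trans (le_of_eq ?_) ((le_abs_self _).trans
    (abs_dx_dx_le (((contDiffOn_sol.contDiffAt (isOpen_smoothDomain.mem_nhds (hmem n)))).of_le
      ENat.LEInfty.out)))
  rw [dx_dx_sol (hmem n), div_eq_mul_inv _ (1 - (u n).1 / (1 + label (u n) ^ 2))]
  rfl

/-! ### The extended metric and the extended outgoing vector field -/

/-- The acoustical metric, extended to the boundary. -/
def extMetric (q : ℝ × ℝ) : Matrix (Fin 2) (Fin 2) ℝ := acousticMetric (-Real.arctan (label q))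

/-- The outgoing vector field, extended to the boundary. -/
def extOutgoing (q : ℝ × ℝ) : ℝ × ℝ := outgoing (-Real.arctan (label q))

lemma contDiff_acousticMetric (i j : Fin 2) :
    ContDiff ℝ ∞ fun y => acousticMetric (-Real.arctan y) i j := by
  have h1 := Real.contDiff_arctan (n := ∞)
  have h2 : ∀ y, (4 + -Real.arctan y) ^ 2 ≠ 0 := fun y => by
    have := speed_pos y
    have : 0 < 4 + -Real.arctan y := by linarith
    positivity
  have h3 : ContDiff ℝ ∞ fun y => (4 + -Real.arctan y) ^ 2 := by fun_prop
  have h4 : ContDiff ℝ ∞ fun y => -(8 * (2 + -Real.arctan y)) := by fun_prop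
  have h5 : ContDiff ℝ ∞ fun y => -(2 * -Real.arctan y) := by fun_prop
  fin_cases i <;> fin_cases j
  · exact h4.div h3 h2
  · exact h5.div h3 h2
  · exact h5.div h3 h2
  · exact contDiff_const.div h3 h2

lemma contDiff_outgoing : ContDiff ℝ ∞ fun y => outgoing (-Real.arctan y) := by
  have h1 := Real.contDiff_arctan (n := ∞)
  unfold outgoing
  fun_prop

lemma continuousOn_extMetric : ContinuousOn extMetric (closure OmegaC) := by
  refine Continuous.comp_continuousOn (g := fun y => acousticMetric (-Real.arctan y)) ?_
    continuousOn_label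
  exact continuous_matrix fun i j => (contDiff_acousticMetric i j).continuous

lemma extMetric_eqOn : EqOn extMetric (fun q => acousticMetric (psi sol q)) OmegaC := fun q hq => by
  simp only [extMetric, psi_sol (omegaC_subset_smoothDomain hq)]

lemma extOutgoing_eqOn : EqOn extOutgoing (fun q => outgoing (psi sol q)) OmegaC := fun q hq => by
  simp only [extOutgoing, psi_sol (omegaC_subset_smoothDomain hq)]

lemma isSmoothOn_of_contDiffOn {f : ℝ × ℝ → ℝ} (h : ContDiffOn ℝ ∞ f smoothDomain) :
    IsSmoothOn f (OmegaC ∪ cauchyHor) :=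
  ⟨smoothDomain, f, isOpen_smoothDomain,
    union_subset omegaC_subset_smoothDomain cauchyHor_subset_smoothDomain, h, fun _ _ => rfl⟩

lemma form_extMetric_eq_zero {q v : ℝ × ℝ}
    (h : v.2 = (2 - Real.arctan (label q)) * v.1 ∨ v.2 = -2 * v.1) :
    form (extMetric q) v v = 0 := by
  rw [extMetric, form_acousticMetric]
  rcases h with h | h <;> rw [h] <;> ring

/-! ### Tangents of the boundary -/

/-- The singular boundary is the envelope of the characteristics: in the derivative of `singCurve`
the terms from varying the label cancel by the focusing condition. Its slope is thus that of the
characteristic touching it. -/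
lemma hasDerivAt_singX {t : ℝ} (ht : 1 < t) :
    HasDerivAt singX (2 - Real.arctan (Real.sqrt (t - 1))) t := by
  set r := Real.sqrt (t - 1) with hr
  have hr0 : 0 < r := Real.sqrt_pos.2 (by linarith)
  have h1 : HasDerivAt (fun t : ℝ => Real.sqrt (t - 1)) (1 / (2 * r)) t :=
    ((hasDerivAt_id t).sub_const 1).sqrt (by simp only [id]; linarith)
  have h2 : HasDerivAt (fun z => (singCurve z).2) (2 * r * (2 - Real.arctan r)) r := by
    have := ((((Real.hasDerivAt_arctan r).const_sub 2).mul
      (((hasDerivAt_id r).pow 2).const_add 1)).add (hasDerivAt_id r))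
    refine this.congr_deriv ?_
    have : 1 + r ^ 2 ≠ 0 := by positivity
    simp only [id, Pi.pow_apply]
    field_simp
    push_cast
    ring
  refine (h2.comp t h1).congr_deriv ?_
  field_simp

lemma label_singX {t : ℝ} (ht : 1 < t) : label (t, singX t) = Real.sqrt (t - 1) := by
  have h : (t, singX t) = singCurve (Real.sqrt (t - 1)) := by
    refine Prod.ext ?_ rfl
    simp only [singCurve]
    rw [Real.sq_sqrt (by linarith)]; ring
  rw [h, label_singCurve (Real.sqrt_nonneg _)]

lemma isTangent_graph {f : ℝ → ℝ} {a d : ℝ} (hf : ContDiffOn ℝ ∞ f (Ioi a)) {p : ℝ × ℝ}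
    (hp : p ∈ {q : ℝ × ℝ | a < q.1 ∧ q.2 = f q.1}) (hd : HasDerivAt f d p.1) :
    IsTangent {q : ℝ × ℝ | a < q.1 ∧ q.2 = f q.1} p (1, d) := by
  refine ⟨fun s => (p.1 + s, f (p.1 + s)), ?_, ?_, ?_, ?_⟩
  · have h1 : ContDiffAt ℝ ∞ f (p.1 + 0) := by
      rw [add_zero]; exact hf.contDiffAt (Ioi_mem_nhds hp.1)
    have h2 : ContDiffAt ℝ ∞ (fun s : ℝ => p.1 + s) 0 := by fun_prop
    exact h2.prodMk (ContDiffAt.comp (g := f) 0 h1 h2)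
  · simp only [add_zero]
    exact Prod.ext rfl hp.2.symm
  · have : ∀ᶠ s in 𝓝 (0 : ℝ), a < p.1 + s :=
      (by fun_prop : Continuous fun s : ℝ => p.1 + s).continuousAt.eventually
        (lt_mem_nhds (by simpa using hp.1))
    filter_upwards [this] with s hs
    exact ⟨hs, rfl⟩
  · have h1 : HasDerivAt (fun s : ℝ => p.1 + s) 1 0 := (hasDerivAt_id 0).const_add p.1
    have h2 : HasDerivAt f d (p.1 + 0) := by rwa [add_zero]
    simpa using h1.prodMk (HasDerivAt.comp (h₂ := f) 0 h2 h1)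

lemma snd_eq_of_isTangent_graph {f : ℝ → ℝ} {a d : ℝ} {p v : ℝ × ℝ} (hd : HasDerivAt f d p.1)
    (h : IsTangent {q : ℝ × ℝ | a < q.1 ∧ q.2 = f q.1} p v) : v.2 = d * v.1 := by
  obtain ⟨c, -, h0, h1, h2⟩ := h
  have h3 : HasDerivAt (fun s => (c s).1) v.1 0 :=
    (ContinuousLinearMap.fst ℝ ℝ ℝ).hasFDerivAt.comp_hasDerivAt 0 h2
  have h4 : HasDerivAt (fun s => (c s).2) v.2 0 :=
    (ContinuousLinearMap.snd ℝ ℝ ℝ).hasFDerivAt.comp_hasDerivAt 0 h2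
  have h5 : HasDerivAt (fun s => f (c s).1) (d * v.1) 0 :=
    HasDerivAt.comp (h₂ := f) 0 (by rwa [h0]) h3
  exact h4.unique (h5.congr_of_eventuallyEq (h1.mono fun s hs => hs.2))

lemma isTangent_cauchyHor {p : ℝ × ℝ} (hp : p ∈ cauchyHor) : IsTangent cauchyHor p ingoing :=
  isTangent_graph (f := fun t => 4 - 2 * t) (by fun_prop) hp (by
    simpa using ((hasDerivAt_id p.1).const_mul 2).const_sub 4)

lemma isNullCurve_cauchyHor : IsNullCurve extMetric cauchyHor := fun p _ v hv => by
  refine form_extMetric_eq_zero (Or.inr ?_)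
  exact snd_eq_of_isTangent_graph (f := fun t => 4 - 2 * t) (by
    simpa using ((hasDerivAt_id p.1).const_mul 2).const_sub 4) hv

lemma label_of_mem_singBdry {p : ℝ × ℝ} (hp : p ∈ singBdry) : label p = Real.sqrt (p.1 - 1) := by
  rw [← label_singX hp.1]
  exact congrArg label (Prod.ext rfl hp.2)

lemma isTangent_singBdry {p : ℝ × ℝ} (hp : p ∈ singBdry) :
    IsTangent singBdry p (extOutgoing p) := by
  have := isTangent_graph contDiffOn_singX hp (hasDerivAt_singX hp.1)
  rw [← label_of_mem_singBdry hp] at this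
  exact this

lemma isNullCurve_singBdry : IsNullCurve extMetric singBdry := fun p hp v hv => by
  refine form_extMetric_eq_zero (Or.inl ?_)
  rw [label_of_mem_singBdry hp]
  exact snd_eq_of_isTangent_graph (hasDerivAt_singX hp.1) hv

/-! ### Degeneracy along the singular boundary -/

/-- The two curves are the envelope and the characteristic that touches it at `p`. Taking `a = z²`
keeps the envelope at times greater than 1. -/
lemma exists_backward_integral_curves {p : ℝ × ℝ} (hp : p ∈ singBdry) :
    ∃ a > 0, ∃ γ₁ γ₂ : ℝ → ℝ × ℝ,
      IsBackwardIntegralCurve extOutgoing a γ₁ ∧ γ₁ 0 = p ∧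
      IsBackwardIntegralCurve extOutgoing a γ₂ ∧ γ₂ 0 = p ∧
      MapsTo γ₁ (Ioc (-a) 0) singBdry ∧ MapsTo γ₂ (Ioo (-a) 0) OmegaC ∧
      ∀ s ∈ Ioo (-a) 0, γ₁ s ≠ γ₂ s := by
  have hp' := hp
  rw [singBdry_eq_image] at hp
  obtain ⟨z, hz, rfl⟩ := hp
  have hz : 0 < z := hz
  have hadd : ∀ s, HasDerivAt (fun s : ℝ => 1 + z ^ 2 + s) 1 s := fun s =>
    (hasDerivAt_id s).const_add _
  have hmem1 : MapsTo (fun s : ℝ => (1 + z ^ 2 + s, singX (1 + z ^ 2 + s))) (Ioc (-(z ^ 2)) 0)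
      singBdry := fun s hs => ⟨by simp only; linarith [hs.1], rfl⟩
  have hmem2 : MapsTo (fun s => char z (1 + z ^ 2 + s)) (Ioo (-(z ^ 2)) 0) OmegaC := fun s hs =>
    (char_mem_omegaC ⟨by simp only; linarith [hs.2], Or.inl hz⟩).1
  refine ⟨z ^ 2, by positivity, fun s => (1 + z ^ 2 + s, singX (1 + z ^ 2 + s)),
    fun s => char z (1 + z ^ 2 + s), ?_, ?_, ?_, ?_, hmem1, hmem2, ?_⟩
  · intro s hs
    have h1 : 1 < 1 + z ^ 2 + s := by linarith [hs.1]
    have h2 := (hadd s).prodMk (HasDerivAt.comp (h₂ := singX) s (hasDerivAt_singX h1) (hadd s))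
    rw [mul_one] at h2
    refine h2.hasDerivWithinAt.congr_deriv ?_
    rw [extOutgoing, label_singX h1]
    rfl
  · simp only [add_zero]
    exact Prod.ext rfl hp'.2.symm
  · intro s hs
    have h1 : label (char z (1 + z ^ 2 + s)) = z :=
      label_char (closedLabels_subset_labels (Or.inl ⟨hz.le, by simp only; linarith [hs.2]⟩))
    simp only [extOutgoing, h1]
    have h2 := (hadd s).prodMk (((hadd s).mul_const (2 + psi0 z)).const_add z)
    rw [one_mul] at h2
    exact h2.hasDerivWithinAt
  · simp only [add_zero]
    exact (singCurve_eq_char z).symm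
  · intro s hs h
    have h1 := hmem1 (Ioo_subset_Ioc_self hs)
    have h2 := hmem2 hs
    simp only at h h1 h2
    rw [← h] at h2
    have h3 : ((1 + z ^ 2 + s, singX (1 + z ^ 2 + s)) : ℝ × ℝ) ∈ frontier OmegaC := by
      rw [frontier_omegaC]; exact Or.inl (Or.inl h1)
    rw [isOpen_omegaC.frontier_eq] at h3
    exact h3.2 h2

/-! ### Curves that are timelike for a pair of characteristic slopes -/

/-- `γ` is a `C¹` curve on `I` whose velocity lies strictly between the directions of slopes
`α` and `β`. -/
def IsConeCurve (α β : ℝ × ℝ → ℝ) (I : Set ℝ) (γ : ℝ → ℝ × ℝ) : Prop :=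
  ∃ γ' : ℝ → ℝ × ℝ, ContinuousOn γ' I ∧ ∀ s ∈ I, HasDerivWithinAt γ (γ' s) I s ∧
    ((γ' s).2 - α (γ s) * (γ' s).1) * ((γ' s).2 - β (γ s) * (γ' s).1) < 0

/-- Every inextendible curve in `Ω` that is timelike for the slopes `α`, `β` meets `{t = 0}`
exactly once. -/
def IsConeCauchy (Ω : Set (ℝ × ℝ)) (α β : ℝ × ℝ → ℝ) : Prop :=
  ∀ (I : Set ℝ) (γ : ℝ → ℝ × ℝ), I.OrdConnected → I.Nontrivial → MapsTo γ I Ω →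
    IsConeCurve α β I γ → ¬ IsExtendible Ω I γ → ∃! s, s ∈ I ∧ (γ s).1 = 0

lemma isTimelikeCurve_iff {ψ : ℝ × ℝ → ℝ} {Ω : Set (ℝ × ℝ)} (hψ : ∀ q ∈ Ω, ψ q ≠ -4) {I : Set ℝ}
    {γ : ℝ → ℝ × ℝ} (hγ : MapsTo γ I Ω) :
    IsTimelikeCurve (fun q => acousticMetric (ψ q)) I γ ↔
      IsConeCurve (fun q => 2 + ψ q) (fun _ => -2) I γ := by
  refine exists_congr fun γ' => and_congr_right fun _ => forall₂_congr fun s hs =>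
    and_congr_right fun _ => ?_
  exact form_acousticMetric_neg_iff (hψ _ (hγ hs)) _

/-- Trades the metric for its two characteristic slopes, a form that is stable under reflections of
`t` and `x` and under exchanging the slopes. -/
lemma isCauchyHypersurface_iff {ψ : ℝ × ℝ → ℝ} {Ω : Set (ℝ × ℝ)} (hψ : ∀ q ∈ Ω, ψ q ≠ -4) :
    IsCauchyHypersurface Ω (fun q => acousticMetric (ψ q)) ↔
      IsConeCauchy Ω (fun q => 2 + ψ q) (fun _ => -2) := by
  constructor
  · intro h I γ h1 h2 h3 h4 h5
    exact h I γ h1 h2 h3 ((isTimelikeCurve_iff hψ h3).2 h4) h5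
  · intro h I γ h1 h2 h3 h4 h5
    exact h I γ h1 h2 h3 ((isTimelikeCurve_iff hψ h3).1 h4) h5

lemma pos_or_neg_of_ne_zero {f : ℝ → ℝ} {I : Set ℝ} (hI : I.OrdConnected)
    (hf : ContinuousOn f I) (h : ∀ s ∈ I, f s ≠ 0) : (∀ s ∈ I, 0 < f s) ∨ ∀ s ∈ I, f s < 0 := by
  by_contra! hc
  obtain ⟨⟨s, hs, h1⟩, ⟨r, hr, h2⟩⟩ := hc
  obtain ⟨x, hx, h0⟩ := hI.isPreconnected.intermediate_value hs hr hf ⟨h1, h2⟩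
  exact h x hx h0

lemma monotoneOn_of_hasDerivWithinAt {f f' : ℝ → ℝ} {I : Set ℝ} (hI : I.OrdConnected)
    (h : ∀ s ∈ I, HasDerivWithinAt f (f' s) I s) (h0 : ∀ s ∈ I, 0 ≤ f' s) : MonotoneOn f I :=
  monotoneOn_of_hasDerivWithinAt_nonneg hI.convex (fun s hs => (h s hs).continuousWithinAt)
    (fun s hs => (h s (interior_subset hs)).mono interior_subset)
    fun s hs => h0 s (interior_subset hs)

lemma antitoneOn_of_hasDerivWithinAt {f f' : ℝ → ℝ} {I : Set ℝ} (hI : I.OrdConnected)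
    (h : ∀ s ∈ I, HasDerivWithinAt f (f' s) I s) (h0 : ∀ s ∈ I, f' s ≤ 0) : AntitoneOn f I :=
  antitoneOn_of_hasDerivWithinAt_nonpos hI.convex (fun s hs => (h s hs).continuousWithinAt)
    (fun s hs => (h s (interior_subset hs)).mono interior_subset)
    fun s hs => h0 s (interior_subset hs)

lemma strictMonoOn_of_hasDerivWithinAt {f f' : ℝ → ℝ} {I : Set ℝ} (hI : I.OrdConnected)
    (h : ∀ s ∈ I, HasDerivWithinAt f (f' s) I s) (h0 : ∀ s ∈ I, 0 < f' s) : StrictMonoOn f I :=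
  strictMonoOn_of_hasDerivWithinAt_pos hI.convex (fun s hs => (h s hs).continuousWithinAt)
    (fun s hs => (h s (interior_subset hs)).mono interior_subset)
    fun s hs => h0 s (interior_subset hs)

/-! ### Global hyperbolicity of the development -/

lemma tendsto_of_label {J : Type*} {γ : J → ℝ × ℝ} {l : Filter J} {y t : ℝ}
    (hmem : ∀ s, γ s ∈ OmegaC)
    (h1 : Tendsto (fun s => label (γ s)) l (𝓝 y)) (h2 : Tendsto (fun s => (γ s).1) l (𝓝 t)) :
    Tendsto γ l (𝓝 (char y t)) := by
  have h : γ = fun s => charMap (label (γ s), (γ s).1) :=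
    funext fun s => (label_mem_openLabels (hmem s)).2.symm
  rw [h]
  exact (contDiff_charMap.continuous.tendsto (y, t)).comp (h1.prodMk_nhds h2)

lemma ingoingCoord_label {q : ℝ × ℝ} (hq : q ∈ OmegaC) :
    ingoingCoord (label q) q.1 = q.2 + 2 * q.1 := by
  rw [← char_ingoingCoord, (label_mem_openLabels hq).2]

section Limits

variable {J : Type*} [LinearOrder J] [Nonempty J] {γ : J → ℝ × ℝ}

/-- A past directed curve in the future of the initial line has an end point in the development. -/
lemma exists_limit_past (hmem : ∀ s, γ s ∈ OmegaC) (hT : Monotone fun s => (γ s).1)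
    (hY : Antitone fun s => label (γ s)) (hU : Monotone fun s => (γ s).2 + 2 * (γ s).1)
    (hpos : ∀ s, 0 < (γ s).1) : ∃ q ∈ OmegaC, Tendsto γ atBot (𝓝 q) := by
  obtain ⟨s₀⟩ := ‹Nonempty J›
  have hTb : BddBelow (range fun s => (γ s).1) := ⟨0, by rintro _ ⟨s, rfl⟩; exact (hpos s).le⟩
  have hYb : BddAbove (range fun s => label (γ s)) := by
    refine ⟨(γ s₀).2 + 2 * (γ s₀).1, ?_⟩
    -- As `t > 0`, the foot of the outgoing line lies to the left of that of the ingoing line. This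
    -- bounds the label towards the past end.
    have key : ∀ s, label (γ s) ≤ (γ s).2 + 2 * (γ s).1 := fun s => by
      rw [← ingoingCoord_label (hmem s), ingoingCoord]
      linarith [mul_pos (hpos s) (speed_pos (label (γ s)))]
    rintro _ ⟨s, rfl⟩
    rcases le_total s s₀ with h | h
    · exact (key s).trans (hU h)
    · exact (hY h).trans (key s₀)
  have h1 := tendsto_atBot_ciInf hT hTb
  have h2 := tendsto_atBot_ciSup hY hYb
  set t := ⨅ s, (γ s).1
  set y := ⨆ s, label (γ s)
  have hlim := tendsto_of_label hmem h2 h1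
  have ht0 : 0 ≤ t := ge_of_tendsto' h1 fun s => (hpos s).le
  have ht : t ≤ (γ s₀).1 := ciInf_le hTb s₀
  have hy : label (γ s₀) ≤ y := le_ciSup hYb s₀
  have hu : ingoingCoord y t ≤ ingoingCoord (label (γ s₀)) (γ s₀).1 := by
    have h3 : Tendsto (fun s => (γ s).2 + 2 * (γ s).1) atBot (𝓝 (ingoingCoord y t)) := by
      rw [← char_ingoingCoord]
      exact ((by fun_prop : Continuous fun q : ℝ × ℝ => q.2 + 2 * q.1).tendsto _).comp hlim
    rw [ingoingCoord_label (hmem s₀)]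
    exact le_of_tendsto h3 ((eventually_le_atBot s₀).mono fun s hs => hU hs)
  refine ⟨char y t, (char_mem_omegaC ?_).1, hlim⟩
  obtain ⟨h3, h4⟩ := (label_mem_openLabels (hmem s₀)).1
  simp only at h3 h4
  -- Towards the past the label grows and the time drops, so an unfocused positive label stays so.
  -- Otherwise `x + 2t < 4` persists, and a focused limit would violate `four_lt_ingoingCoord_sing`
  -- if its label were positive.
  rcases lt_or_ge 0 (label (γ s₀)) with h5 | h5
  · exact ⟨by simp only; nlinarith, Or.inl (h5.trans_le hy)⟩
  · have h6 := hu.trans_lt (h4.resolve_left (not_lt.2 h5))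
    refine ⟨?_, Or.inr h6⟩
    rcases lt_trichotomy y 0 with h7 | h7 | h7
    · exact lt_of_ingoingCoord h7 h6.le
    · simp only [h7, ingoingCoord, Real.arctan_zero] at h6 ⊢
      linarith
    · by_contra! h8
      have h9 := (ingoingCoord_mono y).monotone h8
      linarith [four_lt_ingoingCoord_sing h7]

/-- Here `t ≤ 0` in the limit, where nothing focuses and membership in `openLabels` is automatic. -/
lemma exists_limit_future (hmem : ∀ s, γ s ∈ OmegaC) (hT : Monotone fun s => (γ s).1)
    (hY : Antitone fun s => label (γ s)) (hU : Monotone fun s => (γ s).2 + 2 * (γ s).1)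
    (hneg : ∀ s, (γ s).1 < 0) : ∃ q ∈ OmegaC, Tendsto γ atTop (𝓝 q) := by
  obtain ⟨s₀⟩ := ‹Nonempty J›
  have hTb : BddAbove (range fun s => (γ s).1) := ⟨0, by rintro _ ⟨s, rfl⟩; exact (hneg s).le⟩
  have hYb : BddBelow (range fun s => label (γ s)) := by
    refine ⟨(γ s₀).2 + 2 * (γ s₀).1, ?_⟩
    have key : ∀ s, (γ s).2 + 2 * (γ s).1 ≤ label (γ s) := fun s => by
      rw [← ingoingCoord_label (hmem s), ingoingCoord]
      linarith [mul_neg_of_neg_of_pos (hneg s) (speed_pos (label (γ s)))]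
    rintro _ ⟨s, rfl⟩
    rcases le_total s₀ s with h | h
    · exact (hU h).trans (key s)
    · exact (key s₀).trans (hY h)
  have h1 := tendsto_atTop_ciSup hT hTb
  have h2 := tendsto_atTop_ciInf hY hYb
  set t := ⨆ s, (γ s).1
  set y := ⨅ s, label (γ s)
  have ht0 : t ≤ 0 := le_of_tendsto' h1 fun s => (hneg s).le
  refine ⟨char y t, (char_mem_omegaC ⟨by simp only; nlinarith, ?_⟩).1, tendsto_of_label hmem h2 h1⟩
  rcases lt_or_ge 0 y with h | h
  · exact Or.inl h
  · right
    unfold ingoingCoord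
    nlinarith [speed_pos y]

end Limits

lemma mul_neg_cases {a b v w : ℝ} (hab : b < a) (h : (w - a * v) * (w - b * v) < 0) :
    (0 < v ∧ w - a * v < 0 ∧ 0 < w - b * v) ∨ (v < 0 ∧ 0 < w - a * v ∧ w - b * v < 0) := by
  rcases mul_neg_iff.1 h with ⟨h1, h2⟩ | ⟨h1, h2⟩
  · right
    exact ⟨by nlinarith, h1, h2⟩
  · left
    exact ⟨by nlinarith, h1, h2⟩

/-- The sign of the time component is constant along the curve, so `t`, `x + 2t` and the label are
monotone. This gives at most one crossing, and a curve without any has a limit at the end facing `{t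
= 0}`. -/
lemma isConeCauchy_omegaC : IsConeCauchy OmegaC (fun q => 2 + psi sol q) (fun _ => -2) := by
  rintro I γ hI hIn hmem ⟨γ', hγ', hγ⟩ hext
  have hψ : ∀ s ∈ I, psi sol (γ s) = -Real.arctan (label (γ s)) := fun s hs =>
    psi_sol (omegaC_subset_smoothDomain (hmem hs))
  have hcone : ∀ s ∈ I, (0 < (γ' s).1 ∧
        (γ' s).2 - (2 - Real.arctan (label (γ s))) * (γ' s).1 < 0 ∧
        0 < (γ' s).2 + 2 * (γ' s).1) ∨
      ((γ' s).1 < 0 ∧ 0 < (γ' s).2 - (2 - Real.arctan (label (γ s))) * (γ' s).1 ∧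
        (γ' s).2 + 2 * (γ' s).1 < 0) := fun s hs => by
    have h := (hγ s hs).2
    simp only [hψ s hs] at h
    have := mul_neg_cases (by linarith [speed_pos (label (γ s))]) h
    simpa [sub_neg_eq_add, ← sub_eq_add_neg] using this
  have hTd : ∀ s ∈ I, HasDerivWithinAt (fun s => (γ s).1) (γ' s).1 I s := fun s hs =>
    (ContinuousLinearMap.fst ℝ ℝ ℝ).hasFDerivAt.comp_hasDerivWithinAt s (hγ s hs).1
  have hXd : ∀ s ∈ I, HasDerivWithinAt (fun s => (γ s).2) (γ' s).2 I s := fun s hs =>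
    (ContinuousLinearMap.snd ℝ ℝ ℝ).hasFDerivAt.comp_hasDerivWithinAt s (hγ s hs).1
  have hUd : ∀ s ∈ I, HasDerivWithinAt (fun s => (γ s).2 + 2 * (γ s).1)
      ((γ' s).2 + 2 * (γ' s).1) I s := fun s hs => (hXd s hs).add ((hTd s hs).const_mul 2)
  have hYd : ∀ s ∈ I, HasDerivWithinAt (fun s => label (γ s))
      (1 / (1 - (γ s).1 / (1 + label (γ s) ^ 2)) *
        ((γ' s).2 - (2 - Real.arctan (label (γ s))) * (γ' s).1)) I s := fun s hs => by
    have := (hasFDerivAt_label (omegaC_subset_smoothDomain (hmem hs))).comp_hasDerivWithinAt s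
      (hγ s hs).1
    exact this.congr_deriv (by simp)
  have hk : ∀ s ∈ I, 0 < 1 / (1 - (γ s).1 / (1 + label (γ s) ^ 2)) := fun s hs =>
    one_div_pos.2 (focus_pos (omegaC_subset_smoothDomain (hmem hs)))
  have hne : ∀ s ∈ I, (γ' s).1 ≠ 0 := fun s hs h0 => by
    rcases hcone s hs with h | h
    · exact h.1.ne' h0
    · exact h.1.ne h0
  have hsign := pos_or_neg_of_ne_zero hI (continuous_fst.comp_continuousOn hγ') hne
  have hnonempty : Nonempty I := hIn.nonempty.to_subtype
  have hmem' : ∀ s : I, γ s ∈ OmegaC := fun s => hmem s.2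
  have hinj : InjOn (fun s => (γ s).1) I := by
    rcases hsign with h | h
    · exact (strictMonoOn_of_hasDerivWithinAt hI hTd h).injOn
    · have := (strictMonoOn_of_hasDerivWithinAt hI (fun s hs => (hTd s hs).neg)
        fun s hs => neg_pos.2 (h s hs)).injOn
      exact fun s hs r hr hsr => this hs hr (congrArg Neg.neg hsr)
  suffices hex : ∃ s ∈ I, (γ s).1 = 0 by
    obtain ⟨s, hs, h0⟩ := hex
    exact ⟨s, ⟨hs, h0⟩, fun r hr => hinj hr.1 hs (hr.2.trans h0.symm)⟩
  by_contra! hex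
  have hTsign := pos_or_neg_of_ne_zero hI (fun s hs => (hTd s hs).continuousWithinAt) hex
  apply hext
  rcases hsign with h | h
  · have hc : ∀ s ∈ I, (γ' s).2 - (2 - Real.arctan (label (γ s))) * (γ' s).1 < 0 ∧
        0 < (γ' s).2 + 2 * (γ' s).1 := fun s hs =>
      ((hcone s hs).resolve_right fun h' => lt_asymm h'.1 (h s hs)).2
    have mT : Monotone fun s : I => (γ s).1 := fun s r hsr =>
      monotoneOn_of_hasDerivWithinAt hI hTd (fun s hs => (h s hs).le) s.2 r.2 hsr
    have mU : Monotone fun s : I => (γ s).2 + 2 * (γ s).1 := fun s r hsr =>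
      monotoneOn_of_hasDerivWithinAt hI hUd (fun s hs => (hc s hs).2.le) s.2 r.2 hsr
    have mY : Antitone fun s : I => label (γ s) := fun s r hsr =>
      antitoneOn_of_hasDerivWithinAt hI hYd (fun s hs =>
        (mul_neg_of_pos_of_neg (hk s hs) (hc s hs).1).le) s.2 r.2 hsr
    rcases hTsign with h0 | h0
    · exact Or.inl (exists_limit_past hmem' mT mY mU fun s => h0 s s.2)
    · exact Or.inr (exists_limit_future hmem' mT mY mU fun s => h0 s s.2)
  · have hc : ∀ s ∈ I, 0 < (γ' s).2 - (2 - Real.arctan (label (γ s))) * (γ' s).1 ∧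
        (γ' s).2 + 2 * (γ' s).1 < 0 := fun s hs =>
      ((hcone s hs).resolve_left fun h' => lt_asymm h'.1 (h s hs)).2
    have mT : Antitone fun s : I => (γ s).1 := fun s r hsr =>
      antitoneOn_of_hasDerivWithinAt hI hTd (fun s hs => (h s hs).le) s.2 r.2 hsr
    have mU : Antitone fun s : I => (γ s).2 + 2 * (γ s).1 := fun s r hsr =>
      antitoneOn_of_hasDerivWithinAt hI hUd (fun s hs => (hc s hs).2.le) s.2 r.2 hsr
    have mY : Monotone fun s : I => label (γ s) := fun s r hsr =>
      monotoneOn_of_hasDerivWithinAt hI hYd (fun s hs =>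
        (mul_pos (hk s hs) (hc s hs).1).le) s.2 r.2 hsr
    rcases hTsign with h0 | h0
    -- A past directed parametrization is treated by reversing the order of the parameter.
    · exact Or.inr (exists_limit_past (J := (I : Type)ᵒᵈ) (γ := fun s => γ (OrderDual.ofDual s : I))
        (fun s => hmem' _) mT.dual_left mY.dual_left mU.dual_left fun s => h0 _ (Subtype.prop _))
    · exact Or.inl (exists_limit_future (J := (I : Type)ᵒᵈ)
        (γ := fun s => γ (OrderDual.ofDual s : I)) (fun s => hmem' _) mT.dual_left mY.dual_left
        mU.dual_left fun s => h0 _ (Subtype.prop _))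

lemma isGHD_sol : IsGHD OmegaC sol where
  toIsDevelopment := isDevelopment_sol
  lorentzian q hq := by
    rw [psi_sol (omegaC_subset_smoothDomain hq)]
    exact isLorentzian_acousticMetric (neg_arctan_ne _)
  cauchy := by
    rw [isCauchyHypersurface_iff]
    · exact isConeCauchy_omegaC
    · intro q hq
      rw [psi_sol (omegaC_subset_smoothDomain hq)]
      exact neg_arctan_ne _

/-! ### Maximal integral curves -/

section ODE

variable {E : Type*} [NormedAddCommGroup E] [NormedSpace ℝ E]

/-- `γ` is an integral curve of `v` on `J` with values in `Ω`. -/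
def IsSolOn (v : E → E) (Ω : Set E) (J : Set ℝ) (γ : ℝ → E) : Prop :=
  ∀ s ∈ J, γ s ∈ Ω ∧ HasDerivAt γ (v (γ s)) s

lemma IsSolOn.mono {v : E → E} {Ω : Set E} {J K : Set ℝ} {γ : ℝ → E} (h : IsSolOn v Ω J γ)
    (hK : K ⊆ J) : IsSolOn v Ω K γ := fun s hs => h s (hK hs)

/-- The set where the solutions agree locally is open by definition and relatively closed by
continuity and local uniqueness. -/
lemma IsSolOn.eqOn {v : E → E} {Ω : Set E} (hΩ : IsOpen Ω) (hv : ContDiffOn ℝ 1 v Ω) {a b t₀ : ℝ}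
    {γ₁ γ₂ : ℝ → E} (h₁ : IsSolOn v Ω (Ioo a b) γ₁) (h₂ : IsSolOn v Ω (Ioo a b) γ₂)
    (ht₀ : t₀ ∈ Ioo a b) (h₀ : γ₁ t₀ = γ₂ t₀) : EqOn γ₁ γ₂ (Ioo a b) := by
  have hloc : ∀ s ∈ Ioo a b, γ₁ s = γ₂ s → γ₁ =ᶠ[𝓝 s] γ₂ := by
    intro s hs heq
    obtain ⟨K, V, hV, hK⟩ :=
      (hv.contDiffAt (hΩ.mem_nhds (h₁ s hs).1)).exists_lipschitzOnWith
    have hI : Ioo a b ∈ 𝓝 s := isOpen_Ioo.mem_nhds hs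
    refine ODE_solution_unique_of_eventually (v := fun _ => v) (s := fun _ => V) (K := K)
      (Eventually.of_forall fun _ => hK) ?_ ?_ heq
    · filter_upwards [hI, (h₁ s hs).2.continuousAt hV] with r hr hr' using ⟨(h₁ r hr).2, hr'⟩
    · filter_upwards [hI, (h₂ s hs).2.continuousAt (heq ▸ hV)] with r hr hr'
        using ⟨(h₂ r hr).2, hr'⟩
  have hsub : Ioo a b ⊆ {s | γ₁ =ᶠ[𝓝 s] γ₂} := by
    refine isPreconnected_Ioo.subset_of_closure_inter_subset ?_
      ⟨t₀, ht₀, hloc t₀ ht₀ h₀⟩ ?_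
    · exact isOpen_iff_mem_nhds.2 fun s hs => hs.eventually_nhds
    · rintro s ⟨hs, hsI⟩
      refine hloc s hsI ?_
      have hne : NeBot (𝓝[{s | γ₁ =ᶠ[𝓝 s] γ₂}] s) := mem_closure_iff_nhdsWithin_neBot.1 hs
      have l1 : Tendsto γ₁ (𝓝[{s | γ₁ =ᶠ[𝓝 s] γ₂}] s) (𝓝 (γ₁ s)) :=
        (h₁ s hsI).2.continuousAt.tendsto.mono_left nhdsWithin_le_nhds
      have l2 : Tendsto γ₂ (𝓝[{s | γ₁ =ᶠ[𝓝 s] γ₂}] s) (𝓝 (γ₂ s)) :=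
        (h₂ s hsI).2.continuousAt.tendsto.mono_left nhdsWithin_le_nhds
      refine tendsto_nhds_unique (l1.congr' ?_) l2
      filter_upwards [self_mem_nhdsWithin] with r hr using EventuallyEq.eq_of_nhds hr
  exact fun s hs => (hsub hs).eq_of_nhds

lemma IsSolOn.comp_neg {v : E → E} {Ω : Set E} {a b : ℝ} {γ : ℝ → E}
    (h : IsSolOn v Ω (Ioo a b) γ) :
    IsSolOn (fun q => -v q) Ω (Ioo (-b) (-a)) (fun s => γ (-s)) := fun s hs => by
  obtain ⟨h1, h2⟩ := h (-s) ⟨by linarith [hs.2], by linarith [hs.1]⟩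
  refine ⟨h1, ?_⟩
  have := h2.scomp s (hasDerivAt_neg s)
  simpa [Function.comp_def] using this

variable [CompleteSpace E]

lemma exists_isSolOn {v : E → E} {Ω : Set E} (hΩ : IsOpen Ω) (hv : ContDiffOn ℝ 1 v Ω) {q : E}
    (hq : q ∈ Ω) (T : ℝ) :
    ∃ ε > 0, ∃ γ : ℝ → E, γ T = q ∧ IsSolOn v Ω (Ioo (T - ε) (T + ε)) γ := by
  obtain ⟨γ, h0, ε, hε, h⟩ := (hv.contDiffAt
    (hΩ.mem_nhds hq)).exists_forall_mem_closedBall_exists_eq_forall_mem_Ioo_hasDerivAt₀ T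
  have hc : ContinuousAt γ T := (h T ⟨by linarith, by linarith⟩).continuousAt
  have : γ ⁻¹' Ω ∈ 𝓝 T := hc (by rw [h0]; exact hΩ.mem_nhds hq)
  obtain ⟨r, hr, hr'⟩ := Metric.mem_nhds_iff.1 this
  rw [Real.ball_eq_Ioo] at hr'
  refine ⟨min ε r, lt_min hε hr, γ, h0, fun s hs => ⟨hr' ⟨?_, ?_⟩, h s ⟨?_, ?_⟩⟩⟩
  · linarith [hs.1, min_le_right ε r]
  · linarith [hs.2, min_le_right ε r]
  · linarith [hs.1, min_le_left ε r]
  · linarith [hs.2, min_le_left ε r]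

/-- A solution with a limit in the domain at the upper end of its interval can be continued. -/
lemma IsSolOn.exists_extend_right {v : E → E} {Ω : Set E} (hΩ : IsOpen Ω)
    (hv : ContDiffOn ℝ 1 v Ω) {a T : ℝ} (haT : a < T) {γ : ℝ → E} (h : IsSolOn v Ω (Ioo a T) γ)
    {q : E} (hq : q ∈ Ω) (hlim : Tendsto γ (𝓝[<] T) (𝓝 q)) :
    ∃ ε > 0, ∃ δ : ℝ → E, EqOn δ γ (Ioo a T) ∧ IsSolOn v Ω (Ioo a (T + ε)) δ := by
  obtain ⟨ε, hε, β, hβ0, hβ⟩ := exists_isSolOn hΩ hv hq T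
  let δ : ℝ → E := fun s => if s < T then γ s else β s
  have hlt : ∀ s, s < T → δ s = γ s := fun s hs => if_pos hs
  have hge : ∀ s, T ≤ s → δ s = β s := fun s hs => if_neg (not_lt.2 hs)
  have hT : δ T = q := by rw [hge T le_rfl, hβ0]
  refine ⟨ε, hε, δ, fun s hs => hlt s hs.2, fun s hs => ?_⟩
  rcases lt_trichotomy s T with hsT | rfl | hsT
  · rw [hlt s hsT]
    obtain ⟨h1, h2⟩ := h s ⟨hs.1, hsT⟩
    refine ⟨h1, h2.congr_of_eventuallyEq ?_⟩
    filter_upwards [Iio_mem_nhds hsT] with r hr using hlt r hr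
  · rw [hT]
    refine ⟨hq, ?_⟩
    have hI : Ioo a s ∈ 𝓝[<] s := Ioo_mem_nhdsLT haT
    have heq : ∀ r ∈ Ioo a s, δ =ᶠ[𝓝 r] γ := fun r hr => by
      filter_upwards [Iio_mem_nhds hr.2] with x hx using hlt x hx
    have hd : ∀ r ∈ Ioo a s, HasDerivAt δ (v (γ r)) r := fun r hr =>
      (h r hr).2.congr_of_eventuallyEq (heq r hr)
    -- At the junction the one-sided derivative exists because the derivative `v (γ r)` converges as
    -- `r` approaches it.
    have left : HasDerivWithinAt δ (v q) (Iic s) s := by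
      refine hasDerivWithinAt_Iic_of_tendsto_deriv (s := Ioo a s)
        (fun r hr => (hd r hr).differentiableAt.differentiableWithinAt) ?_ hI ?_
      · rw [ContinuousWithinAt, hT]
        refine (hlim.mono_left (nhdsWithin_mono s Ioo_subset_Iio_self)).congr' ?_
        filter_upwards [self_mem_nhdsWithin] with r hr using (hlt r hr.2).symm
      · have hvq : Tendsto (fun r => v (γ r)) (𝓝[<] s) (𝓝 (v q)) :=
          ((hv.continuousOn.continuousAt (hΩ.mem_nhds hq)).tendsto).comp hlim
        refine hvq.congr' ?_
        filter_upwards [hI] with r hr using (hd r hr).deriv.symm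
    have right : HasDerivWithinAt δ (v q) (Ici s) s := by
      have := (hβ s ⟨by linarith, by linarith⟩).2
      rw [hβ0] at this
      exact this.hasDerivWithinAt.congr (fun r hr => hge r hr) (hge s le_rfl)
    have := left.union right
    rwa [Iic_union_Ici, hasDerivWithinAt_univ] at this
  · rw [hge s hsT.le]
    obtain ⟨h1, h2⟩ := hβ s ⟨by linarith, hs.2⟩
    refine ⟨h1, h2.congr_of_eventuallyEq ?_⟩
    filter_upwards [Ioi_mem_nhds hsT] with r hr using hge r (le_of_lt hr)

lemma IsSolOn.exists_extend_left {v : E → E} {Ω : Set E} (hΩ : IsOpen Ω)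
    (hv : ContDiffOn ℝ 1 v Ω) {b T : ℝ} (hbT : T < b) {γ : ℝ → E} (h : IsSolOn v Ω (Ioo T b) γ)
    {q : E} (hq : q ∈ Ω) (hlim : Tendsto γ (𝓝[>] T) (𝓝 q)) :
    ∃ ε > 0, ∃ δ : ℝ → E, EqOn δ γ (Ioo T b) ∧ IsSolOn v Ω (Ioo (T - ε) b) δ := by
  have hlim' : Tendsto (fun s => γ (-s)) (𝓝[<] (-T)) (𝓝 q) := by
    refine hlim.comp ?_
    have := tendsto_neg_nhdsLT (a := -T)
    rwa [neg_neg] at this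
  obtain ⟨ε, hε, δ, h1, h2⟩ := h.comp_neg.exists_extend_right hΩ hv.neg (by linarith) hq hlim'
  refine ⟨ε, hε, fun s => δ (-s), fun s hs => ?_, ?_⟩
  · simpa using h1 (show -s ∈ Ioo (-b) (-T) from ⟨by linarith [hs.2], by linarith [hs.1]⟩)
  · have h3 := h2.comp_neg
    simp only [neg_neg, neg_add_rev] at h3
    rwa [show -ε + T = T - ε by ring] at h3

/-- Maximal integral curves exist, and have no limit in the domain at the ends of their interval of
definition. -/
lemma exists_maximal_isSolOn {v : E → E} {Ω : Set E} (hΩ : IsOpen Ω) (hv : ContDiffOn ℝ 1 v Ω)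
    {p : E} (hp : p ∈ Ω) (t₀ : ℝ) :
    ∃ (J : Set ℝ) (γ : ℝ → E), IsOpen J ∧ J.OrdConnected ∧ t₀ ∈ J ∧ γ t₀ = p ∧ IsSolOn v Ω J γ ∧
      (∀ T, ∀ q ∈ Ω, (∃ a < T, Ioo a T ⊆ J) → Tendsto γ (𝓝[<] T) (𝓝 q) → T ∈ J) ∧
      (∀ T, ∀ q ∈ Ω, (∃ b > T, Ioo T b ⊆ J) → Tendsto γ (𝓝[>] T) (𝓝 q) → T ∈ J) := by
  -- `J` is the union of the intervals of all solutions through `p`. By uniqueness the value at `s`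
  -- does not depend on the solution chosen for `s`, so `Δ s s` is a solution.
  let P : ℝ × ℝ → (ℝ → E) → Prop := fun w δ =>
    t₀ ∈ Ioo w.1 w.2 ∧ δ t₀ = p ∧ IsSolOn v Ω (Ioo w.1 w.2) δ
  let J : Set ℝ := {s | ∃ w δ, s ∈ Ioo w.1 w.2 ∧ P w δ}
  choose! W Δ hW hP using fun s (hs : s ∈ J) => hs
  have huniq : ∀ w δ s, s ∈ Ioo w.1 w.2 → P w δ → Δ s s = δ s := by
    intro w δ s hs hw
    have hsJ : s ∈ J := ⟨w, δ, hs, hw⟩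
    obtain ⟨h1, h2, h3⟩ := hP s hsJ
    obtain ⟨h4, h5, h6⟩ := hw
    have hI := Ioo_inter_Ioo (a₁ := (W s).1) (b₁ := (W s).2) (a₂ := w.1) (b₂ := w.2)
    have e := IsSolOn.eqOn hΩ hv (a := max (W s).1 w.1) (b := min (W s).2 w.2) (t₀ := t₀)
      (h3.mono (by rw [← hI]; exact inter_subset_left))
      (h6.mono (by rw [← hI]; exact inter_subset_right))
      (by rw [← hI]; exact ⟨h1, h4⟩) (h2.trans h5.symm)
    exact e (by rw [← hI]; exact ⟨hW s hsJ, hs⟩)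
  let γ : ℝ → E := fun s => Δ s s
  have hsub : ∀ w δ, P w δ → Ioo w.1 w.2 ⊆ J := fun w δ hw s hs => ⟨w, δ, hs, hw⟩
  have hopen : IsOpen J := isOpen_iff_mem_nhds.2 fun s hs =>
    mem_of_superset (isOpen_Ioo.mem_nhds (hW s hs)) (hsub _ _ (hP s hs))
  have ht₀J : t₀ ∈ J := by
    obtain ⟨ε, hε, δ, h0, h⟩ := exists_isSolOn hΩ hv hp t₀
    have : t₀ ∈ Ioo (t₀ - ε) (t₀ + ε) := ⟨by linarith, by linarith⟩
    exact ⟨(t₀ - ε, t₀ + ε), δ, this, this, h0, h⟩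
  have hord : J.OrdConnected := by
    have hc : ∀ s ∈ J, uIcc t₀ s ⊆ J := fun s hs =>
      (ordConnected_Ioo.uIcc_subset (hP s hs).1 (hW s hs)).trans (hsub _ _ (hP s hs))
    refine ⟨fun x hx y hy z hz => ?_⟩
    rcases le_total z t₀ with h | h
    · exact hc x hx (by rw [mem_uIcc]; exact Or.inr ⟨hz.1, h⟩)
    · exact hc y hy (by rw [mem_uIcc]; exact Or.inl ⟨h, hz.2⟩)
  have hsol : IsSolOn v Ω J γ := fun s hs => by
    obtain ⟨h1, h2⟩ := (hP s hs).2.2 s (hW s hs)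
    refine ⟨h1, h2.congr_of_eventuallyEq ?_⟩
    filter_upwards [isOpen_Ioo.mem_nhds (hW s hs)] with r hr using huniq _ _ r hr (hP s hs)
  have hγ₀ : γ t₀ = p := (hP t₀ ht₀J).2.1
  obtain ⟨r, hr, hrJ⟩ := Metric.isOpen_iff.1 hopen t₀ ht₀J
  rw [Real.ball_eq_Ioo] at hrJ
  refine ⟨J, γ, hopen, hord, ht₀J, hγ₀, hsol, ?_, ?_⟩
  · rintro T q hq ⟨a, haT, haJ⟩ hlim
    have hm : (a + T) / 2 ∈ J := haJ ⟨by linarith, by linarith⟩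
    rcases le_or_gt T t₀ with hT | hT
    · exact hord.out hm ht₀J ⟨by linarith, hT⟩
    -- The continuation must live on an interval around `t₀` to belong to the family that defines
    -- `J`.
    have hIJ : Ioo (t₀ - r) T ⊆ J := fun x hx => by
      rcases lt_or_ge x (t₀ + r) with h | h
      · exact hrJ ⟨hx.1, h⟩
      · refine hord.out ht₀J (haJ (a := max x ((a + T) / 2)) ⟨?_, ?_⟩)
          ⟨by linarith, le_max_left _ _⟩
        · exact lt_max_of_lt_right (by linarith)
        · exact max_lt hx.2 (by linarith)
    obtain ⟨ε, hε, δ, h1, h2⟩ := (hsol.mono hIJ).exists_extend_right hΩ hv (by linarith) hq hlim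
    have ht : t₀ ∈ Ioo (t₀ - r) T := ⟨by linarith, hT⟩
    exact ⟨(t₀ - r, T + ε), δ, ⟨by simp only; linarith, by simp only; linarith⟩,
      ⟨ht.1, by simp only; linarith⟩, (h1 ht).trans hγ₀, h2⟩
  · rintro T q hq ⟨b, hbT, hbJ⟩ hlim
    have hm : (b + T) / 2 ∈ J := hbJ ⟨by linarith, by linarith⟩
    rcases le_or_gt t₀ T with hT | hT
    · exact hord.out ht₀J hm ⟨hT, by linarith⟩
    have hIJ : Ioo T (t₀ + r) ⊆ J := fun x hx => by
      rcases lt_or_ge (t₀ - r) x with h | h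
      · exact hrJ ⟨h, hx.2⟩
      · refine hord.out (hbJ (a := min x ((b + T) / 2)) ⟨?_, ?_⟩) ht₀J
          ⟨min_le_left _ _, by linarith⟩
        · exact lt_min hx.1 (by linarith)
        · exact min_lt_of_right_lt (by linarith)
    obtain ⟨ε, hε, δ, h1, h2⟩ := (hsol.mono hIJ).exists_extend_left hΩ hv (by linarith) hq hlim
    have ht : t₀ ∈ Ioo T (t₀ + r) := ⟨hT, by linarith⟩
    exact ⟨(T - ε, t₀ + r), δ, ⟨by simp only; linarith, by simp only; linarith⟩,
      ⟨by simp only; linarith, ht.2⟩, (h1 ht).trans hγ₀, h2⟩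

end ODE

/-! ### Inextendible curves parametrized by time -/

lemma eq_of_tendsto_time {J : Set ℝ} {γ : ℝ → ℝ × ℝ} (hγ : ∀ s ∈ J, (γ s).1 = s) {q : ℝ × ℝ}
    {l : Filter J} (hlim : Tendsto (fun s : J => γ s) l (𝓝 q)) :
    Tendsto (fun s : J => (s : ℝ)) l (𝓝 q.1) := by
  refine ((continuous_fst.tendsto q).comp hlim).congr fun s => hγ s s.2

/-- If the graph `γ` over `J` tends to `q` towards the upper end of `J`, where `J` has no maximum,
then `J` ends at the time of `q`. -/
lemma limit_atTop_time {J : Set ℝ} (hne : J.Nonempty) (hord : J.OrdConnected)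
    (hmax : ∀ s ∈ J, ∃ r ∈ J, s < r) {γ : ℝ → ℝ × ℝ} (hγ : ∀ s ∈ J, (γ s).1 = s) {q : ℝ × ℝ}
    (hlim : Tendsto (fun s : J => γ s) atTop (𝓝 q)) :
    q.1 ∉ J ∧ (∃ a < q.1, Ioo a q.1 ⊆ J) ∧ Tendsto γ (𝓝[<] q.1) (𝓝 q) := by
  have hJ : Nonempty J := hne.to_subtype
  have ht := eq_of_tendsto_time hγ hlim
  have hle : ∀ s ∈ J, s ≤ q.1 := fun s hs =>
    ge_of_tendsto ht ((eventually_ge_atTop (⟨s, hs⟩ : J)).mono fun r hr => hr)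
  have hlt : ∀ s ∈ J, s < q.1 := fun s hs => by
    obtain ⟨r, hr, hsr⟩ := hmax s hs
    exact hsr.trans_le (hle r hr)
  have hsub : ∀ s ∈ J, Ioo s q.1 ⊆ J := fun s hs x hx => by
    obtain ⟨r, hr⟩ := (ht.eventually (lt_mem_nhds hx.2)).exists
    exact hord.out hs r.2 ⟨hx.1.le, le_of_lt hr⟩
  obtain ⟨s₀, hs₀⟩ := hne
  refine ⟨fun h => lt_irrefl _ (hlt _ h), ⟨s₀, hlt s₀ hs₀, hsub s₀ hs₀⟩, ?_⟩
  have hmap := map_coe_atTop_of_Ioo_subset (s := J) (b := q.1) (fun s hs => hlt s hs)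
    (fun a' ha' => by exact ⟨s₀, hlt s₀ hs₀, hsub s₀ hs₀⟩)
  rw [← hmap, tendsto_map'_iff]
  exact hlim

lemma limit_atBot_time {J : Set ℝ} (hne : J.Nonempty) (hord : J.OrdConnected)
    (hmin : ∀ s ∈ J, ∃ r ∈ J, r < s) {γ : ℝ → ℝ × ℝ} (hγ : ∀ s ∈ J, (γ s).1 = s) {q : ℝ × ℝ}
    (hlim : Tendsto (fun s : J => γ s) atBot (𝓝 q)) :
    q.1 ∉ J ∧ (∃ b > q.1, Ioo q.1 b ⊆ J) ∧ Tendsto γ (𝓝[>] q.1) (𝓝 q) := by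
  have hJ : Nonempty J := hne.to_subtype
  have ht := eq_of_tendsto_time hγ hlim
  have hle : ∀ s ∈ J, q.1 ≤ s := fun s hs =>
    le_of_tendsto ht ((eventually_le_atBot (⟨s, hs⟩ : J)).mono fun r hr => hr)
  have hlt : ∀ s ∈ J, q.1 < s := fun s hs => by
    obtain ⟨r, hr, hsr⟩ := hmin s hs
    exact (hle r hr).trans_lt hsr
  have hsub : ∀ s ∈ J, Ioo q.1 s ⊆ J := fun s hs x hx => by
    obtain ⟨r, hr⟩ := (ht.eventually (gt_mem_nhds hx.1)).exists
    exact hord.out r.2 hs ⟨le_of_lt hr, hx.2.le⟩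
  obtain ⟨s₀, hs₀⟩ := hne
  refine ⟨fun h => lt_irrefl _ (hlt _ h), ⟨s₀, hlt s₀ hs₀, hsub s₀ hs₀⟩, ?_⟩
  have hmap := map_coe_atBot_of_Ioo_subset (s := J) (a := q.1) (fun s hs => hlt s hs)
    (fun a' ha' => by exact ⟨s₀, hlt s₀ hs₀, hsub s₀ hs₀⟩)
  rw [← hmap, tendsto_map'_iff]
  exact hlim

lemma exists_gt_of_isOpen {J : Set ℝ} (hJ : IsOpen J) : ∀ s ∈ J, ∃ r ∈ J, s < r := fun s hs => by
  obtain ⟨r, hr, h⟩ := Metric.isOpen_iff.1 hJ s hs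
  refine ⟨s + r / 2, h ?_, by linarith⟩
  rw [Real.ball_eq_Ioo]
  constructor <;> linarith

lemma exists_lt_of_isOpen {J : Set ℝ} (hJ : IsOpen J) : ∀ s ∈ J, ∃ r ∈ J, r < s := fun s hs => by
  obtain ⟨r, hr, h⟩ := Metric.isOpen_iff.1 hJ s hs
  refine ⟨s - r / 2, h ?_, by linarith⟩
  rw [Real.ball_eq_Ioo]
  constructor <;> linarith

/-- Solutions for a field with unit time component are parametrized by time. -/
lemma IsSolOn.fst_eq {w : ℝ × ℝ → ℝ} {Ω : Set (ℝ × ℝ)} {J : Set ℝ} (hord : J.OrdConnected)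
    {γ : ℝ → ℝ × ℝ} (h : IsSolOn (fun q => (1, w q)) Ω J γ) {t₀ : ℝ} (ht₀ : t₀ ∈ J)
    (h₀ : (γ t₀).1 = t₀) : ∀ s ∈ J, (γ s).1 = s := by
  have hd : ∀ s ∈ J, HasDerivWithinAt (fun s => (γ s).1 - s) 0 J s := fun s hs => by
    have h1 := (ContinuousLinearMap.fst ℝ ℝ ℝ).hasFDerivAt.comp_hasDerivAt s (h s hs).2
    exact (h1.sub (hasDerivAt_id s)).hasDerivWithinAt.congr_deriv (by simp)
  have m1 := monotoneOn_of_hasDerivWithinAt hord hd fun _ _ => le_rfl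
  have m2 := antitoneOn_of_hasDerivWithinAt hord hd fun _ _ => le_rfl
  intro s hs
  rcases le_total s t₀ with h | h
  · have e1 := m1 hs ht₀ h
    have e2 := m2 hs ht₀ h
    simp only [h₀] at e1 e2
    linarith
  · have e1 := m1 ht₀ hs h
    have e2 := m2 ht₀ hs h
    simp only [h₀] at e1 e2
    linarith

/-! ### Timelike curves approaching a null segment -/

section Approach

variable {Ω : Set (ℝ × ℝ)} {α β : ℝ × ℝ → ℝ} {x₀ l : ℝ}

/-- The gap to the left of the null line `x = x₀ + l t` at time `t` in which the slopes are
controlled at scale `ε`. -/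
def IsControlled (Ω : Set (ℝ × ℝ)) (α β : ℝ × ℝ → ℝ) (x₀ l t ε : ℝ) : Prop :=
  ∀ δ, 0 ≤ δ → δ ≤ ε → (t, x₀ + l * t - δ) ∈ Ω ∧ l - δ / ε ≤ β (t, x₀ + l * t - δ) ∧
    α (t, x₀ + l * t - δ) < l - ε

lemma IsControlled.mono {t ε ε' : ℝ} (h : IsControlled Ω α β x₀ l t ε) (hε' : 0 < ε')
    (hle : ε' ≤ ε) : IsControlled Ω α β x₀ l t ε' := fun δ h0 h1 => by
  obtain ⟨h2, h3, h4⟩ := h δ h0 (h1.trans hle)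
  have : δ / ε ≤ δ / ε' := div_le_div_of_nonneg_left h0 hε' hle
  exact ⟨h2, by linarith, by linarith⟩

/-- `β` equals `l` on the line and is locally Lipschitz, so it loses at most a multiple of `δ` at
distance `δ`; `α` stays a definite amount below `l` by continuity. -/
lemma exists_isControlled_nhds (hΩ : IsOpen Ω) (hα : ContinuousOn α Ω) (hβ : ContDiffOn ℝ 1 β Ω)
    (hαβ : ∀ q ∈ Ω, α q < β q) {I : Set ℝ}
    (hN : ∀ t ∈ I, (t, x₀ + l * t) ∈ Ω ∧ β (t, x₀ + l * t) = l) {t : ℝ} (ht : t ∈ I) :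
    ∃ ε > 0, ε ≤ 1 ∧ ∀ᶠ s in 𝓝 t, s ∈ I → IsControlled Ω α β x₀ l s ε := by
  obtain ⟨h1, h2⟩ := hN t ht
  obtain ⟨K, V, hV, hK⟩ := (hβ.contDiffAt (hΩ.mem_nhds h1)).exists_lipschitzOnWith
  have hg : 0 < l - α (t, x₀ + l * t) := by
    have := hαβ _ h1
    linarith
  set g := (l - α (t, x₀ + l * t)) / 2 with hgdef
  have hg0 : 0 < g := by positivity
  have hα' : ∀ᶠ q in 𝓝 (t, x₀ + l * t), α q < l - g :=
    (hα.continuousAt (hΩ.mem_nhds h1)).eventually (gt_mem_nhds (by linarith))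
  obtain ⟨r, hr, hr'⟩ := Metric.mem_nhds_iff.1 (inter_mem (inter_mem hV (hΩ.mem_nhds h1)) hα')
  have hs1 : ∀ᶠ s in 𝓝 t, |s - t| < r := by
    have := Metric.ball_mem_nhds t hr
    filter_upwards [this] with s hs
    rwa [← Real.dist_eq]
  have hs2 : ∀ᶠ s in 𝓝 t, |l * (s - t)| < r / 2 := by
    have hc : Continuous fun s => |l * (s - t)| := by fun_prop
    exact hc.continuousAt.eventually (gt_mem_nhds (by simpa using hr))
  have hK0 : (0 : ℝ) < K + 1 := by positivity
  refine ⟨min (min 1 (r / 4)) (min g (1 / (K + 1))), by positivity,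
    (min_le_left _ _).trans (min_le_left _ _), ?_⟩
  set ε := min (min 1 (r / 4)) (min g (1 / (K + 1))) with hε
  have hε0 : 0 < ε := by positivity
  have e2 : ε ≤ r / 4 := (min_le_left _ _).trans (min_le_right _ _)
  have e3 : ε ≤ g := (min_le_right _ _).trans (min_le_left _ _)
  have e4 : ε ≤ 1 / (K + 1) := (min_le_right _ _).trans (min_le_right _ _)
  filter_upwards [hs1, hs2] with s h3 h4 hs δ hδ0 hδ
  have hball : ∀ δ', 0 ≤ δ' → δ' ≤ ε → (s, x₀ + l * s - δ') ∈ Metric.ball (t, x₀ + l * t) r := by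
    intro δ' h0 h5
    rw [Metric.mem_ball, Prod.dist_eq, max_lt_iff, Real.dist_eq, Real.dist_eq]
    refine ⟨h3, ?_⟩
    rw [abs_lt] at h4 ⊢
    constructor <;> simp only <;> linarith [h4.1, h4.2]
  obtain ⟨⟨h5, h6⟩, h7⟩ := hr' (hball δ hδ0 hδ)
  obtain ⟨⟨h8, -⟩, -⟩ := hr' (hball 0 le_rfl hε0.le)
  refine ⟨h6, ?_, by have : α (s, x₀ + l * s - δ) < l - g := h7; linarith⟩
  have h9 := hK.dist_le_mul _ h5 _ h8
  rw [sub_zero, (hN s hs).2, Prod.dist_eq, dist_self, Real.dist_eq, Real.dist_eq] at h9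
  have h10 : |x₀ + l * s - δ - (x₀ + l * s)| = δ := by
    rw [sub_sub_cancel_left, abs_neg, abs_of_nonneg hδ0]
  simp only [h10] at h9
  rw [max_eq_right hδ0] at h9
  have h11 : K * δ ≤ δ / ε := by
    rw [le_div_iff₀ hε0]
    have h12 : (K + 1) * ε ≤ 1 := by
      rw [le_div_iff₀ hK0] at e4; linarith
    have : 0 ≤ (K : ℝ) := K.coe_nonneg
    nlinarith
  linarith [(abs_le.1 h9).1]

lemma exists_isControlled_Icc (hΩ : IsOpen Ω) (hα : ContinuousOn α Ω) (hβ : ContDiffOn ℝ 1 β Ω)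
    (hαβ : ∀ q ∈ Ω, α q < β q) {t b : ℝ}
    (hN : ∀ s ∈ Icc t b, (s, x₀ + l * s) ∈ Ω ∧ β (s, x₀ + l * s) = l) :
    ∃ ε > 0, ε ≤ 1 ∧ ∀ s ∈ Icc t b, IsControlled Ω α β x₀ l s ε := by
  suffices h : ∃ ε > 0, ε ≤ 1 ∧ ∀ s ∈ Icc t b, s ∈ Icc t b → IsControlled Ω α β x₀ l s ε by
    obtain ⟨ε, h1, h2, h3⟩ := h
    exact ⟨ε, h1, h2, fun s hs => h3 s hs hs⟩
  refine isCompact_Icc.induction_on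
    (p := fun A => ∃ ε > 0, ε ≤ 1 ∧ ∀ s ∈ A, s ∈ Icc t b → IsControlled Ω α β x₀ l s ε)
    ⟨1, one_pos, le_rfl, fun s hs => absurd hs (notMem_empty s)⟩ ?_ ?_ ?_
  · rintro A B hAB ⟨ε, h1, h2, h3⟩
    exact ⟨ε, h1, h2, fun s hs => h3 s (hAB hs)⟩
  · rintro A B ⟨ε, h1, h2, h3⟩ ⟨ε', h1', h2', h3'⟩
    refine ⟨min ε ε', lt_min h1 h1', (min_le_left _ _).trans h2, fun s hs hs' => ?_⟩
    rcases hs with hs | hs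
    · exact (h3 s hs hs').mono (lt_min h1 h1') (min_le_left _ _)
    · exact (h3' s hs hs').mono (lt_min h1 h1') (min_le_right _ _)
  · intro s hs
    obtain ⟨ε, h1, h2, h3⟩ := exists_isControlled_nhds hΩ hα hβ hαβ hN hs
    exact ⟨_, mem_nhdsWithin_of_mem_nhds h3, ε, h1, h2, fun r hr => hr⟩

/-- A continuous, increasing scale of control along a half open null segment. -/
lemma exists_control_function (hΩ : IsOpen Ω) (hα : ContinuousOn α Ω) (hβ : ContDiffOn ℝ 1 β Ω)
    (hαβ : ∀ q ∈ Ω, α q < β q) {a b : ℝ} (hab : a < b)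
    (hN : ∀ t ∈ Ioc a b, (t, x₀ + l * t) ∈ Ω ∧ β (t, x₀ + l * t) = l) :
    ∃ η : ℝ → ℝ, Continuous η ∧ (∀ t, a < t → 0 < η t) ∧ (∀ s t, a ≤ s → s ≤ t → η s ≤ η t) ∧
      ∀ t ∈ Ioc a b, η t ≤ 1 ∧ IsControlled Ω α β x₀ l t (η t) := by
  -- Scales valid on the whole of `[t, b]`, so that their supremum is monotone in `t`. The scale 0
  -- is admitted by hand to keep the set nonempty.
  let S : ℝ → Set ℝ := fun t =>
    {ε | ε ∈ Icc 0 1 ∧ (ε = 0 ∨ ∀ s ∈ Icc t b, IsControlled Ω α β x₀ l s ε)}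
  have hne : ∀ t, (S t).Nonempty := fun t => ⟨0, ⟨le_rfl, zero_le_one⟩, Or.inl rfl⟩
  have hbdd : ∀ t, BddAbove (S t) := fun t => ⟨1, fun ε h => h.1.2⟩
  let ε₀ : ℝ → ℝ := fun t => sSup (S t)
  have hmono : Monotone ε₀ := fun t t' htt' => csSup_le_csSup (hbdd t') (hne t)
    fun ε h => ⟨h.1, h.2.imp_right fun h' s hs => h' s ⟨htt'.trans hs.1, hs.2⟩⟩
  have hle1 : ∀ t, ε₀ t ≤ 1 := fun t => csSup_le (hne t) fun ε h => h.1.2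
  have hge0 : ∀ t, 0 ≤ ε₀ t := fun t => le_csSup (hbdd t) ⟨⟨le_rfl, zero_le_one⟩, Or.inl rfl⟩
  have hpos : ∀ t, a < t → 0 < ε₀ t := by
    have h1 : ∀ t ∈ Ioc a b, 0 < ε₀ t := fun t ht => by
      obtain ⟨ε, h1, h2, h3⟩ := exists_isControlled_Icc hΩ hα hβ hαβ (t := t) (b := b)
        fun s hs => hN s ⟨ht.1.trans_le hs.1, hs.2⟩
      exact h1.trans_le (le_csSup (hbdd t) ⟨⟨h1.le, h2⟩, Or.inr h3⟩)
    intro t ht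
    rcases le_total t b with h | h
    · exact h1 t ⟨ht, h⟩
    · exact (h1 b ⟨hab, le_rfl⟩).trans_le (hmono h)
  have hctrl : ∀ t ∈ Ioc a b, ∀ η, 0 < η → η < ε₀ t → IsControlled Ω α β x₀ l t η := by
    intro t ht η h0 h1
    obtain ⟨ε, ⟨-, h2⟩, h3⟩ := exists_lt_of_lt_csSup (hne t) h1
    rcases h2 with h2 | h2
    · linarith
    · exact (h2 t ⟨le_rfl, ht.2⟩).mono h0 h3.le
  have hint : ∀ s t, IntervalIntegrable ε₀ MeasureTheory.volume s t := fun s t =>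
    hmono.intervalIntegrable
  have hc : 0 < 1 / (2 * (b - a)) := by
    have : 0 < b - a := by linarith
    positivity
  have hlow : ∀ t, a < t → 0 < ∫ s in a..t, ε₀ s := fun t ht =>
    intervalIntegral.intervalIntegral_pos_of_pos_on (hint a t) (fun s hs => hpos s hs.1) ht
  -- The supremum may jump; its primitive is continuous and increasing. This normalization keeps it
  -- at most `ε₀ t / 2`, strictly below the supremum and hence a valid scale.
  refine ⟨fun t => 1 / (2 * (b - a)) * ∫ s in a..t, ε₀ s, ?_, ?_, ?_, ?_⟩
  · exact continuous_const.mul (intervalIntegral.continuous_primitive hint a)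
  · exact fun t ht => mul_pos hc (hlow t ht)
  · intro s t _ hst
    refine mul_le_mul_of_nonneg_left ?_ hc.le
    rw [← intervalIntegral.integral_add_adjacent_intervals (hint a s) (hint s t)]
    linarith [intervalIntegral.integral_nonneg (μ := MeasureTheory.volume) hst fun u _ => hge0 u]
  · intro t ht
    have hup : ∫ s in a..t, ε₀ s ≤ (t - a) * ε₀ t := by
      have h1 := intervalIntegral.integral_mono_on ht.1.le (hint a t)
        (intervalIntegrable_const (c := ε₀ t)) fun s hs => hmono hs.2
      simpa using h1
    have h2 : 1 / (2 * (b - a)) * ∫ s in a..t, ε₀ s ≤ ε₀ t / 2 := by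
      have hba : 0 < b - a := by linarith
      calc 1 / (2 * (b - a)) * ∫ s in a..t, ε₀ s
          ≤ 1 / (2 * (b - a)) * ((b - a) * ε₀ t) := by
            refine mul_le_mul_of_nonneg_left (hup.trans ?_) hc.le
            exact mul_le_mul_of_nonneg_right (by linarith [ht.2]) (hge0 t)
        _ = ε₀ t / 2 := by field_simp
    refine ⟨by linarith [hle1 t, hge0 t], hctrl t ht _ (mul_pos hc (hlow t ht.1)) ?_⟩
    linarith [hpos t ht.1]

/-- A half open null segment is approached, from the side of its timelike future, by a timelike
curve with the same past end point. -/
lemma exists_timelike_approach (hΩ : IsOpen Ω) (hα : ContinuousOn α Ω) (hβ : ContDiffOn ℝ 1 β Ω)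
    (hαβ : ∀ q ∈ Ω, α q < β q) {a b : ℝ} (hab : a < b)
    (hN : ∀ t ∈ Ioc a b, (t, x₀ + l * t) ∈ Ω ∧ β (t, x₀ + l * t) = l) :
    ∃ x x' : ℝ → ℝ, ContinuousOn x' (Ioc a b) ∧ Tendsto x (𝓝[>] a) (𝓝 (x₀ + l * a)) ∧
      ∀ t ∈ Ioc a b, HasDerivAt x (x' t) t ∧ (t, x t) ∈ Ω ∧ α (t, x t) < x' t ∧
        x' t < β (t, x t) := by
  obtain ⟨η, hη, hη0, hηm, hηc⟩ := exists_control_function hΩ hα hβ hαβ hab hN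
  have hba : 0 < b - a := by linarith
  set c := 1 / (2 * (1 + (b - a))) with hc
  have hc0 : 0 < c := by positivity
  set h : ℝ → ℝ := fun t => c * ∫ s in a..t, η s ^ 2 with hh
  have hηsq : Continuous fun s => η s ^ 2 := hη.pow 2
  have hd : ∀ t, HasDerivAt h (c * η t ^ 2) t := fun t =>
    (hηsq.integral_hasStrictDerivAt a t).hasDerivAt.const_mul c
  have hinv : ContinuousOn (fun s => 1 / η s) (Ioi a) :=
    continuousOn_const.div hη.continuousOn fun s hs => (hη0 s hs).ne'
  have hinvint : ∀ s t, a < s → a < t →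
      IntervalIntegrable (fun s => 1 / η s) MeasureTheory.volume s t := fun s t hs ht =>
    (hinv.mono fun u hu => (lt_min hs ht).trans_le hu.1).intervalIntegrable
  set G : ℝ → ℝ := fun t => ∫ s in b..t, 1 / η s with hG
  have hGd : ∀ t, a < t → HasDerivAt G (1 / η t) t := fun t ht =>
    intervalIntegral.integral_hasDerivAt_right (hinvint b t hab ht)
      (hinv.stronglyMeasurableAtFilter isOpen_Ioi t ht) (hinv.continuousAt (Ioi_mem_nhds ht))
  have hG0 : ∀ t ∈ Ioc a b, G t ≤ 0 := fun t ht => by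
    rw [hG]
    simp only
    rw [intervalIntegral.integral_symm, neg_nonpos]
    exact intervalIntegral.integral_nonneg ht.2 fun u hu =>
      (one_div_pos.2 (hη0 u (ht.1.trans_le hu.1))).le
  have hhpos : ∀ t, a < t → 0 < h t := fun t ht => mul_pos hc0
    (intervalIntegral.intervalIntegral_pos_of_pos_on (hηsq.intervalIntegrable _ _)
      (fun s hs => pow_pos (hη0 s hs.1) 2) ht)
  have hhle : ∀ t ∈ Ioc a b, h t ≤ c * ((b - a) * η t ^ 2) := fun t ht => by
    refine mul_le_mul_of_nonneg_left ?_ hc0.le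
    have hη0' : ∀ s, a ≤ s → 0 ≤ η s := fun s hs => by
      have hcl : s ∈ closure (Ioi a) := by rw [closure_Ioi]; exact hs
      exact closure_minimal (fun u hu => (hη0 u hu).le) (isClosed_le continuous_const hη) hcl
    have h1 := intervalIntegral.integral_mono_on ht.1.le (hηsq.intervalIntegrable a t)
      (intervalIntegrable_const (μ := MeasureTheory.volume) (c := η t ^ 2)) fun s hs =>
        pow_le_pow_left₀ (hη0' s hs.1) (hηm s t hs.1 hs.2) 2
    simp only [intervalIntegral.integral_const, smul_eq_mul] at h1
    refine h1.trans (mul_le_mul_of_nonneg_right ?_ (sq_nonneg _))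
    linarith [ht.2]
  -- The gap `δ = h exp G` satisfies `δ' = h' exp G + δ / η > δ / η`, so the slope `l - δ'` is below
  -- `l - δ / η ≤ β`. By the choice of `c` also `δ' ≤ η / 2`, which keeps the slope above `l - η >
  -- α`. Since `exp G ≤ 1` and `h` vanishes at `a`, the curve ends at the end point of the null
  -- segment.
  refine ⟨fun t => x₀ + l * t - h t * Real.exp (G t),
    fun t => l - (c * η t ^ 2 * Real.exp (G t) + h t * (Real.exp (G t) * (1 / η t))), ?_, ?_, ?_⟩
  · have hGc : ContinuousOn G (Ioc a b) := fun t ht =>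
      (hGd t ht.1).continuousAt.continuousWithinAt
    have hhc : ContinuousOn h (Ioc a b) := fun t _ => (hd t).continuousAt.continuousWithinAt
    have hE : ContinuousOn (fun t => Real.exp (G t)) (Ioc a b) :=
      Real.continuous_exp.comp_continuousOn hGc
    exact continuousOn_const.sub (((continuousOn_const.mul hηsq.continuousOn).mul hE).add
      (hhc.mul (hE.mul (hinv.mono fun t ht => ht.1))))
  · have h0 : Tendsto h (𝓝[>] a) (𝓝 0) := by
      have := (hd a).continuousAt.tendsto
      have ha : h a = 0 := by simp [hh]
      rw [ha] at this
      exact this.mono_left nhdsWithin_le_nhds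
    have h1 : Tendsto (fun t => h t * Real.exp (G t)) (𝓝[>] a) (𝓝 0) := by
      refine tendsto_of_tendsto_of_tendsto_of_le_of_le' tendsto_const_nhds h0 ?_ ?_
      · filter_upwards [self_mem_nhdsWithin] with t ht
        exact (mul_pos (hhpos t ht) (Real.exp_pos _)).le
      · filter_upwards [Ioc_mem_nhdsGT hab] with t ht
        exact mul_le_of_le_one_right (hhpos t ht.1).le (Real.exp_le_one_iff.2 (hG0 t ht))
    have h2 : Tendsto (fun t : ℝ => x₀ + l * t) (𝓝[>] a) (𝓝 (x₀ + l * a)) :=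
      ((by fun_prop : Continuous fun t : ℝ => x₀ + l * t).tendsto a).mono_left nhdsWithin_le_nhds
    simpa using h2.sub h1
  · intro t ht
    obtain ⟨hη1, hctrl⟩ := hηc t ht
    have hηt := hη0 t ht.1
    have hht := hhpos t ht.1
    have hht' := hhle t ht
    have hE1 : Real.exp (G t) ≤ 1 := Real.exp_le_one_iff.2 (hG0 t ht)
    have hE0 := Real.exp_pos (G t)
    set E := Real.exp (G t) with hE
    have hδ : h t * E ≤ h t := mul_le_of_le_one_right hht.le hE1
    have hcb : c * (1 + (b - a)) = 1 / 2 := by rw [hc]; field_simp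
    have hδη : h t * E ≤ η t ^ 2 / 2 := by
      have : c * ((b - a) * η t ^ 2) ≤ η t ^ 2 / 2 := by nlinarith [sq_nonneg (η t)]
      linarith
    obtain ⟨k1, k2, k3⟩ := hctrl (h t * E) (mul_pos hht hE0).le (by nlinarith)
    have hdiv : h t * (E * (1 / η t)) = h t * E / η t := by ring
    have hfirst : 0 < c * η t ^ 2 * E := by positivity
    have hsum : c * η t ^ 2 * E + h t * E / η t ≤ η t / 2 := by
      have h1 : c * η t ^ 2 * E ≤ c * η t := by
        have : η t ^ 2 * E ≤ η t := by nlinarith [mul_pos hηt hE0]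
        nlinarith
      have h2 : h t * E / η t ≤ c * (b - a) * η t := by
        rw [div_le_iff₀ hηt]
        nlinarith
      nlinarith
    refine ⟨?_, k1, ?_, ?_⟩
    · have h1 := (hd t).mul ((hGd t ht.1).exp)
      have h2 := ((hasDerivAt_id t).const_mul l).const_add x₀
      exact (h2.sub h1).congr_deriv (by rw [mul_one])
    · change α (t, x₀ + l * t - h t * E) < l - (c * η t ^ 2 * E + h t * (E * (1 / η t)))
      rw [hdiv]
      linarith
    · change l - (c * η t ^ 2 * E + h t * (E * (1 / η t))) < β (t, x₀ + l * t - h t * E)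
      rw [hdiv]
      linarith

end Approach

/-- In a domain for which `{t = 0}` is a Cauchy hypersurface, null lines extend to the past as long
as they do not cross `{t = 0}`. -/
lemma mem_of_null_segment {Ω : Set (ℝ × ℝ)} {α β : ℝ × ℝ → ℝ} (hΩ : IsOpen Ω)
    (hα : ContDiffOn ℝ 1 α Ω) (hβ : ContDiffOn ℝ 1 β Ω) (hαβ : ∀ q ∈ Ω, α q < β q)
    (hC : IsConeCauchy Ω α β) {x₀ l a b : ℝ} (ha : 0 ≤ a) (hab : a < b)
    (hN : ∀ t ∈ Ioc a b, (t, x₀ + l * t) ∈ Ω ∧ β (t, x₀ + l * t) = l) :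
    (a, x₀ + l * a) ∈ Ω := by
  -- If the end point is missing, the approaching timelike curve has no past end point in `Ω`.
  -- Continued maximally to the future it is inextendible, yet it stays at times greater than `a ≥
  -- 0` and never meets `{t = 0}`.
  by_contra hnot
  obtain ⟨x, x', hx', hlim, hx⟩ := exists_timelike_approach hΩ hα.continuousOn hβ hαβ hab hN
  have hbmem : b ∈ Ioc a b := ⟨hab, le_rfl⟩
  obtain ⟨hxb, hqΩ, hs1, hs2⟩ := hx b hbmem
  set q : ℝ × ℝ := (b, x b) with hq
  -- The field of slope `α + θ (β - α)` is timelike for `0 < θ < 1`, and this `θ` matches the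
  -- velocity at `b`, so the concatenated curve is `C¹`.
  set θ := (x' b - α q) / (β q - α q) with hθ
  have hden : 0 < β q - α q := by linarith [hαβ q hqΩ]
  have hθ0 : 0 < θ := div_pos (by linarith) hden
  have hθ1 : θ < 1 := (div_lt_one hden).2 (by linarith)
  have hθs : α q + θ * (β q - α q) = x' b := by
    rw [hθ, div_mul_cancel₀ _ hden.ne']; ring
  set v : ℝ × ℝ → ℝ × ℝ := fun p => (1, α p + θ * (β p - α p)) with hv
  have hvC : ContDiffOn ℝ 1 v Ω :=
    contDiffOn_const.prodMk (hα.add (contDiffOn_const.mul (hβ.sub hα)))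
  obtain ⟨J, γ, hJo, hJord, hbJ, hγb, hsol, hup, -⟩ := exists_maximal_isSolOn hΩ hvC hqΩ b
  have hγ1 : ∀ s ∈ J, (γ s).1 = s := IsSolOn.fst_eq hJord hsol hbJ (by rw [hγb])
  let I : Set ℝ := Ioc a b ∪ (J ∩ Ici b)
  let c : ℝ → ℝ × ℝ := fun s => if s ≤ b then (s, x s) else γ s
  let c' : ℝ → ℝ × ℝ := fun s => if s ≤ b then (1, x' s) else v (γ s)
  have hcl : ∀ s, s ≤ b → c s = (s, x s) := fun s hs => if_pos hs
  have hcr : ∀ s, b ≤ s → c s = γ s := fun s hs => by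
    rcases hs.eq_or_lt with rfl | hs
    · rw [hcl _ le_rfl, hγb]
    · exact if_neg (not_le.2 hs)
  have hvq : v q = (1, x' b) := by rw [hv]; simp only; rw [hθs]
  have hcl' : ∀ s, s ≤ b → c' s = (1, x' s) := fun s hs => if_pos hs
  have hcr' : ∀ s, b ≤ s → c' s = v (γ s) := fun s hs => by
    rcases hs.eq_or_lt with rfl | hs
    · rw [hcl' _ le_rfl, hγb, hvq]
    · exact if_neg (not_le.2 hs)
  have hIa : ∀ s ∈ I, a < s := by
    rintro s (hs | hs)
    · exact hs.1
    · exact hab.trans_le hs.2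
  have hIJ : ∀ s ∈ I, b ≤ s → s ∈ J := by
    rintro s (hs | hs) h
    · rw [le_antisymm hs.2 h]; exact hbJ
    · exact hs.1
  have hIord : I.OrdConnected := ⟨fun s hs r hr z hz => by
    rcases le_total z b with h | h
    · exact Or.inl ⟨(hIa s hs).trans_le hz.1, h⟩
    · exact Or.inr ⟨hJord.out hbJ (hIJ r hr (h.trans hz.2)) ⟨h, hz.2⟩, h⟩⟩
  have hbI : b ∈ I := Or.inl hbmem
  have hmI : (a + b) / 2 ∈ I := Or.inl ⟨by linarith, by linarith⟩
  have hc1 : ∀ s ∈ I, (c s).1 = s := fun s hs => by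
    rcases le_total s b with h | h
    · rw [hcl s h]
    · rw [hcr s h, hγ1 s (hIJ s hs h)]
  have hmaps : MapsTo c I Ω := fun s hs => by
    rcases le_total s b with h | h
    · rw [hcl s h]; exact (hx s ⟨hIa s hs, h⟩).2.1
    · rw [hcr s h]; exact (hsol s (hIJ s hs h)).1
  have hleft : ∀ s ∈ Ioc a b, HasDerivWithinAt c (c' s) (Iic b) s := fun s hs => by
    rw [hcl' s hs.2]
    exact ((hasDerivAt_id s).prodMk (hx s hs).1).hasDerivWithinAt.congr (fun r hr => hcl r hr)
      (hcl s hs.2)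
  have hright : ∀ s ∈ J ∩ Ici b, HasDerivWithinAt c (c' s) (Ici b) s := fun s hs => by
    rw [hcr' s hs.2]
    exact (hsol s hs.1).2.hasDerivWithinAt.congr (fun r hr => hcr r hr) (hcr s hs.2)
  have hderiv : ∀ s ∈ I, HasDerivAt c (c' s) s := fun s hs => by
    rcases lt_trichotomy s b with h | h | h
    · exact (hleft s ⟨hIa s hs, h.le⟩).hasDerivAt (Iic_mem_nhds h)
    · rw [h]
      have := (hleft b hbmem).union (hright b ⟨hbJ, self_mem_Ici⟩)
      rwa [Iic_union_Ici, hasDerivWithinAt_univ] at this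
    · exact (hright s ⟨hIJ s hs h.le, h.le⟩).hasDerivAt (Ici_mem_nhds h)
  have hcont : ContinuousOn c' I := by
    have h1 : ContinuousOn c' (Ioc a b) :=
      (continuousOn_const.prodMk hx').congr fun s hs => hcl' s hs.2
    have h2 : ContinuousOn c' (J ∩ Ici b) := by
      have : ContinuousOn (fun s => v (γ s)) J :=
        hvC.continuousOn.comp (fun s hs => (hsol s hs).2.continuousAt.continuousWithinAt)
          fun s hs => (hsol s hs).1
      exact (this.mono inter_subset_left).congr fun s hs => hcr' s hs.2
    intro s hs
    refine ContinuousWithinAt.union ?_ ?_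
    · by_cases h : s ∈ Ioc a b
      · exact h1 s h
      · have hbs : b < s := by
          by_contra h'
          exact h ⟨hIa s hs, not_lt.1 h'⟩
        refine continuousWithinAt_of_notMem_closure fun hcl => ?_
        exact absurd (closure_minimal (fun r hr => hr.2) isClosed_Iic hcl) (not_le.2 hbs)
    · by_cases h : s ∈ J ∩ Ici b
      · exact h2 s h
      · have hsb : s < b := by
          by_contra h'
          exact h ⟨hIJ s hs (not_lt.1 h'), not_lt.1 h'⟩
        refine continuousWithinAt_of_notMem_closure fun hcl => ?_
        exact absurd (closure_minimal (fun r hr => hr.2) isClosed_Ici hcl) (not_le.2 hsb)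
  have hcone : IsConeCurve α β I c := by
    refine ⟨c', hcont, fun s hs => ⟨(hderiv s hs).hasDerivWithinAt, ?_⟩⟩
    rcases le_total s b with h | h
    · obtain ⟨-, -, h1, h2⟩ := hx s ⟨hIa s hs, h⟩
      rw [hcl s h, hcl' s h]
      simp only [mul_one]
      exact mul_neg_of_pos_of_neg (by linarith) (by linarith)
    · have h1 := hαβ _ (hsol s (hIJ s hs h)).1
      rw [hcr s h, hcr' s h]
      simp only [hv, mul_one]
      exact mul_neg_of_pos_of_neg (by nlinarith) (by nlinarith)
  have hext : ¬ IsExtendible Ω I c := by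
    rintro (⟨p, hp, hl⟩ | ⟨p, hp, hl⟩)
    · have hmin : ∀ s ∈ I, ∃ r ∈ I, r < s := fun s hs => by
        have h0 := hIa s hs
        refine ⟨(a + min s b) / 2, Or.inl ⟨?_, ?_⟩, ?_⟩
        · linarith [lt_min h0 hab]
        · linarith [min_le_right s b]
        · linarith [min_le_left s b]
      obtain ⟨h1, ⟨b', hb', h2⟩, h3⟩ := limit_atBot_time ⟨b, hbI⟩ hIord hmin hc1 hl
      have hpa : p.1 = a := by
        refine le_antisymm ?_ ?_
        · by_contra h4
          rw [not_le] at h4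
          exact h1 (by
            rcases le_total p.1 b with h5 | h5
            · exact Or.inl ⟨h4, h5⟩
            · have h6 : (p.1 + b') / 2 ∈ I := h2 ⟨by linarith, by linarith⟩
              exact hIord.out hbI h6 ⟨h5, by linarith⟩)
        · by_contra h4
          rw [not_le] at h4
          have h6 : (p.1 + min b' a) / 2 ∈ I := h2
            ⟨by linarith [lt_min hb' h4], by linarith [min_le_left b' a, lt_min hb' h4]⟩
          linarith [hIa _ h6, min_le_right b' a]
      rw [hpa] at h3
      have hlim' : Tendsto c (𝓝[>] a) (𝓝 (a, x₀ + l * a)) := by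
        have h4 : Tendsto (fun s : ℝ => s) (𝓝[>] a) (𝓝 a) := nhdsWithin_le_nhds
        refine (h4.prodMk_nhds hlim).congr' ?_
        filter_upwards [Ioc_mem_nhdsGT hab] with s hs using (hcl s hs.2).symm
      exact hnot (tendsto_nhds_unique hlim' h3 ▸ hp)
    · have hmax : ∀ s ∈ I, ∃ r ∈ I, s < r := fun s hs => by
        rcases lt_or_ge s b with h | h
        · exact ⟨b, hbI, h⟩
        · obtain ⟨r, hr, hsr⟩ := exists_gt_of_isOpen hJo s (hIJ s hs h)
          exact ⟨r, Or.inr ⟨hr, h.trans hsr.le⟩, hsr⟩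
      obtain ⟨h1, ⟨a', ha', h2⟩, h3⟩ := limit_atTop_time ⟨b, hbI⟩ hIord hmax hc1 hl
      have hbp : b < p.1 := by
        by_contra h4
        rw [not_lt] at h4
        have h5 : (max a' a + p.1) / 2 < p.1 → a < p.1 → False := fun _ h6 => h1 (Or.inl ⟨h6, h4⟩)
        have h6 : (a' + p.1) / 2 ∈ I := h2 ⟨by linarith, by linarith⟩
        exact h1 (Or.inl ⟨by linarith [hIa _ h6], h4⟩)
      have h4 : Tendsto γ (𝓝[<] p.1) (𝓝 p) := by
        refine h3.congr' ?_
        filter_upwards [Ioo_mem_nhdsLT hbp] with s hs using hcr s hs.1.le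
      have h5 : p.1 ∈ J := by
        refine hup p.1 p hp ⟨max a' b, max_lt ha' hbp, fun s hs => ?_⟩ h4
        exact hIJ s (h2 ⟨(le_max_left _ _).trans_lt hs.1, hs.2⟩)
          ((le_max_right _ _).trans hs.1.le)
      exact h1 (Or.inr ⟨h5, hbp.le⟩)
  obtain ⟨s, ⟨hs, h0⟩, -⟩ := hC I c hIord ⟨_, hmI, b, hbI, by linarith⟩ hmaps hcone hext
  rw [hc1 s hs] at h0
  linarith [hIa s hs]

/-! ### Reflections and null segments -/

lemma IsConeCauchy.symm {Ω : Set (ℝ × ℝ)} {α β : ℝ × ℝ → ℝ} (h : IsConeCauchy Ω α β) :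
    IsConeCauchy Ω β α := by
  intro I γ h1 h2 h3 ⟨γ', h4, h5⟩ h6
  exact h I γ h1 h2 h3 ⟨γ', h4, fun s hs => ⟨(h5 s hs).1, by
    rw [mul_comm]; exact (h5 s hs).2⟩⟩ h6

/-- For signs `e₁`, `e₂` the reflection multiplies slopes by `e₁ e₂`. This reduces both families of
null lines, in both time directions, to one configuration. -/
lemma IsConeCauchy.reflect {Ω : Set (ℝ × ℝ)} {α β : ℝ × ℝ → ℝ} (h : IsConeCauchy Ω α β)
    {e₁ e₂ : ℝ} (he₁ : e₁ * e₁ = 1) (he₂ : e₂ * e₂ = 1) :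
    IsConeCauchy {q | (e₁ * q.1, e₂ * q.2) ∈ Ω} (fun q => e₁ * e₂ * α (e₁ * q.1, e₂ * q.2))
      (fun q => e₁ * e₂ * β (e₁ * q.1, e₂ * q.2)) := by
  intro I γ h1 h2 h3 ⟨γ', h4, h5⟩ h6
  have hinv : ∀ q : ℝ × ℝ, (e₁ * (e₁ * q.1), e₂ * (e₂ * q.2)) = q := fun q => by
    rw [← mul_assoc, ← mul_assoc, he₁, he₂, one_mul, one_mul]
  have hcont : Continuous fun q : ℝ × ℝ => (e₁ * q.1, e₂ * q.2) := by fun_prop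
  have hext : ∀ l : Filter I, (∃ q ∈ Ω, Tendsto (fun s : I => (e₁ * (γ s).1, e₂ * (γ s).2)) l (𝓝 q))
      → ∃ q ∈ {q : ℝ × ℝ | (e₁ * q.1, e₂ * q.2) ∈ Ω}, Tendsto (fun s : I => γ s) l (𝓝 q) := by
    rintro l ⟨q, hq, hl⟩
    refine ⟨(e₁ * q.1, e₂ * q.2), by change (_, _) ∈ Ω; rwa [hinv], ?_⟩
    exact ((hcont.tendsto q).comp hl).congr fun s => hinv (γ s)
  have hcone : IsConeCurve α β I (fun s => (e₁ * (γ s).1, e₂ * (γ s).2)) := by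
    refine ⟨fun s => (e₁ * (γ' s).1, e₂ * (γ' s).2), hcont.comp_continuousOn h4,
      fun s hs => ⟨?_, ?_⟩⟩
    · have h7 := (h5 s hs).1
      have h8 := (ContinuousLinearMap.fst ℝ ℝ ℝ).hasFDerivAt.comp_hasDerivWithinAt s h7
      have h9 := (ContinuousLinearMap.snd ℝ ℝ ℝ).hasFDerivAt.comp_hasDerivWithinAt s h7
      exact (h8.const_mul e₁).prodMk (h9.const_mul e₂)
    · have h7 := (h5 s hs).2
      have h8 : ∀ a : ℝ, e₂ * (γ' s).2 - a * (e₁ * (γ' s).1) =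
          e₂ * ((γ' s).2 - e₁ * e₂ * a * (γ' s).1) := fun a => by
        linear_combination (e₁ * a * (γ' s).1) * he₂
      simp only [h8]
      rw [mul_mul_mul_comm, he₂, one_mul]
      exact h7
  obtain ⟨s, ⟨hs, hs0⟩, huniq⟩ := h I _ h1 h2 (fun s hs => h3 hs) hcone
    fun hx => h6 (hx.imp (hext _) (hext _))
  have e₁0 : e₁ ≠ 0 := fun h0 => by simp [h0] at he₁
  refine ⟨s, ⟨hs, (mul_eq_zero.1 hs0).resolve_left e₁0⟩, fun r hr => huniq r ⟨hr.1, ?_⟩⟩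
  change e₁ * (γ r).1 = 0
  rw [hr.2, mul_zero]

/-- The line of slope `l` through `p`, parametrized by the proportion of the time of `p`. -/
def line (p : ℝ × ℝ) (l s : ℝ) : ℝ × ℝ := (s * p.1, p.2 - l * ((1 - s) * p.1))

lemma line_one (p : ℝ × ℝ) (l : ℝ) : line p l 1 = p := by simp [line]

lemma line_zero (p : ℝ × ℝ) (l : ℝ) : line p l 0 = (0, p.2 - l * p.1) := by simp [line]

lemma hasDerivAt_line (p : ℝ × ℝ) (l s : ℝ) :
    HasDerivAt (line p l) (p.1 • ((1, l) : ℝ × ℝ)) s := by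
  refine (((hasDerivAt_id s).mul_const p.1).prodMk
    (((((hasDerivAt_id s).const_sub 1).mul_const p.1).const_mul l).const_sub p.2)).congr_deriv ?_
  ext <;> simp [mul_comm]

lemma continuous_line (p : ℝ × ℝ) (l : ℝ) : Continuous (line p l) := by
  unfold line; fun_prop

/-- Null segments joining a point to `{t = 0}` stay in a domain for which `{t = 0}` is a Cauchy
hypersurface. -/
lemma line_mem {Ω : Set (ℝ × ℝ)} {α β : ℝ × ℝ → ℝ} (hΩ : IsOpen Ω) (hα : ContDiffOn ℝ 1 α Ω)
    (hβ : ContDiffOn ℝ 1 β Ω) {σ : ℝ} (hσ : σ * σ = 1) (hlt : ∀ q ∈ Ω, σ * α q < σ * β q)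
    (hC : IsConeCauchy Ω α β) {p : ℝ × ℝ} (hp : p ∈ Ω) {l : ℝ}
    (hl : ∀ s ≤ 1, (∀ u ∈ Icc s 1, line p l u ∈ Ω) → β (line p l s) = l) :
    ∀ s ∈ Icc (0 : ℝ) 1, line p l s ∈ Ω := by
  rcases eq_or_ne p.1 0 with h0 | h0
  · intro s _
    have : line p l s = p := by ext <;> simp [line, h0]
    rwa [this]
  obtain ⟨e, he, hep⟩ : ∃ e : ℝ, e * e = 1 ∧ 0 < e * p.1 := by
    rcases h0.lt_or_gt with h | h
    · exact ⟨-1, by norm_num, by linarith⟩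
    · exact ⟨1, by norm_num, by linarith⟩
  by_contra! hbad
  -- At the last parameter `r` at which the segment is outside `Ω`, the half open segment after it
  -- is inside, which is the situation of `mem_of_null_segment`.
  let S := Icc (0 : ℝ) 1 ∩ line p l ⁻¹' Ωᶜ
  have hS : IsCompact S :=
    isCompact_Icc.inter_right (hΩ.isClosed_compl.preimage (continuous_line p l))
  obtain ⟨r, ⟨hr01, hrbad⟩, hrmax⟩ := hS.exists_isGreatest (by
    obtain ⟨s, hs, h⟩ := hbad
    exact ⟨s, hs, h⟩)
  have hgood : ∀ u ∈ Ioc r 1, line p l u ∈ Ω := fun u hu => by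
    by_contra h
    exact absurd (hrmax ⟨⟨hr01.1.trans hu.1.le, hu.2⟩, h⟩) (not_le.2 hu.1)
  have hr1 : r < 1 := hr01.2.lt_of_ne fun h => hrbad (by rwa [h, line_one])
  -- The sign `e` brings `p` to positive time, and `σ e` in the second coordinate multiplies slopes
  -- by `e * (σ e) = σ`, so that the reflected `α` lies below the reflected `β`.
  set T : ℝ × ℝ → ℝ × ℝ := fun q => (e * q.1, σ * e * q.2) with hT
  have hTsmooth : ContDiff ℝ 1 T := by rw [hT]; fun_prop
  have he2 : σ * e * (σ * e) = 1 := by linear_combination e * e * hσ + he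
  have hsign : e * (σ * e) = σ := by linear_combination σ * he
  have key : ∀ t, T (t, σ * e * (p.2 - l * p.1) + σ * l * t) = line p l (t / (e * p.1)) :=
      fun t => by
    have e0 : e ≠ 0 := (left_ne_zero_of_mul hep.ne')
    have he' : e = 1 / e := by rw [eq_div_iff e0, he]
    simp only [hT, line]
    ext
    · simp only
      field_simp
      linear_combination t * he
    · simp only
      have h1 : t / (e * p.1) * p.1 = e * t := by
        field_simp
        linear_combination -t * he
      linear_combination (p.2 - l * p.1) * he2 + l * e * t * hσ - l * h1
  have hreflect := hC.reflect he he2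
  refine hrbad ?_
  have hmem := mem_of_null_segment (x₀ := σ * e * (p.2 - l * p.1)) (l := σ * l)
    (a := r * (e * p.1)) (b := e * p.1) (hΩ.preimage hTsmooth.continuous)
    (contDiffOn_const.mul (hα.comp hTsmooth.contDiffOn fun q hq => hq))
    (contDiffOn_const.mul (hβ.comp hTsmooth.contDiffOn fun q hq => hq))
    (fun q hq => by rw [hsign]; exact hlt _ hq) hreflect (mul_nonneg hr01.1 hep.le)
    (by nlinarith) fun t ht => ?_
  · have := key (r * (e * p.1))
    rw [mul_div_cancel_right₀ _ hep.ne'] at this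
    rw [← this]
    exact hmem
  · have hu : t / (e * p.1) ∈ Ioc r 1 := ⟨by rw [lt_div_iff₀ hep]; exact ht.1,
      by rw [div_le_one hep]; exact ht.2⟩
    have h1 := hl _ hu.2 fun u hu' => hgood u ⟨hu.1.trans_le hu'.1, hu'.2⟩
    refine ⟨?_, ?_⟩
    · change T _ ∈ Ω
      rw [key]
      exact hgood _ hu
    · change e * (σ * e) * β (T _) = _
      rw [key, h1, hsign]

/-! ### The characteristic equation on a globally hyperbolic development -/

section Development

variable {Ω : Set (ℝ × ℝ)} {Φ : ℝ × ℝ → ℝ}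

lemma IsDevelopment.contDiffOn_dt (h : IsDevelopment Ω Φ) : ContDiffOn ℝ ∞ (dt Φ) Ω :=
  (h.smooth.fderiv_of_isOpen (m := ∞) h.isOpen le_rfl).clm_apply contDiffOn_const

lemma IsDevelopment.contDiffOn_dx (h : IsDevelopment Ω Φ) : ContDiffOn ℝ ∞ (dx Φ) Ω :=
  (h.smooth.fderiv_of_isOpen (m := ∞) h.isOpen le_rfl).clm_apply contDiffOn_const

lemma IsDevelopment.contDiffOn_psi (h : IsDevelopment Ω Φ) : ContDiffOn ℝ ∞ (psi Φ) Ω :=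
  h.contDiffOn_dt.sub (contDiffOn_const.mul h.contDiffOn_dx)

lemma IsDevelopment.hasFDerivAt (h : IsDevelopment Ω Φ) {q : ℝ × ℝ} (hq : q ∈ Ω) :
    HasFDerivAt Φ (fderiv ℝ Φ q) q :=
  ((h.smooth.contDiffAt (h.isOpen.mem_nhds hq)).differentiableAt (by simp)).hasFDerivAt

lemma IsDevelopment.hasFDerivAt_psi (h : IsDevelopment Ω Φ) {q : ℝ × ℝ} (hq : q ∈ Ω) :
    HasFDerivAt (psi Φ) (fderiv ℝ (psi Φ) q) q :=
  ((h.contDiffOn_psi.contDiffAt (h.isOpen.mem_nhds hq)).differentiableAt (by simp)).hasFDerivAt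

lemma IsDevelopment.psi_initial (h : IsDevelopment Ω Φ) (x : ℝ) :
    psi Φ (0, x) = -Real.arctan x := by
  have h1 := (h.hasFDerivAt (h.line_subset x)).comp_hasDerivAt x
    ((hasDerivAt_const x (0 : ℝ)).prodMk (hasDerivAt_id x))
  have h2 : Φ ∘ Prod.mk 0 = fun _ => 0 := funext fun x => h.data_zero x
  have h3 : dx Φ (0, x) = 0 := by
    rw [h2] at h1
    exact h1.unique (hasDerivAt_const x _)
  rw [psi, h.data_one, h3]
  ring

/-- `Ψ` is transported along the outgoing characteristics. -/
lemma IsDevelopment.fderiv_psi (h : IsDevelopment Ω Φ) {q : ℝ × ℝ} (hq : q ∈ Ω) :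
    dt (psi Φ) q + (2 + psi Φ q) * dx (psi Φ) q = 0 := by
  have hn := h.isOpen.mem_nhds hq
  have hd1 : DifferentiableAt ℝ (dt Φ) q :=
    (h.contDiffOn_dt.contDiffAt hn).differentiableAt (by simp)
  have hd2 : DifferentiableAt ℝ (dx Φ) q :=
    (h.contDiffOn_dx.contDiffAt hn).differentiableAt (by simp)
  have hD : DifferentiableAt ℝ (fderiv ℝ Φ) q :=
    ((h.smooth.fderiv_of_isOpen (m := ∞) h.isOpen le_rfl).contDiffAt hn).differentiableAt (by simp)
  have hψ : fderiv ℝ (psi Φ) q = fderiv ℝ (dt Φ) q - (2 : ℝ) • fderiv ℝ (dx Φ) q := by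
    have := hd1.hasFDerivAt.sub (hd2.hasFDerivAt.const_mul 2)
    exact this.fderiv
  have hsymm : dt (dx Φ) q = dx (dt Φ) q := by
    have h1 := (h.smooth.contDiffAt hn).isSymmSndFDerivAt
      (by rw [minSmoothness_of_isRCLikeNormedField]; exact WithTop.coe_le_coe.2 le_top)
      (1, 0) (0, 1)
    have h2 : ∀ v w : ℝ × ℝ, fderiv ℝ (fun q => fderiv ℝ Φ q v) q w = fderiv ℝ (fderiv ℝ Φ) q w v :=
      fun v w => by
        rw [(hD.hasFDerivAt.clm_apply (hasFDerivAt_const v q)).fderiv]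
        simp
    exact (h2 _ _).trans (h1.trans (h2 _ _).symm)
  have h3 := h.equation q hq
  have h4 : dt (psi Φ) q = dt (dt Φ) q - 2 * dt (dx Φ) q := by
    simp only [dt, hψ]; simp
  have h5 : dx (psi Φ) q = dx (dt Φ) q - 2 * dx (dx Φ) q := by
    simp only [dx, hψ]; simp
  rw [h4, h5]
  -- The wave equation is `-L Ψ = 0` once the mixed derivatives are interchanged.
  linear_combination -h3 + (2 + psi Φ q) * (-hsymm)

/-- `Ψ` is constant on segments of outgoing characteristics. -/
lemma IsDevelopment.psi_line (h : IsDevelopment Ω Φ) {p : ℝ × ℝ} {s : ℝ} (hs : s ≤ 1)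
    (hmem : ∀ u ∈ Icc s 1, line p (2 + psi Φ p) u ∈ Ω) :
    psi Φ (line p (2 + psi Φ p) s) = psi Φ p := by
  set l := 2 + psi Φ p with hl
  -- The slope `l` of the segment differs from the characteristic slope by exactly `Ψ - Ψ(p)`, so
  -- this difference solves a homogeneous linear equation and vanishes at parameter 1. Grönwall's
  -- inequality, applied below with the parameter reversed, makes it zero.
  have hd : ∀ u ∈ Icc s 1, HasDerivAt (fun u => psi Φ (line p l u) - psi Φ p)
      (-(p.1 * dx (psi Φ) (line p l u)) * (psi Φ (line p l u) - psi Φ p)) u := fun u hu => by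
    have h1 := ((h.hasFDerivAt_psi (hmem u hu)).comp_hasDerivAt u
      (hasDerivAt_line p l u)).sub_const (psi Φ p)
    refine h1.congr_deriv ?_
    have h2 := h.fderiv_psi (hmem u hu)
    have h3 : ((1, l) : ℝ × ℝ) = (1, 0) + l • (0, 1) := by ext <;> simp
    rw [map_smul, h3, map_add, map_smul]
    change p.1 * (dt (psi Φ) (line p l u) + l * dx (psi Φ) (line p l u)) = _
    linear_combination p.1 * h2 + p.1 * dx (psi Φ) (line p l u) * hl
  have hcx : ContinuousOn (fun u => p.1 * dx (psi Φ) (line p l u)) (Icc s 1) := by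
    have h1 : ContinuousOn (dx (psi Φ)) Ω :=
      ((h.contDiffOn_psi.fderiv_of_isOpen (m := ∞) h.isOpen le_rfl).clm_apply
        contDiffOn_const).continuousOn
    exact continuousOn_const.mul (h1.comp (continuous_line p l).continuousOn hmem)
  obtain ⟨K, hK⟩ := isCompact_Icc.exists_bound_of_continuousOn hcx
  have hrev : ∀ w ∈ Icc (0 : ℝ) (1 - s), 1 - w ∈ Icc s 1 := fun w hw =>
    ⟨by linarith [hw.2], by linarith [hw.1]⟩
  have hd' : ∀ w ∈ Icc (0 : ℝ) (1 - s), HasDerivAt (fun w => psi Φ (line p l (1 - w)) - psi Φ p)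
      (p.1 * dx (psi Φ) (line p l (1 - w)) * (psi Φ (line p l (1 - w)) - psi Φ p)) w := fun w hw =>
    ((hd _ (hrev w hw)).comp w ((hasDerivAt_id w).const_sub 1)).congr_deriv (by simp)
  have h0 := eq_zero_of_abs_deriv_le_mul_abs_self_of_eq_zero_right (K := K)
    (fun w hw => (hd' w hw).continuousAt.continuousWithinAt)
    (fun w hw => (hd' w (Ico_subset_Icc_self hw)).hasDerivWithinAt)
    (by rw [sub_zero, line_one, sub_self])
    (fun w hw => by
      rw [norm_mul]
      exact mul_le_mul_of_nonneg_right (hK _ (hrev w (Ico_subset_Icc_self hw))) (norm_nonneg _))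
    (1 - s) ⟨by linarith, le_rfl⟩
  rw [sub_sub_cancel] at h0
  linarith

lemma IsGHD.isConeCauchy (h : IsGHD Ω Φ) :
    IsConeCauchy Ω (fun q => 2 + psi Φ q) (fun _ => -2) :=
  (isCauchyHypersurface_iff fun q hq => ne_of_isLorentzian (h.lorentzian q hq)).1 h.cauchy

/-- Being Lorentzian only gives `Ψ ≠ -4`. The slope `Ψ / 2` is the mean of `-2` and `2 + Ψ`, hence
timelike whichever is larger. A maximal integral curve meets `{t = 0}`, where `Ψ > -4`, and the sign
of `Ψ + 4` cannot change along it. -/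
lemma IsGHD.neg_four_lt_psi (h : IsGHD Ω Φ) {q : ℝ × ℝ} (hq : q ∈ Ω) : -4 < psi Φ q := by
  have hψ := h.contDiffOn_psi
  have hv : ContDiffOn ℝ 1 (fun q => ((1 : ℝ), psi Φ q / 2)) Ω :=
    contDiffOn_const.prodMk ((hψ.of_le (by simp)).div_const 2)
  obtain ⟨J, γ, hJ, hord, htJ, hγ0, hsol, hup, hlow⟩ :=
    exists_maximal_isSolOn h.isOpen hv hq q.1
  have hfst := hsol.fst_eq hord htJ (by rw [hγ0])
  have hne : ∀ s ∈ J, psi Φ (γ s) ≠ -4 := fun s hs =>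
    ne_of_isLorentzian (h.lorentzian _ (hsol s hs).1)
  have hγc : ContinuousOn γ J := fun s hs => (hsol s hs).2.continuousAt.continuousWithinAt
  have hψc : ContinuousOn (fun s => psi Φ (γ s)) J :=
    hψ.continuousOn.comp hγc fun s hs => (hsol s hs).1
  obtain ⟨r, hr, hlt⟩ := exists_gt_of_isOpen hJ _ htJ
  obtain ⟨s, ⟨hs, hs0⟩, -⟩ := h.isConeCauchy J γ hord ⟨_, htJ, r, hr, hlt.ne⟩
    (fun s hs => (hsol s hs).1)
    ⟨fun s => (1, psi Φ (γ s) / 2), continuousOn_const.prodMk (hψc.div_const 2), fun s hs =>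
      ⟨(hsol s hs).2.hasDerivWithinAt, by
        have : 0 < (psi Φ (γ s) + 4) ^ 2 := by
          have : psi Φ (γ s) + 4 ≠ 0 := fun h0 => hne s hs (by linarith)
          positivity
        simp only
        nlinarith⟩⟩ (by
      rintro (⟨p, hp, hlim⟩ | ⟨p, hp, hlim⟩)
      · obtain ⟨h1, h2, h3⟩ :=
          limit_atBot_time ⟨_, htJ⟩ hord (exists_lt_of_isOpen hJ) hfst hlim
        exact h1 (hlow _ p hp h2 h3)
      · obtain ⟨h1, h2, h3⟩ :=
          limit_atTop_time ⟨_, htJ⟩ hord (exists_gt_of_isOpen hJ) hfst hlim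
        exact h1 (hup _ p hp h2 h3))
  have h0 : -4 < psi Φ (γ s) := by
    have : γ s = (0, (γ s).2) := Prod.ext hs0 rfl
    rw [this, h.psi_initial]
    linarith [speed_pos (γ s).2]
  rcases pos_or_neg_of_ne_zero (f := fun s => psi Φ (γ s) + 4) hord (hψc.add continuousOn_const)
    (fun s hs h0 => hne s hs (by linarith)) with h1 | h1
  · have h2 := h1 _ htJ
    simp only [hγ0] at h2
    linarith
  · have h2 := h1 s hs
    linarith

lemma IsGHD.outgoing_line_mem (h : IsGHD Ω Φ) {p : ℝ × ℝ} (hp : p ∈ Ω) :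
    ∀ s ∈ Icc (0 : ℝ) 1, line p (2 + psi Φ p) s ∈ Ω :=
  line_mem h.isOpen contDiffOn_const (contDiffOn_const.add (h.contDiffOn_psi.of_le (by simp)))
    (σ := 1) (by norm_num) (fun q hq => by linarith [h.neg_four_lt_psi hq]) h.isConeCauchy.symm hp
    fun s hs hu => by rw [h.psi_line hs hu]

lemma IsGHD.ingoing_line_mem (h : IsGHD Ω Φ) {p : ℝ × ℝ} (hp : p ∈ Ω) :
    ∀ s ∈ Icc (0 : ℝ) 1, line p (-2) s ∈ Ω :=
  line_mem h.isOpen (contDiffOn_const.add (h.contDiffOn_psi.of_le (by simp))) contDiffOn_const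
    (σ := -1) (by norm_num) (fun q hq => by linarith [h.neg_four_lt_psi hq]) h.isConeCauchy hp
    fun _ _ _ => rfl

/-- The foot on `{t = 0}` of the outgoing characteristic through `q`. -/
def foot (Φ : ℝ × ℝ → ℝ) (q : ℝ × ℝ) : ℝ := q.2 - (2 + psi Φ q) * q.1

lemma IsGHD.psi_eq (h : IsGHD Ω Φ) {p : ℝ × ℝ} (hp : p ∈ Ω) :
    psi Φ p = -Real.arctan (foot Φ p) := by
  have h1 := h.psi_line zero_le_one (h.outgoing_line_mem hp)
  rw [line_zero, h.psi_initial] at h1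
  exact h1.symm

/-- Differentiating `Ψ = -arctan (x - (2 + Ψ) t)` in `x` gives `∂ₓΨ (1 - t / (1 + y²)) = -1 / (1 +
y²)`, which is impossible when the left factor vanishes. -/
lemma IsGHD.time_ne (h : IsGHD Ω Φ) {p : ℝ × ℝ} (hp : p ∈ Ω) : p.1 ≠ 1 + foot Φ p ^ 2 := by
  intro ht
  have h1 := h.hasFDerivAt_psi hp
  have hy : HasFDerivAt (foot Φ) (ContinuousLinearMap.snd ℝ ℝ ℝ -
      ((2 + psi Φ p) • ContinuousLinearMap.fst ℝ ℝ ℝ + p.1 • fderiv ℝ (psi Φ) p)) p :=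
    hasFDerivAt_snd.sub ((h1.const_add 2).mul hasFDerivAt_fst)
  have h2 := ((Real.hasDerivAt_arctan (foot Φ p)).comp_hasFDerivAt p hy).neg
  have h3 : psi Φ =ᶠ[𝓝 p] -(Real.arctan ∘ foot Φ) :=
    eventually_of_mem (h.isOpen.mem_nhds hp) fun q hq => h.psi_eq hq
  have h4 := congrArg (fun A : ℝ × ℝ →L[ℝ] ℝ => A (0, 1)) (h1.unique (h2.congr_of_eventuallyEq h3))
  simp only [neg_apply, smul_apply,
    sub_apply, add_apply, smul_eq_mul,
    ContinuousLinearMap.coe_fst', ContinuousLinearMap.coe_snd'] at h4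
  rw [ht] at h4
  have h5 : 1 + foot Φ p ^ 2 ≠ 0 := by positivity
  field_simp at h4
  have : (1 : ℝ) = 0 := by linear_combination h4
  exact one_ne_zero this

/-- Beyond the focusing time, the same characteristic traced back to `{t = 0}` would pass through
its focusing point inside `Ω`. -/
lemma IsGHD.time_lt (h : IsGHD Ω Φ) {p : ℝ × ℝ} (hp : p ∈ Ω) : p.1 < 1 + foot Φ p ^ 2 := by
  by_contra! hge
  have hpos : 0 < 1 + foot Φ p ^ 2 := by positivity
  have hp1 : 0 < p.1 := hpos.trans_le hge
  set s := (1 + foot Φ p ^ 2) / p.1 with hs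
  have hs01 : s ∈ Icc (0 : ℝ) 1 := ⟨by positivity, by rw [hs, div_le_one hp1]; exact hge⟩
  have hmem := h.outgoing_line_mem hp
  have h1 := h.psi_line hs01.2 fun u hu => hmem u ⟨hs01.1.trans hu.1, hu.2⟩
  have h2 : foot Φ (line p (2 + psi Φ p) s) = foot Φ p := by
    rw [foot, h1, foot, line]
    ring
  refine h.time_ne (hmem s hs01) ?_
  rw [h2]
  simp only [line, hs]
  field_simp

lemma IsGHD.char_foot (h : IsGHD Ω Φ) {p : ℝ × ℝ} (hp : p ∈ Ω) : char (foot Φ p) p.1 = p := by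
  rw [char, psi0, ← h.psi_eq hp, foot]
  ext
  · rfl
  · simp only
    ring

/-- If `x + 2t ≥ 4`, the ingoing segment starts on `{t = 0}` at a foot `≥ 4` and ends at a foot `≤
0`, so it crosses the characteristic with label 0. There `x = 2t` and `t < 1`, so `x + 2t < 4`,
although `x + 2t` is constant on the segment. -/
lemma IsGHD.ingoing_lt (h : IsGHD Ω Φ) {p : ℝ × ℝ} (hp : p ∈ Ω) (hy : foot Φ p ≤ 0) :
    p.2 + 2 * p.1 < 4 := by
  by_contra! hge
  have hmem := h.ingoing_line_mem hp
  have hc : ContinuousOn (fun s => foot Φ (line p (-2) s)) (Icc 0 1) := by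
    have : ContinuousOn (foot Φ) Ω := continuousOn_snd.sub
      ((continuousOn_const.add h.contDiffOn_psi.continuousOn).mul continuousOn_fst)
    exact this.comp (continuous_line p _).continuousOn hmem
  obtain ⟨s, hs, h0⟩ := intermediate_value_Icc' zero_le_one hc (show (0 : ℝ) ∈ _ by
    refine ⟨?_, ?_⟩
    · simpa only [line_one] using hy
    · simp only [line_zero, foot]
      linarith)
  have h1 := h.time_lt (hmem s hs)
  have h2 := h.psi_eq (hmem s hs)
  simp only at h0
  rw [h0] at h1 h2
  rw [foot, h2, Real.arctan_zero] at h0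
  simp only [line] at h0 h1
  linarith

lemma IsGHD.mem_omegaC (h : IsGHD Ω Φ) {p : ℝ × ℝ} (hp : p ∈ Ω) :
    p ∈ OmegaC ∧ psi Φ p = psi sol p := by
  have h1 : (foot Φ p, p.1) ∈ openLabels := by
    refine ⟨h.time_lt hp, ?_⟩
    rcases lt_or_ge 0 (foot Φ p) with hy | hy
    · exact Or.inl hy
    · right
      rw [← char_ingoingCoord, h.char_foot hp]
      exact h.ingoing_lt hp hy
  obtain ⟨h2, h3⟩ := char_mem_omegaC h1
  rw [h.char_foot hp] at h2 h3
  exact ⟨h2, by rw [psi_sol (omegaC_subset_smoothDomain h2), h3, h.psi_eq hp]⟩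

/-- Both functions have the same `Ψ`, which is their derivative along ingoing lines, and both vanish
where these lines meet `{t = 0}`. -/
lemma IsGHD.eqOn_sol (h : IsGHD Ω Φ) : EqOn Φ sol Ω := by
  intro p hp
  have hmem := h.ingoing_line_mem hp
  have hd : ∀ s ∈ Icc (0 : ℝ) 1,
      HasDerivAt (fun s => Φ (line p (-2) s) - sol (line p (-2) s)) 0 s :=
    fun s hs => by
      obtain ⟨h1, h2⟩ := h.mem_omegaC (hmem s hs)
      have h3 := (h.hasFDerivAt (hmem s hs)).comp_hasDerivAt s (hasDerivAt_line p (-2) s)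
      have h4 := (isDevelopment_sol.hasFDerivAt h1).comp_hasDerivAt s (hasDerivAt_line p (-2) s)
      refine (h3.sub h4).congr_deriv ?_
      have h5 : ((1, -2) : ℝ × ℝ) = (1, 0) - (2 : ℝ) • (0, 1) := by ext <;> simp
      rw [map_smul, map_smul, h5, map_sub, map_sub, map_smul, map_smul]
      simp only [psi, dt, dx, smul_eq_mul] at h2 ⊢
      rw [h2]
      ring
  have h1 := constant_of_has_deriv_right_zero
    (fun s hs => (hd s hs).continuousAt.continuousWithinAt)
    (fun s hs => (hd s (Ico_subset_Icc_self hs)).hasDerivWithinAt) 1 ⟨zero_le_one, le_rfl⟩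
  simp only [line_one, line_zero, h.data_zero, isDevelopment_sol.data_zero] at h1
  linarith

end Development

lemma isMGHD_sol : IsMGHD OmegaC sol :=
  ⟨isGHD_sol, fun ⟨_, _, h, hsub, _⟩ => hsub.2 fun _ hp => (h.mem_omegaC hp).1⟩

lemma IsMGHD.eq_omegaC {Ω : Set (ℝ × ℝ)} {Φ : ℝ × ℝ → ℝ} (h : IsMGHD Ω Φ) :
    Ω = OmegaC ∧ EqOn Φ sol OmegaC := by
  have hsub : Ω ⊆ OmegaC := fun _ hp => (h.1.mem_omegaC hp).1
  have hE := h.1.eqOn_sol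
  have heq : Ω = OmegaC := by
    by_contra hne
    exact h.2 ⟨OmegaC, sol, isGHD_sol, hsub.ssubset_of_ne hne, hE.symm⟩
  exact ⟨heq, heq ▸ hE⟩

end ShockMGHD

end

theorem theorem1 :
    ∃ Φ : ℝ × ℝ → ℝ,
      -- existence
      (IsOpen OmegaC ∧ OmegaC ≠ univ ∧ IsDevelopment OmegaC Φ ∧
        (∀ q ∈ OmegaC, psi Φ q ∈ Ioo (-(Real.pi / 2)) (Real.pi / 2)) ∧
        (∀ q ∈ OmegaC, IsLorentzian (acousticMetric (psi Φ q)))) ∧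
      -- uniqueness
      (IsMGHD OmegaC Φ ∧
        ∀ (Ω' : Set (ℝ × ℝ)) (Φ' : ℝ × ℝ → ℝ), IsMGHD Ω' Φ' →
          Ω' = OmegaC ∧ EqOn Φ' Φ OmegaC) ∧
      -- the boundary: decomposition, submanifolds, connectedness
      (frontier OmegaC = singBdry ∪ {initSing} ∪ cauchyHor ∧
        Disjoint singBdry {initSing} ∧ Disjoint singBdry cauchyHor ∧
        Disjoint {initSing} cauchyHor ∧
        IsSubmanifold 1 singBdry ∧ IsSubmanifold 2 {initSing} ∧ IsSubmanifold 1 cauchyHor ∧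
        IsConnected singBdry ∧ IsConnected {initSing} ∧ IsConnected cauchyHor ∧
        IsConnected (frontier OmegaC)) ∧
      -- parametrization of the singular boundary
      (singBdry = singCurve '' Ioi 0 ∧ initSing = singCurve 0) ∧
      -- both curves emanate from the initial singularity
      (closure cauchyHor \ cauchyHor = {initSing} ∧ closure singBdry \ singBdry = {initSing}) ∧
      -- regularity of the extension of the solution to the boundary
      (∃ Φe : ℝ × ℝ → ℝ, EqOn Φe Φ OmegaC ∧
        IsSmoothOn Φe (OmegaC ∪ cauchyHor) ∧
        IsC1HolderNear (1 / 3) (closure OmegaC) Φe initSing ∧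
        ∀ p ∈ singBdry, IsC1HolderNear (1 / 2) (closure OmegaC) Φe p) ∧
      -- sharpness of this regularity
      (∀ F : ℝ × ℝ → ℝ, EqOn F Φ OmegaC →
        (∀ α : ℝ≥0, 1 / 3 < α → ¬ IsC1HolderNear α (closure OmegaC) F initSing) ∧
        (∀ p ∈ singBdry, ∀ α : ℝ≥0, 1 / 2 < α → ¬ IsC1HolderNear α (closure OmegaC) F p)) ∧
      -- blow-up of the second derivatives
      (∀ p ∈ singBdry ∪ {initSing}, ∀ u : ℕ → ℝ × ℝ, (∀ n, u n ∈ OmegaC) →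
        Tendsto u atTop (𝓝 p) →
        Tendsto (fun n => ‖iteratedFDeriv ℝ 2 Φ (u n)‖) atTop atTop) ∧
      -- the extended acoustical metric `g` and the extended vector field `L`
      ∃ (g : ℝ × ℝ → Matrix (Fin 2) (Fin 2) ℝ) (L : ℝ × ℝ → ℝ × ℝ),
        (ContinuousOn g (closure OmegaC) ∧
          EqOn g (fun q => acousticMetric (psi Φ q)) OmegaC ∧
          (∀ q ∈ closure OmegaC, IsLorentzian (g q)) ∧
          (∀ i j, IsHolderNear (1 / 3) (closure OmegaC) (fun q => g q i j) initSing) ∧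
          (∀ p ∈ singBdry, ∀ i j,
            IsHolderNear (1 / 2) (closure OmegaC) (fun q => g q i j) p) ∧
          (∀ i j, IsSmoothOn (fun q => g q i j) (OmegaC ∪ cauchyHor))) ∧
        (ContinuousOn L (closure OmegaC) ∧
          EqOn L (fun q => outgoing (psi Φ q)) OmegaC ∧
          IsHolderNear (1 / 3) (closure OmegaC) L initSing ∧
          (∀ p ∈ singBdry, IsHolderNear (1 / 2) (closure OmegaC) L p) ∧
          (∀ p ∈ singBdry ∪ {initSing}, form (g p) (L p) (L p) = 0)) ∧
        -- the Cauchy horizon and the singular boundary are null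
        ((∀ p ∈ cauchyHor, IsTangent cauchyHor p ingoing) ∧ IsNullCurve g cauchyHor ∧
          (∀ p ∈ singBdry, IsTangent singBdry p (L p)) ∧ IsNullCurve g singBdry) ∧
        -- non-uniqueness of the backward integral curves of `L` on the singular boundary
        (∀ p ∈ singBdry, ∃ a > 0, ∃ γ₁ γ₂ : ℝ → ℝ × ℝ,
          IsBackwardIntegralCurve L a γ₁ ∧ γ₁ 0 = p ∧
          IsBackwardIntegralCurve L a γ₂ ∧ γ₂ 0 = p ∧
          MapsTo γ₁ (Ioc (-a) 0) singBdry ∧ MapsTo γ₂ (Ioo (-a) 0) OmegaC ∧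
          ∀ s ∈ Ioo (-a) 0, γ₁ s ≠ γ₂ s) := by
  refine ⟨sol, ⟨isOpen_omegaC, omegaC_ne_univ, isDevelopment_sol, fun q hq => ?_, fun q hq => ?_⟩,
    ⟨isMGHD_sol, fun _ _ h => h.eq_omegaC⟩,
    ⟨frontier_omegaC, disjoint_singBdry_initSing, disjoint_singBdry_cauchyHor,
      disjoint_initSing_cauchyHor, isSubmanifold_singBdry, isSubmanifold_initSing,
      isSubmanifold_cauchyHor, isConnected_singBdry, isConnected_singleton, isConnected_cauchyHor,
      isConnected_frontier⟩,
    ⟨singBdry_eq_image, initSing_eq⟩, ⟨closure_cauchyHor_diff, closure_singBdry_diff⟩,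
    ⟨sol, fun _ _ => rfl, isSmoothOn_of_contDiffOn contDiffOn_sol,
      isC1HolderNear_sol (isHolderNear_initSing contDiff_solDeriv),
      fun p hp => isC1HolderNear_sol (isHolderNear_singBdry contDiff_solDeriv hp)⟩,
    fun F hF => ⟨fun α hα => not_isC1HolderNear_initSing hF hα,
      fun p hp α hα => not_isC1HolderNear_singBdry hF hα hp⟩,
    fun p hp u hu hlim => tendsto_norm_iteratedFDeriv_sol hp hu hlim, extMetric, extOutgoing,
    ⟨continuousOn_extMetric, extMetric_eqOn,
      fun q _ => isLorentzian_acousticMetric (neg_arctan_ne _),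
      fun i j => isHolderNear_initSing (f := fun w => acousticMetric (-Real.arctan w.1) i j)
        (((contDiff_acousticMetric i j).of_le (by simp)).comp contDiff_fst),
      fun p hp i j => isHolderNear_singBdry (f := fun w => acousticMetric (-Real.arctan w.1) i j)
        (((contDiff_acousticMetric i j).of_le (by simp)).comp contDiff_fst) hp,
      fun i j => isSmoothOn_of_contDiffOn
        ((contDiff_acousticMetric i j).comp_contDiffOn contDiffOn_label)⟩,
    ⟨contDiff_outgoing.continuous.comp_continuousOn continuousOn_label, extOutgoing_eqOn,
      isHolderNear_initSing (f := fun w => outgoing (-Real.arctan w.1))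
        ((contDiff_outgoing.of_le (by simp)).comp contDiff_fst),
      fun p hp => isHolderNear_singBdry (f := fun w => outgoing (-Real.arctan w.1))
        ((contDiff_outgoing.of_le (by simp)).comp contDiff_fst) hp,
      fun p _ => form_extMetric_eq_zero (Or.inl ?_)⟩,
    ⟨fun p hp => isTangent_cauchyHor hp, isNullCurve_cauchyHor,
      fun p hp => isTangent_singBdry hp, isNullCurve_singBdry⟩,
    fun p hp => exists_backward_integral_curves hp⟩
  · rw [psi_sol (omegaC_subset_smoothDomain hq)]
    exact ⟨neg_lt_neg (Real.arctan_lt_pi_div_two _),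
      by linarith [Real.neg_pi_div_two_lt_arctan (label q)]⟩
  · rw [psi_sol (omegaC_subset_smoothDomain hq)]
    exact isLorentzian_acousticMetric (neg_arctan_ne _)
  · simp only [extOutgoing, outgoing]
    ring
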